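/- Let $p$ be a prime, $n\ge 1$ an integer, $W$ the ring of integers of a finite unramified extension field of $\mathbb{Q}_p$, and $R=W[[x_1,\dots,x_{n-1}]]$. Let $S=W[[x_1,\dots,x_{n-1},y_1,\dots,y_{n-1}]]$ be the completion of $R\otimes_W R$, with the two inclusions $r\mapsto r\otimes 1$ ($x_i\mapsto x_i$) and $r\mapsto 1\otimes r$ ($x_i\mapsto y_i$) of $R$, and regard $R$ as an $S$-module through the completed multiplication map $S\to R$, $x_i\mapsto x_i$, $y_i\mapsto x_i$. Put $L=\operatorname{Tor}^S_{n-1}(R,R)$, and let $\mathbb{Z}/p^\infty=\mathbb{Q}_p/\mathbb{Z}_p$. Then: (1) $L$ is a free $R$-module of rank one. (2) Every ring automorphism $\sigma$ of $R$ induces a unique automorphism $\sigma\otimes\sigma$ of $S$ that is compatible with $\sigma$ under the two inclusions $R\to S$ and the multiplication map $S\to R$; hence $\sigma$ acts on $L$, by functoriality of $\operatorname{Tor}$ for semilinear maps. Write $\sigma_*:L\to L$ for this action. (3) For all $R$-modules $M$ of finite length there are $R$-linear isomorphisms $$\Phi_M:\; L\otimes_R\operatorname{Ext}^n_R(M,R)\;\cong\;\operatorname{Hom}_{\mathbb{Z}_p}(M,\mathbb{Z}/p^\infty),$$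 where $R$ acts on the right-hand side by $(rf)(m)=f(rm)$, which are natural with respect to skew homomorphisms. That is, let $(\sigma,\tau):M\to M'$ be a skew homomorphism between finite length modules: $\sigma$ is a ring automorphism of $R$ and $\tau:M\to M'$ is an additive map with $\tau(rm)=\sigma(r)\tau(m)$. Let $(\sigma,\tau)^*:\operatorname{Ext}^n_R(M',R)\to\operatorname{Ext}^n_R(M,R)$ be the induced map, the one which in degree $0$ is $f\mapsto\sigma^{-1}\circ f\circ\tau$. Then for all $l\in L$, $e\in\operatorname{Ext}^n_R(M',R)$ and $m\in M$, $$\Phi_M\bigl(l\otimes(\sigma,\tau)^*e\bigr)(m)=\Phi_{M'}\bigl(\sigma_*l\otimes e\bigr)(\tau(m)).$$ -/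

import Mathlib

universe u

open CategoryTheory MonoidalCategory
open scoped TensorProduct

noncomputable section

namespace GrossHopkins

section Tor

variable {S : Type u} [CommRing S]

/-- A semilinear map `M → M'` over a ring automorphism `e`, as a linear map from `M` to the
restriction of scalars of `M'` along `e`. -/
def twistHom (e : S ≃+* S) {M M' : ModuleCat.{u} S} (f : M →ₛₗ[(e : S →+* S)] M') :
    M ⟶ (ModuleCat.restrictScalars.{u} e.toRingHom).obj M' :=
  ModuleCat.ofHom (Y := (ModuleCat.restrictScalars.{u} e.toRingHom).obj M')
    { toFun := f, map_add' := f.map_add, map_smul' := f.map_smulₛₗ }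

instance restrictScalars_preservesProjectiveObjects (e : S ≃+* S) :
    (ModuleCat.restrictScalars.{u} e.toRingHom).PreservesProjectiveObjects :=
  Functor.preservesProjectiveObjects_of_adjunction_of_preservesEpimorphisms
    (ModuleCat.restrictScalars.{u} e.toRingHom).asEquivalence.toAdjunction

/-- For a ring automorphism `e` of `S`, write `e^*` for restriction of scalars along `e`.  This is
the natural map `e^* A ⊗ e^* X ⟶ e^* (A ⊗ X)`, `a ⊗ x ↦ a ⊗ x`. -/
def twistTensor (e : S ≃+* S) (A : ModuleCat.{u} S) :
    ModuleCat.restrictScalars.{u} e.toRingHom ⋙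
        (tensoringLeft (ModuleCat.{u} S)).obj
          ((ModuleCat.restrictScalars.{u} e.toRingHom).obj A) ⟶
      (tensoringLeft (ModuleCat.{u} S)).obj A ⋙ ModuleCat.restrictScalars.{u} e.toRingHom where
  app X := Functor.LaxMonoidal.μ (ModuleCat.restrictScalars.{u} e.toRingHom) A X
  naturality _ _ f :=
    Functor.LaxMonoidal.μ_natural_right (ModuleCat.restrictScalars.{u} e.toRingHom) A f

/-- The comparison map `Tor_d^S(e^* A, e^* B) ⟶ e^* Tor_d^S(A, B)`: if `P` is a projective
resolution of `B`, then `e^* P` is one of `e^* B`, and the map is induced on homology by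
`e^* A ⊗ e^* P ⟶ e^* (A ⊗ P)`, `a ⊗ x ↦ a ⊗ x`. -/
def torTwist (e : S ≃+* S) (d : ℕ) (A B : ModuleCat.{u} S) :
    ((Tor (ModuleCat.{u} S) d).obj ((ModuleCat.restrictScalars.{u} e.toRingHom).obj A)).obj
        ((ModuleCat.restrictScalars.{u} e.toRingHom).obj B) ⟶
      (ModuleCat.restrictScalars.{u} e.toRingHom).obj
        (((Tor (ModuleCat.{u} S) d).obj A).obj B) :=
  let E := ModuleCat.restrictScalars.{u} e.toRingHom
  let P := projectiveResolution B
  ((E.mapProjectiveResolution P).isoLeftDerivedObj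
      ((tensoringLeft (ModuleCat.{u} S)).obj (E.obj A)) d).hom ≫
    (HomologicalComplex.homologyFunctor (ModuleCat.{u} S) (ComplexShape.down ℕ) d).map
      ((NatTrans.mapHomologicalComplex (twistTensor e A) (ComplexShape.down ℕ)).app P.complex) ≫
    (((((tensoringLeft (ModuleCat.{u} S)).obj A).mapHomologicalComplex
        (ComplexShape.down ℕ)).obj P.complex).sc d |>.mapHomologyIso E).hom ≫
    E.map (P.isoLeftDerivedObj ((tensoringLeft (ModuleCat.{u} S)).obj A) d).inv

/-- Functoriality of `Tor` for semilinear maps: `f : A → A` and `g : B → B`, semilinear over a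
ring automorphism `e` of `S`, induce an `e`-semilinear endomorphism of `Tor_d^S(A, B)`. -/
def torSemilinear (e : S ≃+* S) (d : ℕ) {A B : ModuleCat.{u} S}
    (f : A →ₛₗ[(e : S →+* S)] A) (g : B →ₛₗ[(e : S →+* S)] B) :
    ((Tor (ModuleCat.{u} S) d).obj A).obj B ⟶
      (ModuleCat.restrictScalars.{u} e.toRingHom).obj
        (((Tor (ModuleCat.{u} S) d).obj A).obj B) :=
  ((Tor (ModuleCat.{u} S) d).map (twistHom e f)).app B ≫
    ((Tor (ModuleCat.{u} S) d).obj _).map (twistHom e g) ≫ torTwist e d A B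

end Tor

section Ext

variable {R : Type u} [CommRing R]

/-- The map `Ext^n_R(M', R) → Ext^n_R(M, R)` induced by a skew homomorphism `(σ, τ) : M → M'`.
In degree zero it sends `f : M' → R` to `σ⁻¹ ∘ f ∘ τ`. -/
def extSkew (σ : R ≃+* R) {M M' : ModuleCat.{u} R} (τ : M →ₛₗ[(σ : R →+* R)] M') (n : ℕ)
    (e : Abelian.Ext.{u} M' (ModuleCat.of R R) n) :
    Abelian.Ext.{u} M (ModuleCat.of R R) n :=
  (Abelian.Ext.mk₀ (twistHom σ τ)).comp
    ((e.mapExactFunctor (ModuleCat.restrictScalars.{u} σ.toRingHom)).comp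
      (Abelian.Ext.mk₀ (ModuleCat.restrictScalarsIsoOfEquiv σ).hom) (add_zero n)) (zero_add n)

end Ext

section PowerSeries

variable (W : Type u) [CommRing W] (d : ℕ)

/-- The ring `R = W⟦x_1, …, x_d⟧`. -/
abbrev PS : Type u := MvPowerSeries (Fin d) W

/-- The ring `S = W⟦x_1, …, x_d, y_1, …, y_d⟧`, the completion of `R ⊗_W R`.  The variable `x_i` is
indexed by `Sum.inl i` and `y_i` by `Sum.inr i`. -/
abbrev PS₂ : Type u := MvPowerSeries (Fin d ⊕ Fin d) W

/-- `R → S`, `x_i ↦ x_i`, i.e. `r ↦ r ⊗ 1`. -/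
def inclLeft : PS W d →+* PS₂ W d := (MvPowerSeries.rename (R := W) Sum.inl).toRingHom

/-- `R → S`, `x_i ↦ y_i`, i.e. `r ↦ 1 ⊗ r`. -/
def inclRight : PS W d →+* PS₂ W d := (MvPowerSeries.rename (R := W) Sum.inr).toRingHom

/-- The completed multiplication map `S → R`, `x_i ↦ x_i`, `y_i ↦ x_i`. -/
def diag : PS₂ W d →+* PS W d := (MvPowerSeries.rename (R := W) (Sum.elim id id)).toRingHom

/-- `R` as an `S`-module through the completed multiplication map. -/
abbrev diagModule : ModuleCat.{u} (PS₂ W d) :=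
  (ModuleCat.restrictScalars.{u} (diag W d)).obj (ModuleCat.of (PS W d) (PS W d))

/-- `L = Tor_d^S(R, R)` as an `R`-module, `R` acting on the first argument: as `inclLeft` is a
section of `diag`, this is the restriction along `inclLeft` of the `S`-module `Tor_d^S(R, R)`. -/
abbrev twistModule : ModuleCat.{u} (PS W d) :=
  (ModuleCat.restrictScalars.{u} (inclLeft W d)).obj
    (((Tor (ModuleCat.{u} (PS₂ W d)) d).obj (diagModule W d)).obj (diagModule W d))

variable {W d}

/-- `σ₂` is the automorphism `σ ⊗ σ` of `S` (the completion of `R ⊗_W R`) induced by the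
automorphism `σ` of `R`: it is compatible with the two inclusions of `R` and with the completed
multiplication map. -/
structure IsDiagonalLift (σ : PS W d ≃+* PS W d) (σ₂ : PS₂ W d ≃+* PS₂ W d) : Prop where
  left : ∀ r, σ₂ (inclLeft W d r) = inclLeft W d (σ r)
  right : ∀ r, σ₂ (inclRight W d r) = inclRight W d (σ r)
  diag : ∀ s, GrossHopkins.diag W d (σ₂ s) = σ (GrossHopkins.diag W d s)

/-- `σ : R → R` as a map of `S`-modules, semilinear over `σ₂ = σ ⊗ σ`. -/
def diagSemilinear {σ : PS W d ≃+* PS W d} {σ₂ : PS₂ W d ≃+* PS₂ W d}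
    (h : IsDiagonalLift σ σ₂) :
    diagModule W d →ₛₗ[(σ₂ : PS₂ W d →+* PS₂ W d)] diagModule W d where
  toFun := fun r : PS W d => (σ r : PS W d)
  map_add' := fun a b : PS W d => map_add σ a b
  map_smul' := fun (s : PS₂ W d) (a : PS W d) => by
    change σ (GrossHopkins.diag W d s * a) = GrossHopkins.diag W d (σ₂ s) * σ a
    rw [map_mul, h.diag]

/-- The action of an automorphism `σ` of `R` on `L = Tor_d^S(R, R)`, through its actions `σ ⊗ σ`
on `S` and `σ` on both arguments. -/
def twistAction {σ : PS W d ≃+* PS W d} {σ₂ : PS₂ W d ≃+* PS₂ W d}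
    (h : IsDiagonalLift σ σ₂) (l : twistModule W d) : twistModule W d :=
  (torSemilinear σ₂ d (diagSemilinear h) (diagSemilinear h)).hom l

end PowerSeries

section Pontryagin

variable (p : ℕ) [Fact p.Prime]

/-- `ℤ/p^∞ = ℚ_p / ℤ_p`, as a `ℤ_p`-module. -/
abbrev ZModPInfty : Type :=
  ℚ_[p] ⧸ LinearMap.range (Algebra.linearMap ℤ_[p] ℚ_[p])

variable {R : Type u} [CommRing R] [Algebra ℤ_[p] R]

/-- `Hom_{ℤ_p}(M, ℤ/p^∞)` for a module `M` over a `ℤ_p`-algebra `R`. -/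
def PontryaginDual (M : ModuleCat.{u} R) : Type u :=
  (ModuleCat.restrictScalars.{u} (algebraMap ℤ_[p] R)).obj M →ₗ[ℤ_[p]] ZModPInfty p

instance (M : ModuleCat.{u} R) : AddCommGroup (PontryaginDual p M) :=
  inferInstanceAs (AddCommGroup
    ((ModuleCat.restrictScalars.{u} (algebraMap ℤ_[p] R)).obj M →ₗ[ℤ_[p]] ZModPInfty p))

instance (M : ModuleCat.{u} R) : FunLike (PontryaginDual p M) M (ZModPInfty p) :=
  inferInstanceAs (FunLike
    ((ModuleCat.restrictScalars.{u} (algebraMap ℤ_[p] R)).obj M →ₗ[ℤ_[p]] ZModPInfty p) _ _)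

variable {p}

/-- Multiplication by `r` on `M`, as a `ℤ_p`-linear map. -/
def mulLeft (M : ModuleCat.{u} R) (r : R) :
    (ModuleCat.restrictScalars.{u} (algebraMap ℤ_[p] R)).obj M →ₗ[ℤ_[p]]
      (ModuleCat.restrictScalars.{u} (algebraMap ℤ_[p] R)).obj M :=
  ((ModuleCat.restrictScalars.{u} (algebraMap ℤ_[p] R)).map
    (ModuleCat.ofHom (LinearMap.lsmul R M r))).hom

variable (p)

/-- `R` acts on `Hom_{ℤ_p}(M, ℤ/p^∞)` by `(r • f)(m) = f(r • m)`. -/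
instance (M : ModuleCat.{u} R) : Module R (PontryaginDual p M) where
  smul r f := LinearMap.comp f (mulLeft M r)
  one_smul f := LinearMap.ext fun m : M => congrArg (fun x : M => f x) (one_smul R m)
  mul_smul r s f := LinearMap.ext fun m : M =>
    congrArg (fun x : M => f x) ((mul_comm r s ▸ mul_smul s r m : (r * s) • m = s • r • m))
  smul_zero _ := rfl
  smul_add _ _ _ := rfl
  add_smul r s f := LinearMap.ext fun m : M =>
    (congrArg (fun x : M => f x) (add_smul r s m)).trans (LinearMap.map_add f (r • m) (s • m))
  zero_smul f := LinearMap.ext fun m : M =>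
    (congrArg (fun x : M => f x) (zero_smul R m)).trans (LinearMap.map_zero f)

end Pontryagin

end GrossHopkins

end

/-! Write `d = n - 1`, and call the two copies of `R` in `S` left (variables `x_i`) and right
(variables `y_i`). The kernel of `S → R` is generated by the sequence `x_i - y_i`. It is regular on
`S ⊗_R M` (tensor product over the right copy) for every `R`-module `M`, and the quotient is `M`.
The Koszul extension of this sequence is a class in `Ext_S^d(M, S ⊗_R M)`, natural in `M`: the
fundamental class `fundClass`. For `M = R`, cap product with it is an isomorphism `L → R`
(`isIso_cap_ringClass`), which is (1).

The duality is built in the direction from forms to extensions (`theta`). As `W` is unramified, its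
separability idempotent turns a form `f : M → ℚ_p/ℤ_p` canonically into a `W`-linear map from `M` to
`W ⊗ ℚ_p/ℤ_p`. If the variables act nilpotently on `M`, then `S ⊗_R M` is in effect `W⟦x⟧ ⊗_W M`, so
this map extends to a left linear map from `S ⊗_R M` to `R ⊗ ℚ_p/ℤ_p`. Composing the fundamental
class, restricted to the left copy of `R`, with this map and with the class of `0 → R → R ⊗ ℚ_p → R
⊗ ℚ_p/ℤ_p → 0` gives `theta f` in `Ext_R^{d+1}(M, R)`. For a simple module, a Koszul argument for
`p, x_1, …, x_d` shows that the lower `Ext` groups vanish and that `Ext^{d+1}` is a line over the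
residue field; `theta` is then bijective (`IsResidueGenerator.theta_bijective`). The case of finite
length follows by dévissage (`IsDualizable.extension`), since `ℚ_p/ℤ_p` is injective. Finally `Φ_M(l
⊗ theta f) = cap(l) • f`.

For skew homomorphisms, the only ingredient of `theta` that is not canonical is the fundamental
class, which depends on the generators `x_i - y_i`. But a Koszul class is universal: classes in
`Ext^d` of a module killed by the diagonal ideal are pulled back from it along unique maps. Hence
the classes before and after restriction along `σ ⊗ σ` differ by a map, and testing on `R → M` shows
that this map is multiplication by one scalar `v ∈ R`, the same for all modules
(`exists_fundClass_comp_skewBaseChange`). The same `v` describes the action on `L`, by `σ(cap l) = v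
* cap(σ_* l)` (`map_cap_ringClass`), so it cancels in `Φ`.

For (2), `σ` preserves the maximal ideal, and it carries constants to constants because `W` is
unramified. So `σ ⊗ σ` can be defined by evaluating power series, and is determined by its values on
constants and variables. -/

noncomputable section

namespace GrossHopkins

/-! ### Yoneda products of Koszul type and their universal properties -/

section ExtGeneralities

open Abelian Limits

universe w v u₁ v₁ w₁ u₂ v₂ w₂ u₃ v₃ w₃

variable {C : Type u₁} [Category.{v₁} C] [Abelian C] [HasExt.{w₁} C]
variable {D : Type u₂} [Category.{v₂} D] [Abelian D] [HasExt.{w₂} D]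

/-- `e : Ext A N d` is universal for `X` if every class in `Ext X N d` is the pullback of `e` along
a unique map `X ⟶ A`, and the groups `Ext X N j` vanish for `j < d`. -/
structure IsUniversalFrom (X : C) {A N : C} {d : ℕ} (e : Ext A N d) : Prop where
  exists_eq : ∀ y : Ext X N d, ∃ f : X ⟶ A, (Ext.mk₀ f).comp e (zero_add d) = y
  eq_of_eq : ∀ f g : X ⟶ A, (Ext.mk₀ f).comp e (zero_add d) = (Ext.mk₀ g).comp e (zero_add d) →
    f = g
  vanish : ∀ (j : ℕ) (_ : j < d) (y : Ext X N j), y = 0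

/-- The classes obtained as iterated Yoneda products of extensions `0 → N → N → N₁ → 0` whose first
map satisfies `P`. -/
inductive KoszulClass (P : ∀ N : C, (N ⟶ N) → Prop) : ∀ {A N : C} {d : ℕ}, Ext A N d → Prop
  | iso {A N : C} (φ : A ⟶ N) (hφ : IsIso φ) : KoszulClass P (Ext.mk₀ φ)
  | step {A N N₁ : C} {d : ℕ} (f : N ⟶ N) (g : N ⟶ N₁) (w : f ≫ g = 0)
      (hS : (ShortComplex.mk f g w).ShortExact) (hf : P N f) (e : Ext A N₁ d)
      (he : KoszulClass P e) : KoszulClass P (e.comp hS.extClass (rfl : d + 1 = d + 1))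

lemma IsUniversalFrom.iso (X : C) {A N : C} (φ : A ⟶ N) [IsIso φ] :
    IsUniversalFrom X (Ext.mk₀ φ) where
  exists_eq y := by
    obtain ⟨y, rfl⟩ := (Ext.mk₀_bijective X N).2 y
    exact ⟨y ≫ inv φ, by simp⟩
  eq_of_eq f g h := by
    simp only [Ext.mk₀_comp_mk₀] at h
    exact (cancel_mono φ).1 ((Ext.mk₀_bijective X N).1 h)
  vanish j hj := by omega

/-- Since `f` acts as zero on every `Ext^j(X, N)`, the connecting map `Ext^d(X, N₁) → Ext^{d+1}(X,
N)` is surjective. Its kernel comes from `Ext^d(X, N)`, which also vanishes: this is one more degree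
of vanishing than is known for `N₁`. -/
lemma IsUniversalFrom.step {X A N N₁ : C} {d : ℕ} {f : N ⟶ N} {g : N ⟶ N₁} {w : f ≫ g = 0}
    (hS : (ShortComplex.mk f g w).ShortExact)
    (hf : ∀ (j : ℕ) (y : Ext X N j), y.comp (Ext.mk₀ f) (add_zero j) = 0)
    {e : Ext A N₁ d} (he : IsUniversalFrom X e) :
    IsUniversalFrom X (e.comp hS.extClass (rfl : d + 1 = d + 1)) := by
  have key : ∀ (j : ℕ) (_ : j < d + 1) (y : Ext X N j), y = 0 := by
    intro j hj y
    cases j with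
    | zero =>
      -- In degree zero there is no connecting map to use; instead `f` is both zero on `Hom(X, N)`
      -- and a monomorphism.
      obtain ⟨y, rfl⟩ := (Ext.mk₀_bijective X N).2 y
      have h := hf 0 (Ext.mk₀ y)
      rw [Ext.mk₀_comp_mk₀, ← Ext.mk₀_zero] at h
      have h' := (Ext.mk₀_bijective X N).1 h
      have : Mono f := hS.mono_f
      have : y = 0 := by rwa [← cancel_mono f, zero_comp]
      rw [this, Ext.mk₀_zero]
    | succ j =>
      obtain ⟨x, hx⟩ := Ext.covariant_sequence_exact₁ X hS y (hf _ y) (rfl : j + 1 = j + 1)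
      rw [← hx, he.vanish j (by omega) x, Ext.zero_comp]
  refine ⟨fun y => ?_, fun a b hab => ?_, key⟩
  · obtain ⟨x, hx⟩ := Ext.covariant_sequence_exact₁ X hS y (hf _ y) (rfl : d + 1 = d + 1)
    obtain ⟨a, ha⟩ := he.exists_eq x
    refine ⟨a, ?_⟩
    rw [← hx, ← ha, Ext.comp_assoc _ _ _ _ _ (by omega)]
  · apply he.eq_of_eq
    rw [← sub_eq_zero]
    have h : ((Ext.mk₀ a).comp e (zero_add d) - (Ext.mk₀ b).comp e (zero_add d)).comp hS.extClass
        (rfl : d + 1 = d + 1) = 0 := by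
      rw [sub_eq_add_neg, Ext.add_comp, Ext.neg_comp, ← sub_eq_add_neg, sub_eq_zero,
        Ext.comp_assoc _ _ _ _ rfl (by omega), Ext.comp_assoc _ _ _ _ rfl (by omega)]
      exact hab
    obtain ⟨x, hx⟩ := Ext.covariant_sequence_exact₃ X hS _ rfl h
    rw [← hx, key d (by omega) x, Ext.zero_comp]

lemma KoszulClass.isUniversalFrom {P : ∀ N : C, (N ⟶ N) → Prop} {X : C}
    (hP : ∀ (N : C) (f : N ⟶ N), P N f →
      ∀ (j : ℕ) (y : Ext X N j), y.comp (Ext.mk₀ f) (add_zero j) = 0)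
    {A N : C} {d : ℕ} {e : Ext A N d} (he : KoszulClass P e) : IsUniversalFrom X e := by
  induction he with
  | iso φ hφ => exact IsUniversalFrom.iso X φ
  | step f g w hS hf e he ih => exact IsUniversalFrom.step hS (hP _ f hf) ih

/-- The dual argument, in the contravariant variable. The bound `t` is quantified because each
passage from `N` to `N₁` raises the top possibly nonzero degree of `Ext(-, X)` by one, and this top
degree is the one that is shifted isomorphically. For projective `N` it is used with `t = 0`. -/
lemma KoszulClass.couniversal {P : ∀ N : C, (N ⟶ N) → Prop} {X : C}
    (hP : ∀ (N : C) (f : N ⟶ N), P N f →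
      ∀ (j : ℕ) (y : Ext N X j), (Ext.mk₀ f).comp y (zero_add j) = 0)
    {A N : C} {d : ℕ} {e : Ext A N d} (he : KoszulClass P e) :
    ∀ (t : ℕ) (_ : ∀ (j : ℕ) (_ : t < j) (y : Ext N X j), y = 0),
      (∀ (j m : ℕ) (_ : t = j) (hm : d + j = m), Function.Bijective fun y : Ext N X j =>
        e.comp y hm) := by
  induction he with
  | @iso N φ hφ =>
    rintro t ht j m rfl hm
    obtain rfl : m = t := by omega
    refine Function.bijective_iff_has_inverse.2
      ⟨fun y => (Ext.mk₀ (inv φ)).comp y (zero_add m), fun y => ?_, fun y => ?_⟩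
    · dsimp only
      rw [← Ext.comp_assoc _ _ _ (zero_add 0) _ (by omega)]; simp
    · dsimp only
      rw [← Ext.comp_assoc _ _ _ (zero_add 0) _ (by omega)]; simp
  | @step N N₁ d f g w hS hf e he ih =>
    rintro t ht j m rfl hm
    have h1 : ∀ (j : ℕ) (_ : t + 1 < j) (y : Ext N₁ X j), y = 0 := by
      intro j hj y
      obtain ⟨x, hx⟩ := Ext.contravariant_sequence_exact₃ hS X y (ht j (by omega) _)
        (show 1 + (j - 1) = j by omega)
      rw [← hx, ht (j - 1) (by omega) x, Ext.comp_zero]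
    have h2 := ih (t + 1) h1 (t + 1) m rfl (by omega)
    -- Injective because `f` acts as zero on `Ext^t(N, X)`, surjective because `Ext^{t+1}(N, X)`
    -- vanishes.
    have h3 : Function.Bijective fun y : Ext N X t => hS.extClass.comp y (add_comm 1 t) := by
      refine ⟨fun a b hab => ?_, fun y => ?_⟩
      · dsimp only at hab
        rw [← sub_eq_zero]
        have h : hS.extClass.comp (a - b) (add_comm 1 t) = 0 := by
          rw [sub_eq_add_neg, Ext.comp_add, Ext.comp_neg, ← sub_eq_add_neg, sub_eq_zero, hab]
        obtain ⟨x, hx⟩ := Ext.contravariant_sequence_exact₁ hS X _ _ h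
        rw [← hx]
        exact hP N f hf _ x
      · exact Ext.contravariant_sequence_exact₃ hS X y (ht (t + 1) (by omega) _) (add_comm 1 t)
    have h4 := h2.comp h3
    convert h4 using 2 with y
    exact Ext.comp_assoc _ _ _ _ _ (by omega)

/-- Exact functors preserve extension classes and Yoneda products, so universality survives
restriction of scalars as soon as the scalars involved are controlled. -/
lemma KoszulClass.map {P : ∀ N : C, (N ⟶ N) → Prop} {P' : ∀ N : D, (N ⟶ N) → Prop}
    (F : C ⥤ D) [F.Additive] [PreservesFiniteLimits F] [PreservesFiniteColimits F]
    (hP : ∀ (N : C) (f : N ⟶ N), P N f → P' (F.obj N) (F.map f))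
    {A N : C} {d : ℕ} {e : Ext A N d} (he : KoszulClass P e) :
    KoszulClass P' (e.mapExactFunctor F) := by
  induction he with
  | iso φ hφ =>
    rw [Ext.mapExactFunctor_mk₀]
    exact KoszulClass.iso _ inferInstance
  | step f g w hS hf e he ih =>
    rw [Ext.mapExactFunctor_comp, Ext.mapExactFunctor_extClass]
    exact KoszulClass.step (F.map f) (F.map g) (by rw [← F.map_comp, w, F.map_zero])
      (hS.map_of_exact F) (hP _ _ hf) _ ih

lemma KoszulClass.iso_comp {P : ∀ N : C, (N ⟶ N) → Prop} {A A' N : C} {d : ℕ} {e : Ext A N d}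
    (he : KoszulClass P e) (φ : A' ⟶ A) [IsIso φ] :
    KoszulClass P ((Ext.mk₀ φ).comp e (zero_add d)) := by
  induction he with
  | iso ψ hψ =>
    rw [Ext.mk₀_comp_mk₀]
    exact KoszulClass.iso _ inferInstance
  | @step N N₁ d f g w hS hf e he ih =>
    rw [← Ext.comp_assoc _ _ _ (zero_add d) _ (by omega)]
    exact KoszulClass.step f g w hS hf _ ih

variable {E : Type u₃} [Category.{v₃} E] [Abelian E] [HasExt.{w₃} E]

universe u₄ v₄ w₄

variable {D' : Type u₄} [Category.{v₄} D'] [Abelian D'] [HasExt.{w₄} D']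

/-- A natural transformation between composites of exact functors is compatible with the induced
maps on `Ext`. -/
lemma mapExactFunctor_naturality [EnoughProjectives C]
    (F : C ⥤ D) (G : D ⥤ E) (H : C ⥤ D') (K : D' ⥤ E)
    [F.Additive] [PreservesFiniteLimits F] [PreservesFiniteColimits F]
    [G.Additive] [PreservesFiniteLimits G] [PreservesFiniteColimits G]
    [H.Additive] [PreservesFiniteLimits H] [PreservesFiniteColimits H]
    [K.Additive] [PreservesFiniteLimits K] [PreservesFiniteColimits K]
    (α : F ⋙ G ⟶ H ⋙ K) {X Y : C} {n : ℕ} (e : Ext X Y n) :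
    ((e.mapExactFunctor F).mapExactFunctor G).comp
        (Ext.mk₀ (X := G.obj (F.obj Y)) (Y := K.obj (H.obj Y)) (α.app Y)) (add_zero n) =
      (Ext.mk₀ (X := G.obj (F.obj X)) (Y := K.obj (H.obj X)) (α.app X)).comp
        ((e.mapExactFunctor H).mapExactFunctor K) (zero_add n) := by
  induction n generalizing X with
  | zero =>
    obtain ⟨e, rfl⟩ := (Ext.mk₀_bijective X Y).2 e
    simp only [Ext.mapExactFunctor_mk₀, Ext.mk₀_comp_mk₀]
    congr 1
    exact α.naturality e
  | succ n ih =>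
    -- Dimension shifting: a class of positive degree is a Yoneda product with the extension given
    -- by a projective cover of `X` by an epimorphism, and for extension classes the claim is
    -- naturality along `α`.
    let S : ShortComplex C := ShortComplex.mk (kernel.ι (Projective.π X)) (Projective.π X) (by simp)
    have hS : S.ShortExact :=
      { exact := ShortComplex.exact_of_f_is_kernel _ (kernelIsKernel _) }
    obtain ⟨e', rfl⟩ := Ext.contravariant_sequence_exact₃ hS Y e
      (Ext.eq_zero_of_projective _) (add_comm 1 n)
    have ih' := ih e'
    have hFG := (hS.map_of_exact F).map_of_exact G
    have hHK := (hS.map_of_exact H).map_of_exact K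
    have eFG : (hS.extClass.mapExactFunctor F).mapExactFunctor G = hFG.extClass :=
      (congrArg (Ext.mapExactFunctor G) (Ext.mapExactFunctor_extClass F hS)).trans
        (Ext.mapExactFunctor_extClass G (hS.map_of_exact F))
    have eHK : (hS.extClass.mapExactFunctor H).mapExactFunctor K = hHK.extClass :=
      (congrArg (Ext.mapExactFunctor K) (Ext.mapExactFunctor_extClass H hS)).trans
        (Ext.mapExactFunctor_extClass K (hS.map_of_exact H))
    let φ : (S.map F).map G ⟶ (S.map H).map K :=
      { τ₁ := α.app S.X₁
        τ₂ := α.app S.X₂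
        τ₃ := α.app S.X₃
        comm₁₂ := (α.naturality S.f).symm
        comm₂₃ := (α.naturality S.g).symm }
    have hn := ShortComplex.ShortExact.extClass_naturality hFG hHK φ
    rw [← eFG, ← eHK] at hn
    simp only [Ext.mapExactFunctor_comp]
    refine (Ext.comp_assoc _ _ _ _ (add_zero n) (by omega)).trans ?_
    refine (congrArg (fun t => Ext.comp ((hS.extClass.mapExactFunctor F).mapExactFunctor G) t
      (add_comm 1 n)) ih').trans ?_
    refine (Ext.comp_assoc _ _ _ (add_zero 1) _ (by omega)).symm.trans ?_
    refine (congrArg (fun t => Ext.comp t ((e'.mapExactFunctor H).mapExactFunctor K)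
      (add_comm 1 n)) hn).trans ?_
    exact Ext.comp_assoc _ _ _ _ _ (by omega)

end ExtGeneralities

end GrossHopkins
end

noncomputable section

namespace GrossHopkins

/-! ### Syzygies, cocycles and maps out of homology -/

section Cocycles

open Abelian Limits

universe u₁ v₁ w₁ u₂ v₂ w₂

variable {C : Type u₁} [Category.{v₁} C] [Abelian C]
variable {D : Type u₂} [Category.{v₂} D] [Abelian D]

/-- The sequence `opcycles (n + 1) → X n → opcycles n`. -/
abbrev syzygyComplex (K : ChainComplex C ℕ) (n : ℕ) : ShortComplex C :=
  ShortComplex.mk (K.fromOpcycles (n + 1) n) (K.pOpcycles n) (by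
    rw [← cancel_epi (K.pOpcycles (n + 1))]
    simp)

/-- The object `opcycles n` is the cokernel of the incoming differential, so for a resolution it is
the `n`-th syzygy. The kernel of `fromOpcycles (n + 1) n` is the homology in degree `n + 1`, whence
the one exactness hypothesis. -/
lemma syzygyComplex_shortExact (K : ChainComplex C ℕ) (n : ℕ) (hK : K.ExactAt (n + 1)) :
    (syzygyComplex K n).ShortExact where
  exact := by
    refine ShortComplex.exact_of_g_is_cokernel _ (CokernelCofork.IsColimit.ofπ' _ _ ?_)
    intro A k hk
    have hk' : K.d (n + 1) n ≫ k = 0 := by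
      dsimp at hk
      rw [← K.p_fromOpcycles, Category.assoc, hk, comp_zero]
    exact ⟨K.descOpcycles k (n + 1) (by simp) hk', by simp⟩
  mono_f := by
    have hn : (ComplexShape.down ℕ).next (n + 1) = n := by simp
    dsimp
    have hk := K.homologyIsKernel (n + 1) n (by simp)
    refine Preadditive.mono_of_cancel_zero _ fun {Z} f hf => ?_
    obtain ⟨l, hl⟩ := KernelFork.IsLimit.lift' hk f hf
    have h0 : l = 0 := (HomologicalComplex.exactAt_iff_isZero_homology _ _).1 hK |>.eq_of_tgt _ _
    rw [← hl, h0]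
    exact zero_comp

section

variable [HasExt.{w₁} C] (K : ChainComplex C ℕ) (hK : ∀ n, K.ExactAt (n + 1))

/-- The Yoneda product of the extensions of the syzygies of a resolution. -/
def syzygyClass : ∀ n : ℕ, Ext (K.opcycles 0) (K.opcycles n) n
  | 0 => Ext.mk₀ (𝟙 _)
  | n + 1 => (syzygyClass n).comp (syzygyComplex_shortExact K n (hK n)).extClass rfl

variable {K}

/-- Dimension shifting: positive `Ext` groups of the projective terms vanish, so each class factors
through the next syzygy. -/
lemma syzygyClass_comp_surjective (hproj : ∀ n, Projective (K.X n)) {Y : C} (n m : ℕ) {q : ℕ}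
    (hq : n + m = q) (y : Ext (K.opcycles 0) Y q) :
    ∃ y' : Ext (K.opcycles n) Y m, (syzygyClass K hK n).comp y' hq = y := by
  induction n generalizing m q with
  | zero =>
    obtain rfl : m = q := by omega
    exact ⟨y, by simp [syzygyClass]⟩
  | succ n ih =>
    obtain ⟨y', hy'⟩ := ih (m + 1) (by omega) y
    have := hproj n
    obtain ⟨y'', hy''⟩ := Ext.contravariant_sequence_exact₃
      (syzygyComplex_shortExact K n (hK n)) Y y' (Ext.eq_zero_of_projective _) (add_comm 1 m)
    refine ⟨y'', ?_⟩
    rw [← hy', ← hy'', syzygyClass]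
    exact Ext.comp_assoc _ _ _ _ _ (by omega)

/-- The condition `1 ≤ m` is essential: for `m = 0` the kernel of the shift consists of the
coboundaries. -/
lemma eq_zero_of_syzygyClass_comp (hproj : ∀ n, Projective (K.X n)) {Y : C} (n m : ℕ) {q : ℕ}
    (hm : 1 ≤ m) (hq : n + m = q) (y : Ext (K.opcycles n) Y m)
    (hy : (syzygyClass K hK n).comp y hq = 0) : y = 0 := by
  induction n generalizing m q with
  | zero =>
    obtain rfl : m = q := by omega
    simpa [syzygyClass] using hy
  | succ n ih =>
    rw [syzygyClass, Ext.comp_assoc _ _ _ _ (add_comm 1 m) (by omega)] at hy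
    have h := ih (m + 1) (by omega) _ _ hy
    obtain ⟨x, hx⟩ := Ext.contravariant_sequence_exact₁ _ _ _ _ h
    have := hproj n
    obtain ⟨m, rfl⟩ : ∃ m', m = m' + 1 := ⟨m - 1, by omega⟩
    rw [← hx, Ext.eq_zero_of_projective x, Ext.comp_zero]

/-- A cocycle representing zero is a coboundary. For `n = 0` the convention `next 0 = 0` makes the
outgoing differential zero, and the statement says that `y = 0`. -/
lemma exists_eq_of_syzygyClass_comp_eq_zero (hproj : ∀ n, Projective (K.X n)) {Y : C} (n : ℕ)
    (y : K.opcycles n ⟶ Y) (hy : (syzygyClass K hK n).comp (Ext.mk₀ y) (add_zero n) = 0) :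
    ∃ h : K.X ((ComplexShape.down ℕ).next n) ⟶ Y, K.fromOpcycles n _ ≫ h = y := by
  cases n with
  | zero =>
    refine ⟨0, ?_⟩
    simp only [syzygyClass, Ext.mk₀_comp_mk₀, Category.id_comp] at hy
    rw [← Ext.mk₀_zero] at hy
    rw [comp_zero, (Ext.mk₀_bijective _ _).1 hy]
  | succ n =>
    rw [syzygyClass, Ext.comp_assoc _ _ _ _ (add_zero 1) (by omega)] at hy
    have h := eq_zero_of_syzygyClass_comp hK hproj n 1 le_rfl _ _ hy
    obtain ⟨x, hx⟩ := Ext.contravariant_sequence_exact₁ _ _ _ _ h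
    obtain ⟨x, rfl⟩ := (Ext.mk₀_bijective _ _).2 x
    rw [Ext.mk₀_comp_mk₀] at hx
    have hx := (Ext.mk₀_bijective _ _).1 hx
    have hn : (ComplexShape.down ℕ).next (n + 1) = n := by simp
    rw [hn]
    exact ⟨x, hx⟩

end

/-- A family of maps `K_n ⟶ F (L_n)` compatible with the differentials induces maps
`opcycles n K ⟶ F (opcycles n L)`. -/
def opcyclesDesc (F : C ⥤ D) [F.Additive] {K : ChainComplex D ℕ} {L : ChainComplex C ℕ}
    (s : ∀ n, K.X n ⟶ F.obj (L.X n)) (hs : ∀ i j, K.d i j ≫ s j = s i ≫ F.map (L.d i j)) (n : ℕ) :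
    K.opcycles n ⟶ F.obj (L.opcycles n) :=
  K.descOpcycles (s n ≫ F.map (L.pOpcycles n)) (n + 1) (by simp) (by
    rw [reassoc_of% hs, ← F.map_comp, L.d_pOpcycles, F.map_zero, comp_zero])

lemma pOpcycles_opcyclesDesc (F : C ⥤ D) [F.Additive] {K : ChainComplex D ℕ}
    {L : ChainComplex C ℕ} (s : ∀ n, K.X n ⟶ F.obj (L.X n))
    (hs : ∀ i j, K.d i j ≫ s j = s i ≫ F.map (L.d i j)) (n : ℕ) :
    K.pOpcycles n ≫ opcyclesDesc F s hs n = s n ≫ F.map (L.pOpcycles n) := by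
  simp [opcyclesDesc]

/-- A chain map from `K` to `F(L)` compares the syzygy sequences degree by degree, so naturality of
extension classes gives the claim by induction. -/
lemma syzygyClass_comp_opcyclesDesc [HasExt.{w₁} C] [HasExt.{w₂} D] (F : C ⥤ D) [F.Additive]
    [PreservesFiniteLimits F] [PreservesFiniteColimits F]
    {K : ChainComplex D ℕ} {L : ChainComplex C ℕ} (hK : ∀ n, K.ExactAt (n + 1))
    (hL : ∀ n, L.ExactAt (n + 1)) (s : ∀ n, K.X n ⟶ F.obj (L.X n))
    (hs : ∀ i j, K.d i j ≫ s j = s i ≫ F.map (L.d i j)) (n : ℕ) :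
    (syzygyClass K hK n).comp (Ext.mk₀ (opcyclesDesc F s hs n)) (add_zero n) =
      (Ext.mk₀ (opcyclesDesc F s hs 0)).comp ((syzygyClass L hL n).mapExactFunctor F)
        (zero_add n) := by
  induction n with
  | zero => simp [syzygyClass, Ext.mapExactFunctor_mk₀]
  | succ n ih =>
    have h₁ := syzygyComplex_shortExact K n (hK n)
    have h₂ := (syzygyComplex_shortExact L n (hL n)).map_of_exact F
    have comm₁ : opcyclesDesc F s hs (n + 1) ≫ F.map (L.fromOpcycles (n + 1) n) =
        K.fromOpcycles (n + 1) n ≫ s n := by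
      rw [← cancel_epi (K.pOpcycles (n + 1)), ← Category.assoc, pOpcycles_opcyclesDesc,
        Category.assoc, ← F.map_comp, L.p_fromOpcycles, K.p_fromOpcycles_assoc, hs]
    let φ : syzygyComplex K n ⟶ (syzygyComplex L n).map F :=
      { τ₁ := opcyclesDesc F s hs (n + 1)
        τ₂ := s n
        τ₃ := opcyclesDesc F s hs n
        comm₁₂ := comm₁
        comm₂₃ := (pOpcycles_opcyclesDesc F s hs n).symm }
    have hn := ShortComplex.ShortExact.extClass_naturality h₁ h₂ φ
    rw [← Ext.mapExactFunctor_extClass F (syzygyComplex_shortExact L n (hL n))] at hn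
    simp only [syzygyClass, Ext.mapExactFunctor_comp]
    refine (Ext.comp_assoc _ _ _ _ (add_zero 1) (by omega)).trans ?_
    refine (congrArg (fun t => Ext.comp (syzygyClass K hK n) t rfl) hn).trans ?_
    refine (Ext.comp_assoc _ _ _ (add_zero n) _ (by omega)).symm.trans ?_
    refine (congrArg (fun t => Ext.comp t _ rfl) ih).trans ?_
    exact Ext.comp_assoc _ _ _ _ _ (by omega)

/-- The map on homology induced by a map from a term of a complex which kills boundaries. -/
def homologyDesc (L : ChainComplex C ℕ) (n : ℕ) {Y : C} (g : L.X n ⟶ Y)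
    (hg : L.d (n + 1) n ≫ g = 0) : L.homology n ⟶ Y :=
  L.homologyι n ≫ L.descOpcycles g (n + 1) (by simp) hg

lemma homologyDesc_eq_of_sub_eq (L : ChainComplex C ℕ) (n : ℕ) {Y : C} (g g' : L.X n ⟶ Y)
    (hg : L.d (n + 1) n ≫ g = 0) (hg' : L.d (n + 1) n ≫ g' = 0)
    (h : L.X ((ComplexShape.down ℕ).next n) ⟶ Y) (hh : L.d n _ ≫ h = g - g') :
    homologyDesc L n g hg = homologyDesc L n g' hg' := by
  have : L.descOpcycles g (n + 1) (by simp) hg =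
      L.descOpcycles g' (n + 1) (by simp) hg' + L.fromOpcycles n _ ≫ h := by
    rw [← cancel_epi (L.pOpcycles n)]
    simp [hh]
  rw [homologyDesc, this, Preadditive.comp_add,
    HomologicalComplex.homologyι_comp_fromOpcycles_assoc, zero_comp, add_zero, homologyDesc]

lemma homologyDesc_comp (L : ChainComplex C ℕ) (n : ℕ) {Y Y' : C} (g : L.X n ⟶ Y)
    (hg : L.d (n + 1) n ≫ g = 0) (k : Y ⟶ Y') :
    homologyDesc L n g hg ≫ k = homologyDesc L n (g ≫ k) (by rw [reassoc_of% hg, zero_comp]) := by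
  rw [homologyDesc, homologyDesc, Category.assoc]
  congr 1
  rw [← cancel_epi (L.pOpcycles n)]
  simp

lemma homologyMap_homologyDesc {L L' : ChainComplex C ℕ} (φ : L ⟶ L') (n : ℕ) {Y : C}
    (g : L'.X n ⟶ Y) (hg : L'.d (n + 1) n ≫ g = 0) :
    HomologicalComplex.homologyMap φ n ≫ homologyDesc L' n g hg =
      homologyDesc L n (φ.f n ≫ g) (by rw [← φ.comm_assoc, hg, comp_zero]) := by
  rw [homologyDesc, homologyDesc, HomologicalComplex.homologyι_naturality_assoc]
  congr 1
  rw [← cancel_epi (L.pOpcycles n)]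
  simp

/-- If `L` is a quotient of a projective resolution `K` through which all maps to objects in `T`
factor, and a cocycle `h` represents a class through which all classes with values in `T` factor
uniquely, then the map induced by `h` on the homology of `L` is an isomorphism. -/
lemma isIso_homologyDesc [HasExt.{w₁} C] {K L : ChainComplex C ℕ} (η : K ⟶ L)
    (hη : ∀ n, Epi (η.f n)) {Y FY : C} (ηY : Y ⟶ FY) (hηY : Epi ηY) (T : C → Prop)
    (hT : ∀ (X : C), T X → ∀ (n : ℕ) (f : K.X n ⟶ X), ∃ f' : L.X n ⟶ X, η.f n ≫ f' = f)
    (hTY : ∀ (X : C), T X → ∀ (f : Y ⟶ X), ∃ f' : FY ⟶ X, ηY ≫ f' = f)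
    (hTL : ∀ n, T (L.X n)) (hTFY : T FY) (hTepi : ∀ (X Y : C) (f : X ⟶ Y), Epi f → T X → T Y)
    (hK : ∀ n, K.ExactAt (n + 1)) (hproj : ∀ n, Projective (K.X n))
    (n : ℕ) (h : K.opcycles n ⟶ Y) (g : L.X n ⟶ FY) (hgd : L.d (n + 1) n ≫ g = 0)
    (hg : η.f n ≫ g = K.pOpcycles n ≫ h ≫ ηY)
    (hex : ∀ (X : C), T X → ∀ (y : K.opcycles n ⟶ X), ∃ k : Y ⟶ X,
      (syzygyClass K hK n).comp (Ext.mk₀ y) (add_zero n) =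
        (syzygyClass K hK n).comp (Ext.mk₀ (h ≫ k)) (add_zero n))
    (huniq : ∀ (X : C), T X → ∀ (k k' : Y ⟶ X),
      (syzygyClass K hK n).comp (Ext.mk₀ (h ≫ k)) (add_zero n) =
        (syzygyClass K hK n).comp (Ext.mk₀ (h ≫ k')) (add_zero n) → k = k') :
    IsIso (homologyDesc L n g hgd) := by
  generalize hj : (ComplexShape.down ℕ).next n = j
  have hTO : T (L.opcycles n) := hTepi _ _ (L.pOpcycles n) inferInstance (hTL n)
  let a : K.opcycles n ⟶ L.opcycles n := HomologicalComplex.opcyclesMap η n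
  have ha : K.pOpcycles n ≫ a = η.f n ≫ L.pOpcycles n := by simp [a]
  -- The universal property is applied to the tautological cocycle `a` with values in the opcycles
  -- of `L`; up to a coboundary `h'` it factors through `h`.
  obtain ⟨k, hk⟩ := hex _ hTO a
  obtain ⟨h', hh'⟩ : ∃ h' : K.X j ⟶ L.opcycles n, K.fromOpcycles n j ≫ h' = a - h ≫ k := by
    subst hj
    refine exists_eq_of_syzygyClass_comp_eq_zero hK hproj n (a - h ≫ k) ?_
    rw [sub_eq_add_neg, Ext.mk₀_add, Ext.comp_add, Ext.mk₀_neg, Ext.comp_neg, hk, add_neg_cancel]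
  obtain ⟨kb, hkb⟩ := hTY _ hTO k
  obtain ⟨hb, hhb⟩ := hT _ hTO _ h'
  let gb : L.opcycles n ⟶ FY := L.descOpcycles g (n + 1) (by simp) hgd
  have hgb : L.pOpcycles n ≫ gb = g := by simp [gb]
  -- Descended to `L`, the factorization writes the identity as `gb ≫ kb` plus a term through the
  -- differential, and the latter dies on homology.
  have hid : 𝟙 _ = gb ≫ kb + L.fromOpcycles n j ≫ hb := by
    rw [← cancel_epi (L.pOpcycles n), ← cancel_epi (η.f n), Preadditive.comp_add,
      Preadditive.comp_add, reassoc_of% hgb, reassoc_of% hg, L.p_fromOpcycles_assoc,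
      η.comm_assoc, hhb, hkb, Category.comp_id, ← ha, ← K.p_fromOpcycles_assoc, hh',
      ← Preadditive.comp_add]
    simp
  have hι : L.homologyι n = homologyDesc L n g hgd ≫ kb := by
    have := congrArg (fun t => L.homologyι n ≫ t) hid
    simp only [Category.comp_id, Preadditive.comp_add] at this
    rw [this, HomologicalComplex.homologyι_comp_fromOpcycles_assoc, zero_comp, add_zero,
      homologyDesc, Category.assoc]
  have hvan : ∀ {X : C} (t : K.X j ⟶ X), (syzygyClass K hK n).comp
      (Ext.mk₀ (K.fromOpcycles n j ≫ t)) (add_zero n) = 0 := by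
    intro X t
    cases n with
    | zero =>
      rw [K.fromOpcycles_eq_zero (by simp), zero_comp, Ext.mk₀_zero, Ext.comp_zero]
    | succ n =>
      obtain rfl : n = j := by rw [← hj]; simp
      rw [syzygyClass, Ext.comp_assoc _ _ _ _ (add_zero 1) (by omega), ← Ext.mk₀_comp_mk₀]
      have := (syzygyComplex_shortExact K n (hK n)).extClass_comp_assoc (Ext.mk₀ t)
        (h := add_zero 1)
      rw [this, Ext.comp_zero]
  have hrep : ∀ {X : C} (t : L.opcycles n ⟶ X),
      (syzygyClass K hK n).comp (Ext.mk₀ (h ≫ k ≫ t)) (add_zero n) =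
      (syzygyClass K hK n).comp (Ext.mk₀ (a ≫ t)) (add_zero n) := by
    intro X t
    have : a ≫ t = h ≫ k ≫ t + K.fromOpcycles n j ≫ h' ≫ t := by
      rw [reassoc_of% hh']
      simp
    rw [this, Ext.mk₀_add, Ext.comp_add, hvan, add_zero]
  -- By uniqueness `k` is killed by the differential, since `a` followed by the differential is a
  -- coboundary. So `kb` lands in homology, and will be the inverse.
  have hk0 : k ≫ L.fromOpcycles n j = 0 := by
    apply huniq (L.X j) (hTL _)
    rw [hrep, comp_zero]
    have : a ≫ L.fromOpcycles n j = K.fromOpcycles n j ≫ η.f j := by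
      rw [← cancel_epi (K.pOpcycles n), reassoc_of% ha, L.p_fromOpcycles, η.comm,
        K.p_fromOpcycles_assoc]
    rw [this, hvan, Ext.mk₀_zero, Ext.comp_zero]
  have hkb0 : kb ≫ L.fromOpcycles n j = 0 := by
    rw [← cancel_epi ηY, reassoc_of% hkb, hk0, comp_zero]
  have hkg : kb ≫ gb = 𝟙 _ := by
    rw [← cancel_epi ηY, reassoc_of% hkb, Category.comp_id]
    apply huniq FY hTFY
    rw [hrep]
    have : a ≫ gb = h ≫ ηY := by
      rw [← cancel_epi (K.pOpcycles n), reassoc_of% ha, hgb, hg]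
    rw [this]
  obtain ⟨l, hl⟩ := KernelFork.IsLimit.lift' (L.homologyIsKernel n j hj) kb hkb0
  have hl : l ≫ L.homologyι n = kb := hl
  refine ⟨⟨l, ?_, ?_⟩⟩
  · rw [← cancel_mono (L.homologyι n), Category.assoc, hl, ← hι, Category.id_comp]
  · rw [homologyDesc, reassoc_of% hl]
    exact hkg

end Cocycles

end GrossHopkins
end

noncomputable section

namespace GrossHopkins

/-! ### Regular sequences and their Koszul extensions -/

section KoszulModules

open Abelian Limits Pointwise

variable {S : Type u} [CommRing S]

/-- The quotient `N / z N`. -/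
abbrev quotBy (z : S) (N : ModuleCat.{u} S) : ModuleCat.{u} S :=
  ModuleCat.of S (N ⧸ (z • (⊤ : Submodule S N)))

/-- The map `N / z N ⟶ N' / z N'` induced by a linear map. -/
def quotByMap (z : S) {N N' : ModuleCat.{u} S} (f : N ⟶ N') : quotBy z N ⟶ quotBy z N' :=
  ModuleCat.ofHom (Submodule.mapQ _ _ f.hom (by
    rintro _ ⟨n, -, rfl⟩
    exact ⟨f.hom n, trivial, (map_smul f.hom z n).symm⟩))

/-- The projection `N ⟶ N / z N`. -/
def quotByProj (z : S) (N : ModuleCat.{u} S) : N ⟶ quotBy z N :=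
  ModuleCat.ofHom (Submodule.mkQ _)

lemma quotByProj_surjective (z : S) (N : ModuleCat.{u} S) :
    Function.Surjective (quotByProj z N).hom := Submodule.mkQ_surjective _

lemma quotByProj_eq_zero_iff (z : S) (N : ModuleCat.{u} S) (n : N) :
    (quotByProj z N).hom n = 0 ↔ ∃ n', n = z • n' := by
  refine (Submodule.Quotient.mk_eq_zero _).trans ?_
  rw [Submodule.mem_smul_pointwise_iff_exists]
  exact ⟨fun ⟨n', _, h⟩ => ⟨n', h.symm⟩, fun ⟨n', h⟩ => ⟨n', trivial, h.symm⟩⟩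

lemma smul_comp_quotByProj (z : S) (N : ModuleCat.{u} S) :
    (z • 𝟙 N) ≫ quotByProj z N = 0 := by
  ext n
  exact (quotByProj_eq_zero_iff z N _).2 ⟨n, rfl⟩

lemma quotBy_shortExact {z : S} {N : ModuleCat.{u} S} (hz : IsSMulRegular N z) :
    (ShortComplex.mk _ _ (smul_comp_quotByProj z N)).ShortExact where
  exact := by
    rw [ShortComplex.ShortExact.moduleCat_exact_iff_function_exact]
    intro n
    exact (quotByProj_eq_zero_iff z N n).trans
      ⟨fun ⟨n', h⟩ => ⟨n', h.symm⟩, fun ⟨n', h⟩ => ⟨n', h.symm⟩⟩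
  mono_f := (ModuleCat.mono_iff_injective _).2 hz
  epi_g := (ModuleCat.epi_iff_surjective _).2 (quotByProj_surjective z N)

/-- The iterated quotient of a module by the elements of a list. -/
def koszulQuot : List S → ModuleCat.{u} S → ModuleCat.{u} S
  | [], N => N
  | z :: zs, N => koszulQuot zs (quotBy z N)

/-- Functoriality of the iterated quotient. -/
def koszulQuotMap : ∀ (zs : List S) {N N' : ModuleCat.{u} S} (_ : N ⟶ N'),
    koszulQuot zs N ⟶ koszulQuot zs N'
  | [], _, _, f => f
  | z :: zs, _, _, f => koszulQuotMap zs (quotByMap z f)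

/-- The projection to the iterated quotient. -/
def koszulProj : ∀ (zs : List S) (N : ModuleCat.{u} S), N ⟶ koszulQuot zs N
  | [], N => 𝟙 N
  | z :: zs, N => quotByProj z N ≫ koszulProj zs (quotBy z N)

instance epi_koszulProj (zs : List S) (N : ModuleCat.{u} S) : Epi (koszulProj zs N) := by
  induction zs generalizing N with
  | nil => exact inferInstanceAs (Epi (𝟙 N))
  | cons z zs ih =>
    have : Epi (quotByProj z N) := (ModuleCat.epi_iff_surjective _).2 (quotByProj_surjective z N)
    have := ih (quotBy z N)
    exact epi_comp (quotByProj z N) (koszulProj zs (quotBy z N))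

lemma koszulProj_naturality (zs : List S) {N N' : ModuleCat.{u} S} (f : N ⟶ N') :
    koszulProj zs N ≫ koszulQuotMap zs f = f ≫ koszulProj zs N' := by
  induction zs generalizing N N' with
  | nil => exact (Category.id_comp f).trans (Category.comp_id f).symm
  | cons z zs ih =>
    refine (Category.assoc _ _ _).trans ?_
    refine (congrArg (fun t => quotByProj z N ≫ t) (ih (quotByMap z f))).trans ?_
    exact (Category.assoc (quotByProj z N) (quotByMap z f) _).symm

lemma smul_koszulProj (zs : List S) (N : ModuleCat.{u} S) {z : S} (hz : z ∈ zs) :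
    z • koszulProj zs N = 0 := by
  induction zs generalizing N with
  | nil => simp at hz
  | cons w zs ih =>
    rcases List.mem_cons.1 hz with rfl | hz
    · have h := smul_comp_quotByProj z N
      rw [Linear.smul_comp, Category.id_comp] at h
      change z • (quotByProj z N ≫ koszulProj zs (quotBy z N)) = 0
      rw [← Linear.smul_comp, h, zero_comp]
    · change z • (quotByProj w N ≫ koszulProj zs (quotBy w N)) = 0
      rw [← Linear.comp_smul, ih _ hz, comp_zero]

lemma exists_koszulProj_comp (zs : List S) {N X : ModuleCat.{u} S} (f : N ⟶ X)
    (hf : ∀ z ∈ zs, z • f = 0) : ∃ g : koszulQuot zs N ⟶ X, koszulProj zs N ≫ g = f := by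
  induction zs generalizing N with
  | nil => exact ⟨f, Category.id_comp f⟩
  | cons z zs ih =>
    let f' : quotBy z N ⟶ X := ModuleCat.ofHom (Submodule.liftQ _ f.hom (by
      rintro _ ⟨n, -, rfl⟩
      have h := congrArg (fun t => t.hom n) (hf z List.mem_cons_self)
      have h2 : z • f.hom n = 0 := h
      exact (map_smul f.hom z n).trans h2))
    have hf' : quotByProj z N ≫ f' = f := rfl
    obtain ⟨g, hg⟩ := ih f' (fun w hw => by
      have : Epi (quotByProj z N) := (ModuleCat.epi_iff_surjective _).2 (quotByProj_surjective z N)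
      rw [← cancel_epi (quotByProj z N), Linear.comp_smul, hf', hf w (List.mem_cons_of_mem _ hw),
        comp_zero])
    refine ⟨g, ?_⟩
    exact (Category.assoc _ _ _).trans ((congrArg (fun t => quotByProj z N ≫ t) hg).trans hf')

/-- `zs` is a regular sequence on `N`. -/
def IsKoszulRegular : List S → ModuleCat.{u} S → Prop
  | [], _ => True
  | z :: zs, N => IsSMulRegular N z ∧ IsKoszulRegular zs (quotBy z N)

/-- The class in `Ext (N / (zs) N) N` of the Koszul resolution of a regular sequence. -/
def koszulExt : ∀ (zs : List S) (N : ModuleCat.{u} S) (_ : IsKoszulRegular zs N),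
    Ext.{u} (koszulQuot zs N) N zs.length
  | [], N, _ => Ext.mk₀ (𝟙 N)
  | _ :: zs, _, h => (koszulExt zs _ h.2).comp (quotBy_shortExact h.1).extClass rfl

lemma koszulExt_naturality (zs : List S) {N N' : ModuleCat.{u} S} (h : IsKoszulRegular zs N)
    (h' : IsKoszulRegular zs N') (f : N ⟶ N') :
    (koszulExt zs N h).comp (Ext.mk₀ f) (add_zero _) =
      (Ext.mk₀ (koszulQuotMap zs f)).comp (koszulExt zs N' h') (zero_add _) := by
  induction zs generalizing N N' with
  | nil => exact (Ext.mk₀_id_comp (Ext.mk₀ f)).trans (Ext.comp_mk₀_id (Ext.mk₀ f)).symm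
  | cons z zs ih =>
    let φ : ShortComplex.mk _ _ (smul_comp_quotByProj z N) ⟶
        ShortComplex.mk _ _ (smul_comp_quotByProj z N') :=
      { τ₁ := f
        τ₂ := f
        τ₃ := quotByMap z f
        comm₁₂ := by dsimp; rw [Linear.smul_comp, Linear.comp_smul]; simp
        comm₂₃ := rfl }
    have hn := ShortComplex.ShortExact.extClass_naturality (quotBy_shortExact h.1)
      (quotBy_shortExact h'.1) φ
    refine (Ext.comp_assoc _ _ _ rfl (add_zero 1) rfl).trans ?_
    refine (congrArg (fun t => Ext.comp (koszulExt zs _ h.2) t rfl) hn).trans ?_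
    refine (Ext.comp_assoc _ _ _ (add_zero _) _ (by omega)).symm.trans ?_
    refine (congrArg (fun t => Ext.comp t _ rfl) (ih h.2 h'.2 (quotByMap z f))).trans ?_
    exact Ext.comp_assoc _ _ _ _ _ (by omega)

/-- The endomorphisms given by multiplication by an element of an ideal. -/
def IsScalarIn (I : Ideal S) (N : ModuleCat.{u} S) (f : N ⟶ N) : Prop :=
  ∃ s ∈ I, f = s • 𝟙 N

lemma koszulClass_koszulExt (I : Ideal S) (zs : List S) (hzs : ∀ z ∈ zs, z ∈ I)
    (N : ModuleCat.{u} S) (h : IsKoszulRegular zs N) :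
    KoszulClass (IsScalarIn I) (koszulExt zs N h) := by
  induction zs generalizing N with
  | nil => exact KoszulClass.iso _ (IsIso.id N)
  | cons z zs ih =>
    exact KoszulClass.step _ _ _ (quotBy_shortExact h.1) ⟨z, hzs z List.mem_cons_self, rfl⟩ _
      (ih (fun w hw => hzs w (List.mem_cons_of_mem _ hw)) _ h.2)

/-- Scalars act on `Ext(X, N)` equally through `X` and through `N`, so an element that kills `X`
acts as zero. -/
lemma ext_comp_scalar_eq_zero {I : Ideal S} {X N : ModuleCat.{u} S} (hX : ∀ s ∈ I, s • 𝟙 X = 0)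
    (f : N ⟶ N) (hf : IsScalarIn I N f) (j : ℕ) (y : Ext.{u} X N j) :
    y.comp (Ext.mk₀ f) (add_zero j) = 0 := by
  obtain ⟨s, hs, rfl⟩ := hf
  rw [Ext.mk₀_smul, Ext.comp_smul, Ext.comp_mk₀_id]
  have : s • y = (Ext.mk₀ (s • 𝟙 X)).comp y (zero_add j) := by
    rw [Ext.mk₀_smul, Ext.smul_comp, Ext.mk₀_id_comp]
  rw [this, hX s hs, Ext.mk₀_zero, Ext.zero_comp]

lemma scalar_comp_ext_eq_zero {I : Ideal S} {X N : ModuleCat.{u} S} (hX : ∀ s ∈ I, s • 𝟙 X = 0)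
    (f : N ⟶ N) (hf : IsScalarIn I N f) (j : ℕ) (y : Ext.{u} N X j) :
    (Ext.mk₀ f).comp y (zero_add j) = 0 := by
  obtain ⟨s, hs, rfl⟩ := hf
  rw [Ext.mk₀_smul, Ext.smul_comp, Ext.mk₀_id_comp]
  have : s • y = y.comp (Ext.mk₀ (s • 𝟙 X)) (add_zero j) := by
    rw [Ext.mk₀_smul, Ext.comp_smul, Ext.comp_mk₀_id]
  rw [this, hX s hs, Ext.mk₀_zero, Ext.comp_zero]

/-- A sequence is regular if each of its members has an additive left inverse which commutes with
the preceding members. -/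
lemma isKoszulRegular_of_retractions (zs : List S) (N : ModuleCat.{u} S) (ρ : S → N →+ N)
    (h₁ : ∀ z ∈ zs, ∀ n, ρ z (z • n) = n)
    (h₂ : zs.Pairwise fun z w => ∀ n, ρ w (z • n) = z • ρ w n) : IsKoszulRegular zs N := by
  classical
  induction zs generalizing N with
  | nil => trivial
  | cons z zs ih =>
    rw [List.pairwise_cons] at h₂
    refine ⟨fun a b hab => ?_, ?_⟩
    · rw [← h₁ z List.mem_cons_self a, ← h₁ z List.mem_cons_self b]
      exact congrArg (ρ z) hab
    · let U : AddSubgroup N := (z • (⊤ : Submodule S N)).toAddSubgroup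
      -- Only the operators attached to members of `zs` are known to preserve `z N`; the value zero
      -- at other elements is never used.
      let ρ' : S → quotBy z N →+ quotBy z N := fun w =>
        if hw : U ≤ U.comap (ρ w) then QuotientAddGroup.map U U (ρ w) hw else 0
      have hρ' : ∀ w ∈ zs, ∀ n : N, ρ' w (Submodule.Quotient.mk n) =
          Submodule.Quotient.mk (ρ w n) := by
        intro w hw n
        have hle : U ≤ U.comap (ρ w) := by
          rintro _ ⟨n, -, rfl⟩
          exact ⟨ρ w n, trivial, (h₂.1 w hw n).symm⟩
        have : ρ' w = QuotientAddGroup.map U U (ρ w) hle := dif_pos hle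
        rw [this]
        rfl
      refine ih _ ρ' (fun w hw => ?_) ?_
      · rintro ⟨n⟩
        refine (hρ' w hw (w • n)).trans ?_
        rw [h₁ w (List.mem_cons_of_mem _ hw)]
        rfl
      · refine h₂.2.imp_of_mem ?_
        rintro a b - hb hab ⟨n⟩
        refine (hρ' b hb (a • n)).trans ?_
        rw [hab]
        refine Eq.trans ?_ (congrArg (fun t => a • t) (hρ' b hb n)).symm
        rfl

end KoszulModules

end GrossHopkins
end

noncomputable section

namespace GrossHopkins

/-! ### Base change of modules -/

section BaseChange

variable {R S : Type u} [CommRing R] [CommRing S] (f : R →+* S)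

/-- The base change `S ⊗_R M` along `f : R → S`. -/
abbrev baseChange (M : ModuleCat.{u} R) : ModuleCat.{u} S := (ModuleCat.extendScalars f).obj M

variable {f}

/-- The map `m ↦ 1 ⊗ m`. -/
def toBaseChange (f : R →+* S) (M : ModuleCat.{u} R) : M →+ baseChange f M where
  toFun m := ((ModuleCat.extendRestrictScalarsAdj f).unit.app M).hom m
  map_zero' := map_zero ((ModuleCat.extendRestrictScalarsAdj f).unit.app M).hom
  map_add' := map_add ((ModuleCat.extendRestrictScalarsAdj f).unit.app M).hom

lemma toBaseChange_smul {M : ModuleCat.{u} R} (r : R) (m : M) :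
    toBaseChange f M (r • m) = f r • toBaseChange f M m :=
  map_smul ((ModuleCat.extendRestrictScalarsAdj f).unit.app M).hom r m

lemma smul_toBaseChange_eq {M : ModuleCat.{u} R} (s : S) (m : M) :
    s • toBaseChange f M m = (TensorProduct.tmul R
      (M := (ModuleCat.restrictScalars f).obj (ModuleCat.of S S)) s m : baseChange f M) := by
  refine (ModuleCat.ExtendScalars.smul_tmul f s 1 m).trans ?_
  rw [mul_one]
  rfl

lemma baseChange_induction {M : ModuleCat.{u} R} {p : baseChange f M → Prop}
    (zero : p 0) (add : ∀ a b, p a → p b → p (a + b))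
    (smul : ∀ (s : S) (m : M), p (s • toBaseChange f M m)) (x : baseChange f M) : p x := by
  refine TensorProduct.induction_on (motive := p) x zero (fun s m => ?_) add
  exact (congrArg p (smul_toBaseChange_eq (f := f) (s : S) m)).mp (smul (s : S) m)

lemma baseChange_hom_ext {M : ModuleCat.{u} R} {N : ModuleCat.{u} S} {g h : baseChange f M ⟶ N}
    (hgh : ∀ m, g.hom (toBaseChange f M m) = h.hom (toBaseChange f M m)) : g = h := by
  refine ModuleCat.hom_ext (LinearMap.ext fun x => ?_)
  refine baseChange_induction (p := fun x => g.hom x = h.hom x) ?_ ?_ ?_ x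
  · rw [map_zero, map_zero]
  · intro a b ha hb
    rw [map_add, map_add, ha, hb]
  · intro s m
    rw [map_smul, map_smul, hgh]

/-- Linear maps from a base change. -/
def baseChangeDesc {M : ModuleCat.{u} R} {N : ModuleCat.{u} S} (g : M →+ N)
    (hg : ∀ r m, g (r • m) = f r • g m) : baseChange f M ⟶ N :=
  ((ModuleCat.extendRestrictScalarsAdj f).homEquiv M N).symm
    (ModuleCat.ofHom (Y := (ModuleCat.restrictScalars f).obj N)
      { toFun := g, map_add' := g.map_add, map_smul' := hg })

@[simp]
lemma baseChangeDesc_toBaseChange {M : ModuleCat.{u} R} {N : ModuleCat.{u} S} (g : M →+ N)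
    (hg : ∀ r m, g (r • m) = f r • g m) (m : M) :
    (baseChangeDesc g hg).hom (toBaseChange f M m) = g m := by
  have h := ((ModuleCat.extendRestrictScalarsAdj f).homEquiv M N).apply_symm_apply
    (ModuleCat.ofHom (Y := (ModuleCat.restrictScalars f).obj N)
      { toFun := g, map_add' := g.map_add, map_smul' := hg })
  rw [Adjunction.homEquiv_unit] at h
  exact congrArg (fun t => t.hom m) h

/-- Additive maps on a base change induced by an `R`-linear endomorphism of `S`. -/
def baseChangeMapLeft (ρ : S →+ S) (hρ : ∀ r s, ρ (f r * s) = f r * ρ s) (M : ModuleCat.{u} R) :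
    baseChange f M →+ baseChange f M :=
  (LinearMap.rTensor (R := R) M
    ({ toFun := ρ, map_add' := ρ.map_add, map_smul' := hρ } :
      (ModuleCat.restrictScalars f).obj (ModuleCat.of S S) →ₗ[R]
        (ModuleCat.restrictScalars f).obj (ModuleCat.of S S))).toAddMonoidHom

lemma baseChangeMapLeft_smul (ρ : S →+ S) (hρ : ∀ r s, ρ (f r * s) = f r * ρ s)
    {M : ModuleCat.{u} R} (s : S) (m : M) :
    baseChangeMapLeft ρ hρ M (s • toBaseChange f M m) = ρ s • toBaseChange f M m := by
  rw [smul_toBaseChange_eq, smul_toBaseChange_eq]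
  rfl

/-- Functoriality of base change. -/
abbrev baseChangeMap (f : R →+* S) {M M' : ModuleCat.{u} R} (g : M ⟶ M') :
    baseChange f M ⟶ baseChange f M' := (ModuleCat.extendScalars f).map g

lemma baseChangeMap_toBaseChange {M M' : ModuleCat.{u} R} (g : M ⟶ M') (m : M) :
    (baseChangeMap f g).hom (toBaseChange f M m) = toBaseChange f M' (g.hom m) := rfl

end BaseChange

/-! ### Division of power series by variables -/

section PowerSeriesDivision

open MvPowerSeries

variable {σ : Type*} {W : Type*} [CommRing W]

/-- The linear map which divides the multiples of `X j` by `X j` and kills the monomials not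
divisible by `X j`. -/
def divX (j : σ) : MvPowerSeries σ W →+ MvPowerSeries σ W where
  toFun s := fun e => coeff (e + Finsupp.single j 1) s
  map_zero' := by ext e; exact map_zero (coeff (e + Finsupp.single j 1))
  map_add' a b := by ext e; exact map_add (coeff (e + Finsupp.single j 1)) a b

lemma coeff_divX (j : σ) (s : MvPowerSeries σ W) (e : σ →₀ ℕ) :
    coeff e (divX j s) = coeff (e + Finsupp.single j 1) s := rfl

lemma divX_X_mul (j : σ) (s : MvPowerSeries σ W) : divX j (X j * s) = s := by
  ext e
  rw [coeff_divX, add_comm, X]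
  simpa using coeff_add_monomial_mul (Finsupp.single j 1) e s (1 : W)

/-- As `t` does not involve the variable `j`, every factor `X j` in a monomial of `t * s` comes from
`s`. -/
lemma divX_mul (j : σ) (t s : MvPowerSeries σ W) (ht : ∀ e, coeff e t ≠ 0 → e j = 0) :
    divX j (t * s) = t * divX j s := by
  classical
  ext e
  rw [coeff_divX, coeff_mul, coeff_mul]
  symm
  refine Finset.sum_of_injOn (fun p => (p.1, p.2 + Finsupp.single j 1)) ?_ ?_ ?_ ?_
  · rintro ⟨a, b⟩ - ⟨a', b'⟩ - h
    simpa using h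
  · rintro ⟨a, b⟩ h
    simp only [Finset.mem_coe, Finset.HasAntidiagonal.mem_antidiagonal] at h ⊢
    rw [← add_assoc, h]
  · rintro ⟨a, b⟩ h h'
    simp only [Finset.HasAntidiagonal.mem_antidiagonal] at h
    -- Pairs outside the image of the shift have `b j = 0`; then `a j = e j + 1` is positive and the
    -- coefficient of `t` vanishes.
    by_cases hb : b j = 0
    · by_cases ha : coeff a t = 0
      · rw [ha, zero_mul]
      · have h2 := congrArg (fun f => f j) h
        simp [hb, ht a ha] at h2
    · exfalso
      apply h'
      refine ⟨(a, b - Finsupp.single j 1), ?_, ?_⟩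
      · simp only [Finset.mem_coe, Finset.HasAntidiagonal.mem_antidiagonal]
        ext i
        have h2 := congrArg (fun f => f i) h
        by_cases hij : j = i
        · subst hij
          simp at h2 ⊢
          omega
        · simp [hij] at h2 ⊢
          omega
      · ext i
        · rfl
        · by_cases hij : j = i
          · subst hij
            simp
            omega
          · simp [hij]
  · rintro ⟨a, b⟩ -
    rfl

lemma coeff_X_apply_eq_zero {j k : σ} (hjk : k ≠ j) (e : σ →₀ ℕ)
    (he : coeff e (X k : MvPowerSeries σ W) ≠ 0) : e j = 0 := by
  classical
  rw [coeff_X] at he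
  have : e = Finsupp.single k 1 := by
    by_contra h
    exact he (if_neg h)
  rw [this, Finsupp.single_apply, if_neg hjk]

lemma coeff_rename_apply_eq_zero {τ : Type*} (g : τ ↪ σ) {j : σ} (hj : j ∉ Set.range g)
    (r : MvPowerSeries τ W) (e : σ →₀ ℕ) (he : coeff e (rename g r) ≠ 0) : e j = 0 := by
  by_contra h
  refine he (coeff_rename_eq_zero g r ?_)
  rintro ⟨e', rfl⟩
  exact h (Finsupp.mapDomain_of_notMem_range _ _ hj)

/-- Induction on the set of variables: the part of `s` with exponent at least `k` in the new
variable is divisible by its `k`-th power, and the rest satisfies the hypothesis for the smaller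
set. -/
lemma mem_span_X_pow_of_coeff {ι : Type*} (x : ι → σ) (k : ℕ) (t : Finset ι)
    (s : MvPowerSeries σ W)
    (hs : ∀ e : σ →₀ ℕ, (∀ i ∈ t, e (x i) < k) → coeff e s = 0) :
    s ∈ Ideal.span (Set.range fun i => (X (x i) ^ k : MvPowerSeries σ W)) := by
  classical
  induction t using Finset.induction_on generalizing s with
  | empty =>
    have : s = 0 := by
      ext e
      exact hs e (by simp)
    rw [this]
    exact zero_mem _
  | insert i t hi ih =>
    let a : MvPowerSeries σ W := fun e => if e (x i) < k then coeff e s else 0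
    have ha : ∀ e, coeff e a = if e (x i) < k then coeff e s else 0 := fun e => rfl
    have h1 : a ∈ Ideal.span (Set.range fun i => (X (x i) ^ k : MvPowerSeries σ W)) := by
      refine ih a fun e he => ?_
      rw [ha]
      split_ifs with h
      · refine hs e fun k hk => ?_
        rcases Finset.mem_insert.1 hk with rfl | hk
        · exact h
        · exact he k hk
      · rfl
    have h2 : X (x i) ^ k ∣ s - a := by
      rw [X_pow_dvd_iff]
      intro e he
      rw [map_sub, ha, if_pos he, sub_self]
    obtain ⟨c, hc⟩ := h2
    have : s = a + X (x i) ^ k * c := by rw [← hc]; ring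
    rw [this]
    exact add_mem h1 (Ideal.mul_mem_right _ _ (Ideal.subset_span ⟨i, rfl⟩))

lemma mem_span_X_of_coeff {ι : Type*} (x : ι → σ) (t : Finset ι) (s : MvPowerSeries σ W)
    (hs : ∀ e : σ →₀ ℕ, (∀ i ∈ t, e (x i) = 0) → coeff e s = 0) :
    s ∈ Ideal.span (Set.range fun i => (X (x i) : MvPowerSeries σ W)) := by
  simpa using mem_span_X_pow_of_coeff x 1 t s fun e he =>
    hs e fun i hi => Nat.lt_one_iff.1 (he i hi)

end PowerSeriesDivision

end GrossHopkins
end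

noncomputable section

namespace GrossHopkins

/-! ### The diagonal ideal and the fundamental class -/

section Diagonal

open Abelian MvPowerSeries

variable (W : Type u) [CommRing W] (d : ℕ)

/-- The generators `x_i - y_i` of the kernel of the multiplication map. -/
def diagGen (i : Fin d) : PS₂ W d := X (Sum.inl i) - X (Sum.inr i)

/-- The list of the `x_i - y_i`. -/
def diagGens : List (PS₂ W d) := List.ofFn (diagGen W d)

lemma diag_inclRight (r : PS W d) : diag W d (inclRight W d r) = r := by
  change rename _ (rename _ r) = r
  rw [rename_rename]
  exact rename_id_apply r

lemma diag_inclLeft (r : PS W d) : diag W d (inclLeft W d r) = r := by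
  change rename _ (rename _ r) = r
  rw [rename_rename]
  exact rename_id_apply r

lemma diag_diagGen (i : Fin d) : diag W d (diagGen W d i) = 0 := by
  change rename _ (X (Sum.inl i) - X (Sum.inr i)) = 0
  rw [map_sub, rename_X, rename_X]
  exact sub_self _

lemma hasSubst_shear (c : W) : HasSubst (Sum.elim
    (fun i => X (Sum.inl i) + C c * X (Sum.inr i)) (fun i => X (Sum.inr i)) :
      Fin d ⊕ Fin d → PS₂ W d) :=
  hasSubst_of_constantCoeff_zero (by rintro (i | i) <;> simp)

/-- The substitution `x_i ↦ x_i + c y_i`, `y_i ↦ y_i`. -/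
def shear (c : W) : PS₂ W d →ₐ[W] PS₂ W d := substAlgHom (hasSubst_shear W d c)

variable {W d}

lemma shear_X_inl (c : W) (i : Fin d) :
    shear W d c (X (Sum.inl i)) = X (Sum.inl i) + C c * X (Sum.inr i) :=
  substAlgHom_X _ _

lemma shear_X_inr (c : W) (i : Fin d) : shear W d c (X (Sum.inr i)) = X (Sum.inr i) :=
  substAlgHom_X _ _

lemma shear_shear {a b : W} (hab : a + b = 0) (s : PS₂ W d) : shear W d a (shear W d b s) = s := by
  rw [shear, shear, substAlgHom_comp_substAlgHom_apply, substAlgHom_apply]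
  have h : (fun j => substAlgHom (hasSubst_shear W d a) (Sum.elim
      (fun i => X (Sum.inl i) + C b * X (Sum.inr i)) (fun i => X (Sum.inr i)) j)) =
      (X : Fin d ⊕ Fin d → PS₂ W d) := by
    funext j
    rcases j with i | i
    · change shear W d a (X (Sum.inl i) + C b * X (Sum.inr i)) = _
      have hC : shear W d a (C b) = C b := (shear W d a).commutes b
      rw [map_add, map_mul, shear_X_inl, shear_X_inr, hC, add_assoc, ← add_mul, ← map_add, hab,
        map_zero, zero_mul, add_zero]
    · exact shear_X_inr a i
  rw [h, subst_self, id]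

lemma shear_inclRight (c : W) (r : PS W d) : shear W d c (inclRight W d r) = inclRight W d r := by
  have h : inclRight W d r = subst (X ∘ Sum.inr) r := rename_eq_subst ..
  rw [h, shear, substAlgHom_apply, subst_comp_subst_apply (HasSubst.X_comp ..) (hasSubst_shear W d c)]
  congr 1
  funext i
  rw [← substAlgHom_apply (hasSubst_shear W d c)]
  exact shear_X_inr c i

/-- The change of coordinates `shear (-1)`, with inverse `shear 1`, fixes the right copy of `R`. It
reduces questions about `x_i - y_i` to questions about variables. -/
lemma shear_X_inl_eq_diagGen (i : Fin d) : shear W d (-1) (X (Sum.inl i)) = diagGen W d i := by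
  rw [shear_X_inl, diagGen]
  simp [sub_eq_add_neg]

/-- Division by `x_i - y_i`. -/
def diagDiv (i : Fin d) : PS₂ W d →+ PS₂ W d :=
  ((shear W d (-1) : PS₂ W d →+ PS₂ W d).comp (divX (Sum.inl i))).comp
    (shear W d 1 : PS₂ W d →+ PS₂ W d)

lemma diagDiv_apply (i : Fin d) (s : PS₂ W d) :
    diagDiv i s = shear W d (-1) (divX (Sum.inl i) (shear W d 1 s)) := rfl

lemma shear_diagGen (i : Fin d) : shear W d 1 (diagGen W d i) = X (Sum.inl i) := by
  rw [← shear_X_inl_eq_diagGen, shear_shear (by simp)]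

lemma diagDiv_diagGen_mul (i : Fin d) (s : PS₂ W d) : diagDiv i (diagGen W d i * s) = s := by
  rw [diagDiv_apply, map_mul, shear_diagGen, divX_X_mul, shear_shear (by simp)]

lemma diagDiv_diagGen_mul_of_ne {i j : Fin d} (hij : j ≠ i) (s : PS₂ W d) :
    diagDiv i (diagGen W d j * s) = diagGen W d j * diagDiv i s := by
  rw [diagDiv_apply, map_mul, shear_diagGen, divX_mul, map_mul, shear_X_inl_eq_diagGen,
    diagDiv_apply]
  exact fun e he => coeff_X_apply_eq_zero (by simpa using hij) e he

/-- Linearity over the right copy of `R` is what lets the division operate on `S ⊗_R M`. -/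
lemma diagDiv_inclRight_mul (i : Fin d) (r : PS W d) (s : PS₂ W d) :
    diagDiv i (inclRight W d r * s) = inclRight W d r * diagDiv i s := by
  rw [diagDiv_apply, map_mul, shear_inclRight, divX_mul, map_mul, shear_inclRight, diagDiv_apply]
  exact fun e he => coeff_rename_apply_eq_zero Function.Embedding.inr (by simp) r e he

/-- This allows the division operators to be indexed by the elements of the sequence instead of
their positions. -/
lemma diagGen_injective [Nontrivial W] : Function.Injective (diagGen W d) := by
  classical
  intro i j hij
  by_contra h
  have h2 := congrArg (coeff (Finsupp.single (Sum.inl i) 1)) hij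
  simp [diagGen, coeff_X, Finsupp.single_left_inj, h] at h2

variable (W d)

/-- In sheared coordinates a series is congruent, modulo the `x_i`, to a series in the `y_i` alone.
Undoing the shear gives a congruence modulo the `x_i - y_i`, and applying `diag` identifies the
series in `y`. -/
lemma sub_inclRight_diag_mem (t : PS₂ W d) :
    t - inclRight W d (diag W d t) ∈ Ideal.span (Set.range (diagGen W d)) := by
  have key : ∀ s : PS₂ W d, s - inclRight W d (killCompl Function.Embedding.inr s) ∈
      Ideal.span (Set.range fun i : Fin d => (X (Sum.inl i) : PS₂ W d)) := by
    intro s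
    refine mem_span_X_of_coeff Sum.inl Finset.univ _ fun e he => ?_
    have he' : e = Finsupp.embDomain Function.Embedding.inr
        (e.comapDomain Sum.inr Sum.inr_injective.injOn) := by
      ext j
      rcases j with i | i
      · rw [he i (Finset.mem_univ i), Finsupp.embDomain_of_notMem_range]
        simp
      · exact (Finsupp.embDomain_apply_self Function.Embedding.inr
          (e.comapDomain Sum.inr Sum.inr_injective.injOn) i).symm
    rw [he', map_sub]
    have h := coeff_embDomain_rename (Function.Embedding.inr : Fin d ↪ Fin d ⊕ Fin d)
      (killCompl Function.Embedding.inr s) (e.comapDomain Sum.inr Sum.inr_injective.injOn)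
    rw [coeff_killCompl] at h
    exact sub_eq_zero.2 h.symm
  have h2 := Ideal.mem_map_of_mem (shear W d (-1)) (key (shear W d 1 t))
  rw [Ideal.map_span, ← Set.range_comp, map_sub, shear_shear (by simp), shear_inclRight] at h2
  have h3 : (⇑(shear W d (-1)) ∘ fun i : Fin d => (X (Sum.inl i) : PS₂ W d)) = diagGen W d :=
    funext fun i => shear_X_inl_eq_diagGen i
  rw [h3] at h2
  have h4 : diag W d (t - inclRight W d (killCompl Function.Embedding.inr (shear W d 1 t))) = 0 := by
    have : Ideal.span (Set.range (diagGen W d)) ≤ RingHom.ker (diag W d) := by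
      rw [Ideal.span_le]
      rintro _ ⟨i, rfl⟩
      exact diag_diagGen W d i
    exact this h2
  rw [map_sub, diag_inclRight, sub_eq_zero] at h4
  rwa [h4]

lemma ker_diag : RingHom.ker (diag W d) = Ideal.span (Set.range (diagGen W d)) := by
  refine le_antisymm (fun t ht => ?_) ?_
  · have h := sub_inclRight_diag_mem W d t
    rwa [RingHom.mem_ker.1 ht, map_zero, sub_zero] at h
  · rw [Ideal.span_le]
    rintro _ ⟨i, rfl⟩
    exact diag_diagGen W d i

/-- An `R`-module as an `S`-module through the multiplication map. -/
abbrev diagRestrict (M : ModuleCat.{u} (PS W d)) : ModuleCat.{u} (PS₂ W d) :=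
  (ModuleCat.restrictScalars.{u} (diag W d)).obj M

variable {W d}

lemma smul_id_diagRestrict (M : ModuleCat.{u} (PS W d)) (s : PS₂ W d)
    (hs : s ∈ RingHom.ker (diag W d)) : s • 𝟙 (diagRestrict W d M) = 0 := by
  refine ModuleCat.hom_ext (LinearMap.ext fun m => ?_)
  change diag W d s • (show M from m) = 0
  rw [RingHom.mem_ker.1 hs, zero_smul]

/-- Division by `x_i - y_i` on a base change. -/
def baseChangeDiv (i : Fin d) (M : ModuleCat.{u} (PS W d)) :
    baseChange (inclRight W d) M →+ baseChange (inclRight W d) M :=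
  baseChangeMapLeft (diagDiv i) (diagDiv_inclRight_mul i) M

lemma baseChangeDiv_diagGen_smul (i : Fin d) (M : ModuleCat.{u} (PS W d))
    (n : baseChange (inclRight W d) M) : baseChangeDiv i M (diagGen W d i • n) = n := by
  refine baseChange_induction (p := fun n => baseChangeDiv i M (diagGen W d i • n) = n) ?_ ?_ ?_ n
  · rw [smul_zero, map_zero]
  · intro a b ha hb
    rw [smul_add, map_add, ha, hb]
  · intro s m
    rw [smul_smul, baseChangeDiv, baseChangeMapLeft_smul, diagDiv_diagGen_mul]

lemma baseChangeDiv_diagGen_smul_of_ne {i j : Fin d} (hij : j ≠ i) (M : ModuleCat.{u} (PS W d))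
    (n : baseChange (inclRight W d) M) :
    baseChangeDiv i M (diagGen W d j • n) = diagGen W d j • baseChangeDiv i M n := by
  refine baseChange_induction (p := fun n => baseChangeDiv i M (diagGen W d j • n) =
    diagGen W d j • baseChangeDiv i M n) ?_ ?_ ?_ n
  · rw [smul_zero, map_zero, smul_zero]
  · intro a b ha hb
    rw [smul_add, map_add, ha, hb, map_add, smul_add]
  · intro s m
    rw [smul_smul, baseChangeDiv, baseChangeMapLeft_smul, baseChangeMapLeft_smul,
      diagDiv_diagGen_mul_of_ne hij, smul_smul]

/-- No flatness of `M` is needed: division by each `x_i - y_i` is an operator on `S` linear over the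
right copy of `R`, so it exists on every base change and commutes with the other generators. -/
lemma isKoszulRegular_diagGens [Nontrivial W] (M : ModuleCat.{u} (PS W d)) :
    IsKoszulRegular (diagGens W d) (baseChange (inclRight W d) M) := by
  classical
  obtain ⟨ρ, hρ⟩ : ∃ ρ : PS₂ W d → baseChange (inclRight W d) M →+ baseChange (inclRight W d) M,
      ∀ i, ρ (diagGen W d i) = baseChangeDiv i M :=
    ⟨Function.extend (diagGen W d) (fun i => baseChangeDiv i M) 0,
      fun i => diagGen_injective.extend_apply _ _ i⟩
  refine isKoszulRegular_of_retractions _ _ ρ ?_ ?_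
  · intro z hz n
    obtain ⟨i, rfl⟩ := (List.mem_ofFn' _ _).1 hz
    rw [hρ]
    exact baseChangeDiv_diagGen_smul i M n
  · refine List.pairwise_ofFn.2 fun j i hij n => ?_
    rw [hρ]
    exact baseChangeDiv_diagGen_smul_of_ne hij.ne M n

variable (W d) in
/-- The projection `S ⊗_R M ⟶ M`. -/
def diagProj (M : ModuleCat.{u} (PS W d)) :
    baseChange (inclRight W d) M ⟶ diagRestrict W d M :=
  baseChangeDesc (N := diagRestrict W d M)
    ({ toFun := fun m => m, map_zero' := rfl, map_add' := fun _ _ => rfl } : M →+ diagRestrict W d M)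
    (fun r m => by
      change r • m = diag W d (inclRight W d r) • (show M from m)
      rw [diag_inclRight])

lemma diagProj_toBaseChange (M : ModuleCat.{u} (PS W d)) (m : M) :
    (diagProj W d M).hom (toBaseChange _ M m) = m := baseChangeDesc_toBaseChange _ _ m

lemma diagProj_naturality {M M' : ModuleCat.{u} (PS W d)} (g : M ⟶ M') :
    baseChangeMap (inclRight W d) g ≫ diagProj W d M' =
      diagProj W d M ≫ (ModuleCat.restrictScalars.{u} (diag W d)).map g := by
  refine baseChange_hom_ext fun m => ?_
  change (diagProj W d M').hom (toBaseChange _ M' (g.hom m)) =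
    g.hom ((diagProj W d M).hom (toBaseChange _ M m))
  rw [diagProj_toBaseChange, diagProj_toBaseChange]

lemma koszulProj_smul_eq_zero (M : ModuleCat.{u} (PS W d)) {s : PS₂ W d}
    (hs : s ∈ RingHom.ker (diag W d)) (n : baseChange (inclRight W d) M) :
    (koszulProj (diagGens W d) (baseChange (inclRight W d) M)).hom (s • n) = 0 := by
  rw [ker_diag] at hs
  induction hs using Submodule.span_induction generalizing n with
  | mem z hz =>
    have hz' : z ∈ diagGens W d := (List.mem_ofFn' _ _).2 hz
    rw [map_smul]
    exact congrArg (fun t => t.hom n)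
      (smul_koszulProj (diagGens W d) (baseChange (inclRight W d) M) hz')
  | zero => rw [zero_smul, map_zero]
  | add a b _ _ ha hb => rw [add_smul, map_add, ha, hb, add_zero]
  | smul a b _ hb => rw [smul_eq_mul, mul_comm, mul_smul, hb]

lemma koszulProj_toBaseChange_smul (M : ModuleCat.{u} (PS W d)) (s : PS₂ W d) (m : M) :
    (koszulProj (diagGens W d) (baseChange (inclRight W d) M)).hom
        (toBaseChange _ M (diag W d s • m)) =
      s • (koszulProj (diagGens W d) (baseChange (inclRight W d) M)).hom (toBaseChange _ M m) := by
  rw [toBaseChange_smul, ← LinearMap.map_smul, ← sub_eq_zero, ← LinearMap.map_sub, ← sub_smul]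
  refine koszulProj_smul_eq_zero M ?_ _
  rw [RingHom.mem_ker, map_sub, diag_inclRight, sub_self]

variable (W d) in
/-- The inverse of the identification of `M` with the quotient of `S ⊗_R M` by the `x_i - y_i`. -/
def toKoszulQuot (M : ModuleCat.{u} (PS W d)) :
    diagRestrict W d M ⟶ koszulQuot (diagGens W d) (baseChange (inclRight W d) M) :=
  ModuleCat.ofHom (X := diagRestrict W d M)
    { toFun := fun m => (koszulProj (diagGens W d) (baseChange (inclRight W d) M)).hom
        (toBaseChange _ M m)
      map_add' := fun a b =>
        (congrArg _ (map_add (toBaseChange _ M) a b)).trans (map_add _ _ _)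
      map_smul' := fun s m => koszulProj_toBaseChange_smul M s m }

lemma diagProj_toKoszulQuot (M : ModuleCat.{u} (PS W d)) :
    diagProj W d M ≫ toKoszulQuot W d M =
      koszulProj (diagGens W d) (baseChange (inclRight W d) M) := by
  refine baseChange_hom_ext fun m => ?_
  change (toKoszulQuot W d M).hom ((diagProj W d M).hom (toBaseChange _ M m)) = _
  rw [diagProj_toBaseChange]
  rfl

instance isIso_toKoszulQuot (M : ModuleCat.{u} (PS W d)) : IsIso (toKoszulQuot W d M) := by
  obtain ⟨g, hg⟩ := exists_koszulProj_comp (diagGens W d) (diagProj W d M) (by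
    intro z hz
    obtain ⟨i, rfl⟩ := (List.mem_ofFn' _ _).1 hz
    have h := smul_id_diagRestrict M (diagGen W d i) (diag_diagGen W d i)
    rw [← Category.comp_id (diagProj W d M), ← Linear.comp_smul, h, Limits.comp_zero])
  have hepi : Epi (diagProj W d M) := (ModuleCat.epi_iff_surjective _).2 fun m =>
    ⟨toBaseChange _ M m, diagProj_toBaseChange M m⟩
  refine ⟨g, ?_, ?_⟩
  · rw [← cancel_epi (diagProj W d M), ← Category.assoc, diagProj_toKoszulQuot, hg,
      Category.comp_id]
  · rw [← cancel_epi (koszulProj (diagGens W d) (baseChange (inclRight W d) M)), ← Category.assoc,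
      hg, diagProj_toKoszulQuot, Category.comp_id]

lemma toKoszulQuot_naturality {M M' : ModuleCat.{u} (PS W d)} (g : M ⟶ M') :
    toKoszulQuot W d M ≫ koszulQuotMap (diagGens W d) (baseChangeMap (inclRight W d) g) =
      (ModuleCat.restrictScalars.{u} (diag W d)).map g ≫ toKoszulQuot W d M' := by
  have hepi : Epi (diagProj W d M) := (ModuleCat.epi_iff_surjective _).2 fun m =>
    ⟨toBaseChange _ M m, diagProj_toBaseChange M m⟩
  rw [← cancel_epi (diagProj W d M), ← Category.assoc, diagProj_toKoszulQuot,
    koszulProj_naturality, ← Category.assoc, ← diagProj_naturality, Category.assoc,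
    diagProj_toKoszulQuot]

variable [Nontrivial W]

/-- The fundamental class in `Ext_S^d(M, S ⊗_R M)`. -/
def fundClass (M : ModuleCat.{u} (PS W d)) :
    Ext.{u} (diagRestrict W d M) (baseChange (inclRight W d) M) d :=
  (Ext.mk₀ (toKoszulQuot W d M)).comp (koszulExt (diagGens W d) _ (isKoszulRegular_diagGens M))
    (by rw [zero_add]; exact List.length_ofFn)

lemma fundClass_naturality {M M' : ModuleCat.{u} (PS W d)} (g : M ⟶ M') :
    (fundClass M).comp (Ext.mk₀ (baseChangeMap (inclRight W d) g)) (add_zero d) =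
      (Ext.mk₀ ((ModuleCat.restrictScalars.{u} (diag W d)).map g)).comp (fundClass M')
        (zero_add d) := by
  have hl : (diagGens W d).length = d := List.length_ofFn
  rw [fundClass, fundClass, Ext.comp_assoc _ _ _ _ (add_zero _) (by omega),
    koszulExt_naturality _ _ (isKoszulRegular_diagGens M'),
    ← Ext.comp_assoc _ _ _ (add_zero 0) _ (by omega), Ext.mk₀_comp_mk₀, toKoszulQuot_naturality,
    ← Ext.mk₀_comp_mk₀, Ext.comp_assoc _ _ _ _ _ (by omega)]

lemma koszulClass_fundClass (M : ModuleCat.{u} (PS W d)) :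
    KoszulClass (IsScalarIn (RingHom.ker (diag W d))) (fundClass M) := by
  -- The degree is the length of the list, equal to `d` only propositionally, so it is generalized
  -- before substitution.
  have key : ∀ (k : ℕ) (h : 0 + (diagGens W d).length = k),
      KoszulClass (IsScalarIn (RingHom.ker (diag W d))) ((Ext.mk₀ (toKoszulQuot W d M)).comp
        (koszulExt (diagGens W d) _ (isKoszulRegular_diagGens M)) h) := by
    rintro k h
    obtain rfl : k = (diagGens W d).length := by omega
    refine (koszulClass_koszulExt _ _ (fun z hz => ?_) _ _).iso_comp _
    obtain ⟨i, rfl⟩ := (List.mem_ofFn' _ _).1 hz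
    exact diag_diagGen W d i
  exact key d _

end Diagonal

end GrossHopkins
end

noncomputable section

namespace GrossHopkins

/-! ### Semilinear maps on left derived functors -/

section TorTwist

open Abelian Limits

universe u₁ v₁ w₁ u₂ v₂ w₂

variable {C : Type u₁} [Category.{v₁} C] [Abelian C]
variable {D : Type u₂} [Category.{v₂} D] [Abelian D]

lemma leftHomologyData_π_descOpcycles {S : ShortComplex C} (h : S.LeftHomologyData) {Y : C}
    (g : S.X₂ ⟶ Y) (hg : S.f ≫ g = 0) :
    h.π ≫ h.homologyIso.inv ≫ S.homologyι ≫ S.descOpcycles g hg = h.i ≫ g := by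
  rw [h.π_comp_homologyIso_inv_assoc, S.homology_π_ι_assoc, S.p_descOpcycles,
    h.cyclesIso_inv_comp_iCycles_assoc]

lemma mapHomologyIso_hom_descOpcycles (S : ShortComplex C) (F : C ⥤ D) [F.Additive]
    [F.PreservesHomology] {Y : C} (g : S.X₂ ⟶ Y) (hg : S.f ≫ g = 0)
    (hg' : (S.map F).f ≫ F.map g = 0) :
    (S.mapHomologyIso F).hom ≫ F.map (S.homologyι ≫ S.descOpcycles g hg) =
      (S.map F).homologyι ≫ (S.map F).descOpcycles (F.map g) hg' := by
  let h := S.leftHomologyData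
  have e : (h.map F).homologyIso.inv ≫ (S.mapHomologyIso F).hom = F.map h.homologyIso.inv := by
    rw [h.mapHomologyIso_eq F]
    exact (h.map F).homologyIso.inv_hom_id_assoc (F.map h.homologyIso.inv)
  rw [← cancel_epi (h.map F).homologyIso.inv, reassoc_of% e, ← cancel_epi (h.map F).π,
    leftHomologyData_π_descOpcycles (h.map F) (F.map g) hg']
  have h2 := congrArg F.map (leftHomologyData_π_descOpcycles h g hg)
  simp only [F.map_comp] at h2 ⊢
  exact h2

lemma mapHomologyIso_hom_homologyDesc (L : ChainComplex C ℕ) (n : ℕ) (F : C ⥤ D) [F.Additive]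
    [F.PreservesHomology] {Y : C} (g : L.X n ⟶ Y) (hg : L.d (n + 1) n ≫ g = 0)
    (hg' : F.map (L.d (n + 1) n) ≫ F.map g = 0) :
    ((L.sc n).mapHomologyIso F).hom ≫ F.map (homologyDesc L n g hg) =
      homologyDesc ((F.mapHomologicalComplex (ComplexShape.down ℕ)).obj L) n (F.map g) hg' :=
  mapHomologyIso_hom_descOpcycles (L.sc n) F g _ _

lemma twist_chain {C : Type*} [Category C] {E : C ⥤ C} {X X₁ X₂ X₃ X₄ X₅ X₆ Y : C} {a : X ⟶ X₁} {i : X ≅ X₂} {α : X₂ ⟶ X₃}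
    {i' : X₃ ⟶ X₁} {b : X₁ ⟶ X₄} {j : X₄ ≅ X₅} {s : X₃ ⟶ X₅} {t : X₅ ⟶ X₆} {m : X₆ ⟶ E.obj X₂}
    {g : X₂ ⟶ Y} (ha : a = i.hom ≫ α ≫ i') (hb : i' ≫ b = s ≫ j.inv) :
    (a ≫ b ≫ j.hom ≫ t ≫ m ≫ E.map i.inv) ≫ E.map (i.hom ≫ g) =
      i.hom ≫ α ≫ s ≫ t ≫ m ≫ E.map g := by
  simp only [ha, Category.assoc, reassoc_of% hb, Iso.inv_hom_id_assoc, ← E.map_comp]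

variable [EnoughProjectives C]

/-- The composite in the definition of `torSemilinear`, followed by a map given by a cochain `g`, is
again given by a cochain. Every factor is computed on the single resolution `P`, through a chain
lift `s` of `b`. -/
lemma leftDerived_twist (E G G' : C ⥤ C) [E.Additive] [G.Additive] [G'.Additive]
    [E.PreservesHomology] [E.PreservesProjectiveObjects] (α : G ⟶ G') (tw : E ⋙ G' ⟶ G ⋙ E)
    {B : C} (P : ProjectiveResolution B) (b : B ⟶ E.obj B)
    (s : P.complex ⟶ (E.mapProjectiveResolution P).complex)
    (comm : s.f 0 ≫ (E.mapProjectiveResolution P).π.f 0 = P.π.f 0 ≫ b) (n : ℕ) {Y : C}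
    (g : G.obj (P.complex.X n) ⟶ Y) (hg : G.map (P.complex.d (n + 1) n) ≫ g = 0)
    (hg' : G.map (P.complex.d (n + 1) n) ≫
      α.app (P.complex.X n) ≫ G'.map (s.f n) ≫ tw.app (P.complex.X n) ≫ E.map g = 0) :
    ((NatTrans.leftDerived α n).app B ≫ (G'.leftDerived n).map b ≫
      ((E.mapProjectiveResolution P).isoLeftDerivedObj G' n).hom ≫
      (HomologicalComplex.homologyFunctor C (ComplexShape.down ℕ) n).map
        ((NatTrans.mapHomologicalComplex tw (ComplexShape.down ℕ)).app P.complex) ≫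
      (((G.mapHomologicalComplex (ComplexShape.down ℕ)).obj P.complex).sc n
        |>.mapHomologyIso E).hom ≫ E.map (P.isoLeftDerivedObj G n).inv) ≫
      E.map ((P.isoLeftDerivedObj G n).hom ≫
        homologyDesc ((G.mapHomologicalComplex (ComplexShape.down ℕ)).obj P.complex) n g hg) =
    (P.isoLeftDerivedObj G n).hom ≫
      homologyDesc ((G.mapHomologicalComplex (ComplexShape.down ℕ)).obj P.complex) n
        (α.app (P.complex.X n) ≫ G'.map (s.f n) ≫ tw.app (P.complex.X n) ≫ E.map g) hg' := by
  have h1 := P.leftDerived_app_eq α n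
  have h2 := ProjectiveResolution.isoLeftDerivedObj_inv_naturality b P
    (E.mapProjectiveResolution P) s comm G' n
  have hg2 : E.map (G.map (P.complex.d (n + 1) n)) ≫ E.map g = 0 := by
    rw [← E.map_comp, hg, E.map_zero]
  have h3 := mapHomologyIso_hom_homologyDesc
    ((G.mapHomologicalComplex (ComplexShape.down ℕ)).obj P.complex) n E g hg hg2
  refine (twist_chain h1 h2).trans ?_
  refine congrArg (fun t => (P.isoLeftDerivedObj G n).hom ≫ t) ?_
  refine (congrArg (fun t => _ ≫ _ ≫ _ ≫ t) h3).trans ?_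
  refine (congrArg (fun t => _ ≫ _ ≫ t) (homologyMap_homologyDesc _ _ _ _)).trans ?_
  refine (congrArg (fun t => _ ≫ t) (homologyMap_homologyDesc _ _ _ _)).trans ?_
  exact homologyMap_homologyDesc _ _ _ _

end TorTwist

end GrossHopkins
end

noncomputable section

namespace GrossHopkins

/-! ### The cap product `Tor_n(A, A) → A` -/

section Cap

open Abelian Limits

/-- The augmentation of a projective resolution, as an isomorphism from the opcycles. -/
def opcyclesZeroIso {C : Type*} [Category* C] [Abelian C] {X : C} (P : ProjectiveResolution X) :
    P.complex.opcycles 0 ≅ X :=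
  (P.complex.opcyclesIsCokernel 1 0 (by simp)).coconePointUniqueUpToIso P.isColimitCokernelCofork

lemma pOpcycles_opcyclesZeroIso {C : Type*} [Category* C] [Abelian C] {X : C}
    (P : ProjectiveResolution X) :
    P.complex.pOpcycles 0 ≫ (opcyclesZeroIso P).hom = P.π.f 0 :=
  IsColimit.comp_coconePointUniqueUpToIso_hom (P.complex.opcyclesIsCokernel 1 0 (by simp))
    P.isColimitCokernelCofork WalkingParallelPair.one

lemma exists_cocycle {C : Type*} [Category* C] [Abelian C] [HasExt C] {X : C}
    (P : ProjectiveResolution X) {Y : C} {n : ℕ} (c : Ext X Y n) :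
    ∃ h : P.complex.opcycles n ⟶ Y,
      (syzygyClass P.complex P.complex_exactAt_succ n).comp (Ext.mk₀ h) (add_zero n) =
        (Ext.mk₀ (opcyclesZeroIso P).hom).comp c (zero_add n) := by
  obtain ⟨y, hy⟩ := syzygyClass_comp_surjective P.complex_exactAt_succ P.projective n 0
    (add_zero n) ((Ext.mk₀ (opcyclesZeroIso P).hom).comp c (zero_add n))
  obtain ⟨h, rfl⟩ := (Ext.mk₀_bijective _ _).2 y
  exact ⟨h, hy⟩

/-- A cocycle on a projective resolution representing an extension class. -/
def cocycle {C : Type*} [Category* C] [Abelian C] [HasExt C] {X : C}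
    (P : ProjectiveResolution X) {Y : C} {n : ℕ} (c : Ext X Y n) : P.complex.opcycles n ⟶ Y :=
  (exists_cocycle P c).choose

lemma syzygyClass_comp_cocycle {C : Type*} [Category* C] [Abelian C] [HasExt C] {X : C}
    (P : ProjectiveResolution X) {Y : C} {n : ℕ} (c : Ext X Y n) :
    (syzygyClass P.complex P.complex_exactAt_succ n).comp (Ext.mk₀ (cocycle P c)) (add_zero n) =
      (Ext.mk₀ (opcyclesZeroIso P).hom).comp c (zero_add n) :=
  (exists_cocycle P c).choose_spec

lemma syzygyClass_comp_cocycle_comp {C : Type*} [Category* C] [Abelian C] [HasExt C] {X : C}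
    (P : ProjectiveResolution X) {Y Z : C} {n : ℕ} (c : Ext X Y n) (k : Y ⟶ Z) :
    (syzygyClass P.complex P.complex_exactAt_succ n).comp (Ext.mk₀ (cocycle P c ≫ k)) (add_zero n) =
      (Ext.mk₀ (opcyclesZeroIso P).hom).comp (c.comp (Ext.mk₀ k) (add_zero n)) (zero_add n) := by
  rw [← Ext.mk₀_comp_mk₀, ← Ext.comp_assoc _ _ _ (add_zero n) _ (by omega),
    syzygyClass_comp_cocycle, Ext.comp_assoc _ _ _ _ _ (by omega)]

lemma mapProjectiveResolution_π_f_zero {C D : Type*} [Category* C] [Abelian C] [Category* D]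
    [Abelian D] (F : C ⥤ D) [F.Additive] [F.PreservesProjectiveObjects] [F.PreservesHomology]
    {X : C} (P : ProjectiveResolution X) :
    (F.mapProjectiveResolution P).π.f 0 = F.map (P.π.f 0) := by
  refine (congrArg (fun k => F.map (P.π.f 0) ≫ k)
    (HomologicalComplex.singleMapHomologicalComplex_hom_app_self F (ComplexShape.down ℕ) 0 X)).trans ?_
  refine (congrArg (fun k => F.map (P.π.f 0) ≫ k) ?_).trans (Category.comp_id _)
  refine (congrArg (fun k => k ≫ 𝟙 _) (F.map_id X)).trans (Category.comp_id _)

lemma opcyclesDesc_opcyclesZeroIso {C D : Type*} [Category* C] [Abelian C] [Category* D]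
    [Abelian D] (F : C ⥤ D) [F.Additive] {X : C} {Y : D} (P : ProjectiveResolution X)
    (Q : ProjectiveResolution Y) (s : ∀ n, Q.complex.X n ⟶ F.obj (P.complex.X n))
    (hs : ∀ i j, Q.complex.d i j ≫ s j = s i ≫ F.map (P.complex.d i j)) (b : Y ⟶ F.obj X)
    (hb : s 0 ≫ F.map (P.π.f 0) = Q.π.f 0 ≫ b) :
    opcyclesDesc F s hs 0 ≫ F.map (opcyclesZeroIso P).hom = (opcyclesZeroIso Q).hom ≫ b := by
  rw [← cancel_epi (Q.complex.pOpcycles 0), ← Category.assoc, pOpcycles_opcyclesDesc,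
    ← Category.assoc, pOpcycles_opcyclesZeroIso, Category.assoc, ← F.map_comp,
    pOpcycles_opcyclesZeroIso]
  exact hb

variable {S : Type u} [CommRing S]

/-- Evaluation of a cocycle on the complex computing `Tor`. -/
def capMap {A : ModuleCat.{u} S} (P : ProjectiveResolution A) {n : ℕ}
    (h : P.complex.opcycles n ⟶ ModuleCat.of S S) :
    ((tensoringLeft (ModuleCat.{u} S)).obj A).obj (P.complex.X n) ⟶ A :=
  A ◁ (P.complex.pOpcycles n ≫ h) ≫ (ρ_ A).hom

lemma d_capMap {A : ModuleCat.{u} S} (P : ProjectiveResolution A) {n : ℕ}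
    (h : P.complex.opcycles n ⟶ ModuleCat.of S S) :
    ((tensoringLeft (ModuleCat.{u} S)).obj A).map (P.complex.d (n + 1) n) ≫ capMap P h = 0 := by
  change A ◁ (P.complex.d (n + 1) n) ≫ A ◁ (P.complex.pOpcycles n ≫ h) ≫ (ρ_ A).hom = 0
  rw [← MonoidalCategory.whiskerLeft_comp_assoc, P.complex.d_pOpcycles_assoc, zero_comp,
    MonoidalPreadditive.whiskerLeft_zero, zero_comp]

/-- The cap product with `c`, as a map `Tor_n(A, A) ⟶ A`. -/
def cap {A : ModuleCat.{u} S} {n : ℕ} (c : Ext.{u} A (ModuleCat.of S S) n) :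
    ((Tor (ModuleCat.{u} S) n).obj A).obj A ⟶ A :=
  ((projectiveResolution A).isoLeftDerivedObj ((tensoringLeft (ModuleCat.{u} S)).obj A) n).hom ≫
    homologyDesc ((((tensoringLeft (ModuleCat.{u} S)).obj A).mapHomologicalComplex
      (ComplexShape.down ℕ)).obj (projectiveResolution A).complex) n
      (capMap _ (cocycle (projectiveResolution A) c)) (d_capMap _ _)

section Iso

variable {R : Type u} [CommRing R] (π : S →+* R)

/-- The quotient map `S ⟶ R` as a map of `S`-modules. -/
def augmentation : ModuleCat.of S S ⟶
    (ModuleCat.restrictScalars.{u} π).obj (ModuleCat.of R R) :=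
  ModuleCat.ofHom (Y := (ModuleCat.restrictScalars.{u} π).obj (ModuleCat.of R R))
    { toFun := fun s => π s, map_add' := map_add π, map_smul' := map_mul π }

/-- The map `X ⟶ R ⊗_S X`, `x ↦ 1 ⊗ x`. -/
def tensorUnit (X : ModuleCat.{u} S) : X ⟶
    ((tensoringLeft (ModuleCat.{u} S)).obj
      ((ModuleCat.restrictScalars.{u} π).obj (ModuleCat.of R R))).obj X :=
  (λ_ X).inv ≫ augmentation π ▷ X

lemma tensorUnit_naturality {X Y : ModuleCat.{u} S} (f : X ⟶ Y) :
    tensorUnit π X ≫ ((tensoringLeft (ModuleCat.{u} S)).obj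
      ((ModuleCat.restrictScalars.{u} π).obj (ModuleCat.of R R))).map f = f ≫ tensorUnit π Y := by
  refine (Category.assoc _ _ _).trans ?_
  refine (congrArg (fun t => _ ≫ t) (whisker_exchange (augmentation π) f).symm).trans ?_
  exact leftUnitor_inv_naturality_assoc f _

/-- The property of being killed by the kernel of `π`. -/
def IsKilledByKer (X : ModuleCat.{u} S) : Prop := ∀ s ∈ RingHom.ker π, s • 𝟙 X = 0

variable {π}

lemma IsKilledByKer.smul_eq {X : ModuleCat.{u} S} (hX : IsKilledByKer π X) {s t : S}
    (hst : π s = π t) (x : X) : s • x = t • x := by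
  have h := hX (s - t) (by rw [RingHom.mem_ker, map_sub, hst, sub_self])
  have h2 : (s - t) • x = 0 := congrArg (fun f => f.hom x) h
  rwa [sub_smul, sub_eq_zero] at h2

lemma isKilledByKer_of_smul {X : ModuleCat.{u} S} (h : ∀ s ∈ RingHom.ker π, ∀ x : X, s • x = 0) :
    IsKilledByKer π X := fun s hs => ModuleCat.hom_ext (LinearMap.ext fun x => h s hs x)

lemma isKilledByKer_of_epi {X Y : ModuleCat.{u} S} (f : X ⟶ Y) (hf : Epi f)
    (hX : IsKilledByKer π X) : IsKilledByKer π Y := fun s hs => by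
  rw [← cancel_epi f, Linear.comp_smul, Category.comp_id, comp_zero,
    ← Category.id_comp f, ← Linear.smul_comp, hX s hs, zero_comp]

lemma isKilledByKer_restrictScalars (M : ModuleCat.{u} R) :
    IsKilledByKer π ((ModuleCat.restrictScalars.{u} π).obj M) :=
  isKilledByKer_of_smul fun s hs x => by
    change π s • (show M from x) = 0
    rw [RingHom.mem_ker.1 hs, zero_smul]

lemma isKilledByKer_tensor (X : ModuleCat.{u} S) :
    IsKilledByKer π (((tensoringLeft (ModuleCat.{u} S)).obj
      ((ModuleCat.restrictScalars.{u} π).obj (ModuleCat.of R R))).obj X) := by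
  refine isKilledByKer_of_smul fun s hs x => ?_
  induction x using TensorProduct.induction_on with
  | zero => exact smul_zero s
  | tmul a x =>
    have h : s • a = 0 := by
      change π s * (show R from a) = 0
      rw [RingHom.mem_ker.1 hs, zero_mul]
    refine (TensorProduct.smul_tmul' s a x).trans ?_
    rw [h]
    exact TensorProduct.zero_tmul _ x
  | add a b ha hb => exact (smul_add s a b).trans (by rw [ha, hb, add_zero])

variable (hπ : Function.Surjective π)
include hπ

/-- Modules killed by `ker π` are the `R`-modules, and `R` is the largest quotient of `S` of this
kind. The choice of preimages made by `surjInv` is immaterial. -/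
lemma exists_augmentation_comp {X : ModuleCat.{u} S} (hX : IsKilledByKer π X)
    (f : ModuleCat.of S S ⟶ X) : ∃ f' : (ModuleCat.restrictScalars.{u} π).obj (ModuleCat.of R R) ⟶ X,
      augmentation π ≫ f' = f := by
  have key : ∀ s : S, Function.surjInv hπ (π s) • f.hom (1 : S) = s • f.hom (1 : S) := fun s =>
    hX.smul_eq (Function.surjInv_eq hπ _) _
  refine ⟨ModuleCat.ofHom (X := (ModuleCat.restrictScalars.{u} π).obj (ModuleCat.of R R))
    { toFun := fun r => Function.surjInv hπ r • f.hom (1 : S)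
      map_add' := fun a b => ?_
      map_smul' := fun s a => ?_ }, ?_⟩
  · obtain ⟨a, rfl⟩ := hπ a
    obtain ⟨b, rfl⟩ := hπ b
    refine (congrArg (fun t => Function.surjInv hπ t • f.hom (1 : S)) (map_add π a b).symm).trans ?_
    rw [key, key, key, add_smul]
  · obtain ⟨a, rfl⟩ := hπ a
    refine (congrArg (fun t => Function.surjInv hπ t • f.hom (1 : S)) (map_mul π s a).symm).trans ?_
    rw [key, key, mul_smul]
    rfl
  · refine ModuleCat.hom_ext (LinearMap.ext fun s => ?_)
    refine (key s).trans ?_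
    rw [← map_smul]
    exact congrArg f.hom (mul_one s)

/-- Likewise `R ⊗_S Z` is the universal module under `Z` killed by `ker π`. -/
lemma exists_tensorUnit_comp {X Z : ModuleCat.{u} S} (hX : IsKilledByKer π X) (f : Z ⟶ X) :
    ∃ f' : ((tensoringLeft (ModuleCat.{u} S)).obj
      ((ModuleCat.restrictScalars.{u} π).obj (ModuleCat.of R R))).obj Z ⟶ X,
      tensorUnit π Z ≫ f' = f := by
  have key : ∀ (s : S) (z : Z), Function.surjInv hπ (π s) • f.hom z = s • f.hom z := fun s z =>
    hX.smul_eq (Function.surjInv_eq hπ _) _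
  let F : (ModuleCat.restrictScalars.{u} π).obj (ModuleCat.of R R) →ₗ[S] Z →ₗ[S] X :=
    { toFun := fun r => Function.surjInv hπ r • f.hom
      map_add' := fun a b => ?_
      map_smul' := fun s a => ?_ }
  · refine ⟨ModuleCat.ofHom (TensorProduct.lift F), ModuleCat.hom_ext (LinearMap.ext fun z => ?_)⟩
    change Function.surjInv hπ (π 1) • f.hom z = _
    rw [key, one_smul]
  · refine LinearMap.ext fun z => ?_
    obtain ⟨a, rfl⟩ := hπ a
    obtain ⟨b, rfl⟩ := hπ b
    refine (congrArg (fun t => Function.surjInv hπ t • f.hom z) (map_add π a b).symm).trans ?_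
    change _ = Function.surjInv hπ (π a) • f.hom z + Function.surjInv hπ (π b) • f.hom z
    rw [key, key, key, add_smul]
  · refine LinearMap.ext fun z => ?_
    obtain ⟨a, rfl⟩ := hπ a
    refine (congrArg (fun t => Function.surjInv hπ t • f.hom z) (map_mul π s a).symm).trans ?_
    change _ = s • Function.surjInv hπ (π a) • f.hom z
    rw [key, key, mul_smul]

lemma epi_augmentation : Epi (augmentation π) := (ModuleCat.epi_iff_surjective _).2 hπ

lemma epi_tensorUnit (X : ModuleCat.{u} S) : Epi (tensorUnit π X) := by
  have := epi_augmentation hπ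
  refine (ModuleCat.epi_iff_surjective _).2 fun y => ?_
  induction y using TensorProduct.induction_on with
  | zero => exact ⟨0, map_zero _⟩
  | tmul a x =>
    obtain ⟨s, rfl⟩ := hπ a
    refine ⟨s • x, (map_smul (tensorUnit π X).hom s x).trans ?_⟩
    refine (TensorProduct.smul_tmul' s _ x).trans ?_
    refine congrArg (fun t => t ⊗ₜ[S] x) ?_
    change π s * π 1 = π s
    rw [map_one, mul_one]
  | add a b ha hb =>
    obtain ⟨a', rfl⟩ := ha
    obtain ⟨b', rfl⟩ := hb
    exact ⟨a' + b', map_add _ _ _⟩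

/-- The complex `A ⊗ P` is the largest quotient of `P` killed by `ker π`, and `hc` says that on
modules `X` killed by `ker π` the functor `Ext^n(A, X)` is `Hom(S, X)`, through `c`. This is the
situation of `isIso_homologyDesc`, with `A` as the reflection of `S`. -/
lemma isIso_cap {n : ℕ} (c : Ext.{u} ((ModuleCat.restrictScalars.{u} π).obj (ModuleCat.of R R))
      (ModuleCat.of S S) n)
    (hc : ∀ X : ModuleCat.{u} S, IsKilledByKer π X → Function.Bijective
      fun y : Ext.{u} (ModuleCat.of S S) X 0 => c.comp y (add_zero n)) : IsIso (cap c) := by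
  let A := (ModuleCat.restrictScalars.{u} π).obj (ModuleCat.of R R)
  let P := projectiveResolution A
  have inj : ∀ {X : ModuleCat.{u} S} {m : ℕ} (y y' : Ext.{u} A X m),
      (Ext.mk₀ (opcyclesZeroIso P).hom).comp y (zero_add m) =
        (Ext.mk₀ (opcyclesZeroIso P).hom).comp y' (zero_add m) → y = y' := by
    intro X m y y' h
    have h' := congrArg (fun t => (Ext.mk₀ (opcyclesZeroIso P).inv).comp t (zero_add m)) h
    simpa using h'
  have := isIso_homologyDesc (K := P.complex)
    (L := (((tensoringLeft (ModuleCat.{u} S)).obj A).mapHomologicalComplex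
      (ComplexShape.down ℕ)).obj P.complex)
    { f := fun n => tensorUnit π (P.complex.X n)
      comm' := fun i j _ => tensorUnit_naturality π (P.complex.d i j) }
    (fun n => epi_tensorUnit hπ (P.complex.X n)) (augmentation π) (epi_augmentation hπ)
    (IsKilledByKer π) (fun X hX n f => exists_tensorUnit_comp hπ hX f)
    (fun X hX f => exists_augmentation_comp hπ hX f)
    (fun n => isKilledByKer_tensor (P.complex.X n)) (isKilledByKer_restrictScalars _)
    (fun X Y f hf hX => isKilledByKer_of_epi f hf hX) P.complex_exactAt_succ P.projective n
    (cocycle P c) (capMap P (cocycle P c)) (d_capMap P _) ?_ ?_ ?_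
  · exact IsIso.comp_isIso' (Iso.isIso_hom _) this
  · refine ModuleCat.hom_ext (LinearMap.ext fun x => ?_)
    change (show S from (cocycle P c).hom ((P.complex.pOpcycles n).hom x)) • (show A from π 1) = _
    change π _ * π 1 = π _
    rw [map_one, mul_one]
    rfl
  · intro X hX y
    obtain ⟨y', hy'⟩ := (hc X hX).2 ((Ext.mk₀ (opcyclesZeroIso P).inv).comp
      ((syzygyClass P.complex P.complex_exactAt_succ n).comp (Ext.mk₀ y) (add_zero n)) (zero_add n))
    obtain ⟨k, rfl⟩ := (Ext.mk₀_bijective _ _).2 y'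
    refine ⟨k, ?_⟩
    rw [syzygyClass_comp_cocycle_comp]
    dsimp only at hy'
    rw [hy']
    simp
  · intro X hX k k' h
    rw [syzygyClass_comp_cocycle_comp, syzygyClass_comp_cocycle_comp] at h
    exact (Ext.mk₀_bijective _ _).1 ((hc X hX).1 (inj _ _ h))

end Iso

section Twist

/-- A ring automorphism as a semilinear endomorphism of the ring. -/
def ringTwist (e : S ≃+* S) : ModuleCat.of S S ⟶
    (ModuleCat.restrictScalars.{u} e.toRingHom).obj (ModuleCat.of S S) :=
  ModuleCat.ofHom (Y := (ModuleCat.restrictScalars.{u} e.toRingHom).obj (ModuleCat.of S S))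
    { toFun := fun s => e s, map_add' := map_add e, map_smul' := map_mul e }

/-- The map `a ⊗ s ↦ s • f a`. -/
def twistEval (e : S ≃+* S) {A : ModuleCat.{u} S} (f : A →ₛₗ[(e : S →+* S)] A) :
    A ⊗ (ModuleCat.restrictScalars.{u} e.toRingHom).obj (ModuleCat.of S S) ⟶
      (ModuleCat.restrictScalars.{u} e.toRingHom).obj A :=
  twistHom e f ▷ _ ≫ Functor.LaxMonoidal.μ (ModuleCat.restrictScalars.{u} e.toRingHom) A
    (ModuleCat.of S S) ≫ (ModuleCat.restrictScalars.{u} e.toRingHom).map (ρ_ A).hom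

lemma twistEval_tmul (e : S ≃+* S) {A : ModuleCat.{u} S} (f : A →ₛₗ[(e : S →+* S)] A) (a : A)
    (s : (ModuleCat.restrictScalars.{u} e.toRingHom).obj (ModuleCat.of S S)) :
    (twistEval e f).hom (a ⊗ₜ s) = (show S from s) • f a :=
  (congrArg (ρ_ A).hom.hom
    (ModuleCat.restrictScalars_μ_tmul e.toRingHom A (ModuleCat.of S S) (f a) s)).trans rfl

/-- The hypothesis `hv` says that two cocycles with values in the twisted ring represent the same
`Ext` class. They differ by a coboundary, so their evaluations on `A ⊗ P` agree on homology; one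
evaluation is the left side, the other the right side. -/
lemma cap_comp_twistHom (e : S ≃+* S) {n : ℕ} {A : ModuleCat.{u} S} (f : A →ₛₗ[(e : S →+* S)] A)
    (c : Ext.{u} A (ModuleCat.of S S) n) (v : S)
    (hv : c.comp (Ext.mk₀ (ringTwist e)) (add_zero n) =
      (Ext.mk₀ (twistHom e f)).comp
        ((c.comp (Ext.mk₀ (v • 𝟙 _)) (add_zero n)).mapExactFunctor
          (ModuleCat.restrictScalars.{u} e.toRingHom)) (zero_add n)) :
    cap c ≫ twistHom e f = torSemilinear e n f f ≫
      (ModuleCat.restrictScalars.{u} e.toRingHom).map (cap c ≫ (v • 𝟙 A)) := by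
  let E := ModuleCat.restrictScalars.{u} e.toRingHom
  let P := projectiveResolution A
  let G := (tensoringLeft (ModuleCat.{u} S)).obj A
  let s : P.complex ⟶ (E.mapProjectiveResolution P).complex :=
    ProjectiveResolution.lift (twistHom e f) P (E.mapProjectiveResolution P)
  have comm : s.f 0 ≫ (E.mapProjectiveResolution P).π.f 0 = P.π.f 0 ≫ twistHom e f :=
    ProjectiveResolution.lift_commutes_zero _ _ _
  let h := cocycle P c
  have hs : ∀ i j, P.complex.d i j ≫ s.f j = s.f i ≫ E.map (P.complex.d i j) :=
    fun i j => (s.comm i j).symm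
  let s' := opcyclesDesc E s.f hs
  have hs0 : s' 0 ≫ E.map (opcyclesZeroIso P).hom = (opcyclesZeroIso P).hom ≫ twistHom e f := by
    refine opcyclesDesc_opcyclesZeroIso E P P s.f hs (twistHom e f) ?_
    exact (congrArg (fun k => s.f 0 ≫ k) (mapProjectiveResolution_π_f_zero E P).symm).trans comm
  -- `y₁` is the cocycle of `c` followed by the ring automorphism; `y₂` is its multiple by `v`
  -- pulled back along the chain lift of `f`.
  let y₁ : P.complex.opcycles n ⟶ E.obj (ModuleCat.of S S) := h ≫ ringTwist e
  let y₂ : P.complex.opcycles n ⟶ E.obj (ModuleCat.of S S) := s' n ≫ E.map (h ≫ (v • 𝟙 _))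
  have hy : (syzygyClass P.complex P.complex_exactAt_succ n).comp (Ext.mk₀ (y₁ - y₂))
      (add_zero n) = 0 := by
    have h₁ : (syzygyClass P.complex P.complex_exactAt_succ n).comp (Ext.mk₀ y₁) (add_zero n) =
        (Ext.mk₀ (opcyclesZeroIso P).hom).comp (c.comp (Ext.mk₀ (ringTwist e)) (add_zero n))
          (zero_add n) := syzygyClass_comp_cocycle_comp P c _
    have h₂ : (syzygyClass P.complex P.complex_exactAt_succ n).comp (Ext.mk₀ y₂) (add_zero n) =
        (Ext.mk₀ (opcyclesZeroIso P).hom).comp ((Ext.mk₀ (twistHom e f)).comp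
        ((c.comp (Ext.mk₀ (v • 𝟙 _)) (add_zero n)).mapExactFunctor E) (zero_add n))
          (zero_add n) := by
      rw [← Ext.mk₀_comp_mk₀, ← Ext.comp_assoc _ _ _ (add_zero n) _ (by omega),
        syzygyClass_comp_opcyclesDesc E P.complex_exactAt_succ P.complex_exactAt_succ s.f hs n,
        Ext.comp_assoc _ _ _ _ (add_zero n) (by omega), ← Ext.mapExactFunctor_mk₀,
        ← Ext.mapExactFunctor_comp, syzygyClass_comp_cocycle_comp, Ext.mapExactFunctor_comp,
        Ext.mapExactFunctor_mk₀, ← Ext.comp_assoc _ _ _ (add_zero 0) _ (by omega),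
        Ext.mk₀_comp_mk₀, hs0, ← Ext.mk₀_comp_mk₀, Ext.comp_assoc _ _ _ _ _ (by omega)]
    rw [sub_eq_add_neg, Ext.mk₀_add, Ext.comp_add, Ext.mk₀_neg, Ext.comp_neg, h₁, h₂, hv,
      add_neg_cancel]
  obtain ⟨t, ht⟩ := exists_eq_of_syzygyClass_comp_eq_zero P.complex_exactAt_succ P.projective n
    (y₁ - y₂) hy
  let M := twistEval e f
  -- Both sides of the claim are evaluations `a ⊗ x ↦ y(x) • f a`, for `y = y₁` and `y = y₂`.
  let ev : (P.complex.opcycles n ⟶ E.obj (ModuleCat.of S S)) → (G.obj (P.complex.X n) ⟶ E.obj A) :=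
    fun y => A ◁ (P.complex.pOpcycles n ≫ y) ≫ twistEval e f
  have hev : ∀ y, G.map (P.complex.d (n + 1) n) ≫ ev y = 0 := by
    intro y
    change A ◁ (P.complex.d (n + 1) n) ≫ A ◁ (P.complex.pOpcycles n ≫ y) ≫ _ = 0
    rw [← MonoidalCategory.whiskerLeft_comp_assoc, P.complex.d_pOpcycles_assoc, zero_comp,
      MonoidalPreadditive.whiskerLeft_zero, zero_comp]
  have e₁ : capMap P h ≫ twistHom e f = ev y₁ := by
    refine ModuleCat.MonoidalCategory.tensor_ext fun a x => ?_
    refine (f.map_smulₛₗ _ _).trans ?_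
    exact (twistEval_tmul e f a _).symm
  have e₂ : ((tensoringLeft (ModuleCat.{u} S)).map (twistHom e f)).app (P.complex.X n) ≫
      ((tensoringLeft (ModuleCat.{u} S)).obj (E.obj A)).map (s.f n) ≫
      (twistTensor e A).app (P.complex.X n) ≫ E.map (capMap P h ≫ (v • 𝟙 A)) = ev y₂ := by
    refine ModuleCat.MonoidalCategory.tensor_ext fun a x => ?_
    refine Eq.trans ?_ (twistEval_tmul e f a _).symm
    refine (congrArg (capMap P h ≫ (v • 𝟙 A)).hom
      (ModuleCat.restrictScalars_μ_tmul e.toRingHom A (P.complex.X n) (f a) _)).trans ?_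
    change v • (show S from h.hom ((P.complex.pOpcycles n).hom ((s.f n).hom x))) • f a =
      (show S from v * h.hom ((s' n).hom ((P.complex.pOpcycles n).hom x))) • f a
    have hx : (s' n).hom ((P.complex.pOpcycles n).hom x) =
        (P.complex.pOpcycles n).hom ((s.f n).hom x) :=
      congrArg (fun k => k.hom x) (pOpcycles_opcyclesDesc E s.f hs n)
    rw [hx]
    exact smul_smul _ _ _
  have hd₂ : G.map (P.complex.d (n + 1) n) ≫
      ((tensoringLeft (ModuleCat.{u} S)).map (twistHom e f)).app (P.complex.X n) ≫
      ((tensoringLeft (ModuleCat.{u} S)).obj (E.obj A)).map (s.f n) ≫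
      (twistTensor e A).app (P.complex.X n) ≫ E.map (capMap P h ≫ (v • 𝟙 A)) = 0 :=
    (congrArg (fun k => _ ≫ k) e₂).trans (hev y₂)
  have hd₁ : G.map (P.complex.d (n + 1) n) ≫ capMap P h ≫ (v • 𝟙 A) = 0 := by
    refine (Category.assoc _ _ _).symm.trans ?_
    rw [d_capMap, zero_comp]
  have key := leftDerived_twist E G ((tensoringLeft (ModuleCat.{u} S)).obj (E.obj A))
    ((tensoringLeft (ModuleCat.{u} S)).map (twistHom e f)) (twistTensor e A) P (twistHom e f) s comm
    n (capMap P h ≫ (v • 𝟙 A)) hd₁ hd₂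
  let L := (G.mapHomologicalComplex (ComplexShape.down ℕ)).obj P.complex
  have hcap : cap c ≫ (v • 𝟙 A) = (P.isoLeftDerivedObj G n).hom ≫
      homologyDesc L n (capMap P h ≫ (v • 𝟙 A)) hd₁ :=
    (Category.assoc _ _ _).trans (congrArg (fun k => _ ≫ k) (homologyDesc_comp L n _ _ _))
  have hcap' : cap c ≫ twistHom e f = (P.isoLeftDerivedObj G n).hom ≫
      homologyDesc L n (ev y₁) (hev y₁) := by
    refine (Category.assoc _ _ _).trans (congrArg (fun k => _ ≫ k)
      ((homologyDesc_comp L n _ _ _).trans ?_))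
    congr 1
  have hdesc : homologyDesc L n (ev y₁) (hev y₁) = homologyDesc L n (ev y₂) (hev y₂) := by
    refine homologyDesc_eq_of_sub_eq L n (ev y₁) (ev y₂) (hev y₁) (hev y₂)
      (A ◁ t ≫ twistEval e f) ?_
    have hsub : ∀ {X Y : ModuleCat.{u} S} (a b : X ⟶ Y), A ◁ (a - b) = A ◁ a - A ◁ b :=
      fun a b => ((tensoringLeft (ModuleCat.{u} S)).obj A).map_sub
    change A ◁ (P.complex.d n _) ≫ A ◁ t ≫ twistEval e f =
      A ◁ (P.complex.pOpcycles n ≫ y₁) ≫ twistEval e f -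
        A ◁ (P.complex.pOpcycles n ≫ y₂) ≫ twistEval e f
    rw [← MonoidalCategory.whiskerLeft_comp_assoc, ← P.complex.p_fromOpcycles, Category.assoc, ht,
      Preadditive.comp_sub, hsub, Preadditive.sub_comp]
  refine hcap'.trans ?_
  refine (congrArg (fun k => _ ≫ k) hdesc).trans ?_
  refine Eq.trans ?_ (congrArg (fun k => torSemilinear e n f f ≫ E.map k) hcap.symm)
  refine Eq.trans ?_ key.symm
  congr 2
  exact e₂.symm

end Twist

end Cap

end GrossHopkins
end

noncomputable section

namespace GrossHopkins

/-! ### The fundamental class under automorphisms of `R` -/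

section FundClassTwist

open Abelian MvPowerSeries Limits

variable {W : Type u} [CommRing W] {d : ℕ}

section

variable {σ : PS W d ≃+* PS W d} {σ₂ : PS₂ W d ≃+* PS₂ W d} (h : IsDiagonalLift σ σ₂)
  {M M' : ModuleCat.{u} (PS W d)} (τ : M →ₛₗ[(σ : PS W d →+* PS W d)] M')

/-- A skew homomorphism `M → M'` as a semilinear map over `S`. -/
def diagSkew : diagRestrict W d M →ₛₗ[(σ₂ : PS₂ W d →+* PS₂ W d)] diagRestrict W d M' where
  toFun := fun m : M => (τ m : M')
  map_add' := fun a b : M => map_add τ a b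
  map_smul' := fun (s : PS₂ W d) (a : M) => by
    change τ (diag W d s • a) = diag W d (σ₂ s) • τ a
    rw [h.diag]
    exact τ.map_smulₛₗ _ _

/-- The map `S ⊗_R M → S ⊗_R M'` induced by a skew homomorphism. -/
def skewBaseChange : baseChange (inclRight W d) M ⟶
    (ModuleCat.restrictScalars.{u} σ₂.toRingHom).obj (baseChange (inclRight W d) M') :=
  baseChangeDesc
    (N := (ModuleCat.restrictScalars.{u} σ₂.toRingHom).obj (baseChange (inclRight W d) M'))
    ((toBaseChange (inclRight W d) M').comp τ.toAddMonoidHom) (fun r m => by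
      change toBaseChange (inclRight W d) M' (τ (r • m)) =
        σ₂ (inclRight W d r) • toBaseChange (inclRight W d) M' (τ m)
      rw [h.right, ← toBaseChange_smul]
      exact congrArg _ (τ.map_smulₛₗ _ _))

lemma skewBaseChange_toBaseChange (m : M) :
    (skewBaseChange h τ).hom (toBaseChange (inclRight W d) M m) =
      toBaseChange (inclRight W d) M' (τ m) := baseChangeDesc_toBaseChange _ _ m

end

lemma restrictScalars_map_smul_id {S : Type u} [CommRing S] (e : S ≃+* S) (N : ModuleCat.{u} S)
    (s : S) : (ModuleCat.restrictScalars.{u} e.toRingHom).map (s • 𝟙 N) =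
      e.symm s • 𝟙 ((ModuleCat.restrictScalars.{u} e.toRingHom).obj N) := by
  refine ModuleCat.hom_ext (LinearMap.ext fun x => ?_)
  change s • (show N from x) = e (e.symm s) • (show N from x)
  rw [e.apply_symm_apply]

/-- The map `R ⟶ M`, `1 ↦ m`. -/
def elementMap {R : Type u} [CommRing R] {M : ModuleCat.{u} R} (m : M) : ModuleCat.of R R ⟶ M :=
  ModuleCat.ofHom (LinearMap.toSpanSingleton R M m)

lemma elementMap_one {R : Type u} [CommRing R] {M : ModuleCat.{u} R} (m : M) :
    (elementMap m).hom (1 : R) = m := one_smul R m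

/-- A ring automorphism as a semilinear map. -/
def ringSemilinear {R : Type u} [CommRing R] (σ : R ≃+* R) :
    ModuleCat.of R R →ₛₗ[(σ : R →+* R)] ModuleCat.of R R where
  toFun := fun r : R => σ r
  map_add' := map_add σ
  map_smul' := map_mul σ

lemma comp_mk₀_smul_id {S : Type u} [CommRing S] {X Y : ModuleCat.{u} S} {n : ℕ}
    (c : Ext.{u} X Y n) (s : S) : c.comp (Ext.mk₀ (s • 𝟙 Y)) (add_zero n) =
      (Ext.mk₀ (s • 𝟙 X)).comp c (zero_add n) := by
  rw [Ext.mk₀_smul, Ext.comp_smul, Ext.comp_mk₀_id, Ext.mk₀_smul, Ext.smul_comp, Ext.mk₀_id_comp]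

lemma ring_hom_ext {R : Type u} [CommRing R] {N : ModuleCat.{u} R} {f g : ModuleCat.of R R ⟶ N}
    (hfg : f.hom (1 : R) = g.hom (1 : R)) : f = g := by
  refine ModuleCat.hom_ext (LinearMap.ext_ring hfg)

/-- The identification of `S ⊗_R R` with `S`. -/
def baseChangeSelf {R S : Type u} [CommRing R] [CommRing S] (f : R →+* S) :
    baseChange f (ModuleCat.of R R) ⟶ ModuleCat.of S S :=
  baseChangeDesc (M := ModuleCat.of R R) (N := ModuleCat.of S S) f.toAddMonoidHom
    (fun r m => map_mul f r m)

lemma baseChangeSelf_toBaseChange {R S : Type u} [CommRing R] [CommRing S] (f : R →+* S) (r : R) :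
    (baseChangeSelf f).hom (toBaseChange f (ModuleCat.of R R) r) = f r :=
  baseChangeDesc_toBaseChange (M := ModuleCat.of R R) (N := ModuleCat.of S S) _ _ r

instance isIso_baseChangeSelf {R S : Type u} [CommRing R] [CommRing S] (f : R →+* S) :
    IsIso (baseChangeSelf f) := by
  refine ⟨elementMap (toBaseChange f (ModuleCat.of R R) (1 : R)), ?_, ?_⟩
  · refine baseChange_hom_ext fun r => ?_
    have h1 : f r • toBaseChange f (ModuleCat.of R R) (1 : R) = toBaseChange f (ModuleCat.of R R) r :=
      (toBaseChange_smul (f := f) (M := ModuleCat.of R R) r (1 : R)).symm.trans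
        (congrArg (toBaseChange f (ModuleCat.of R R)) (mul_one r))
    refine Eq.trans ?_ h1
    exact congrArg (fun s : S => s • toBaseChange f (ModuleCat.of R R) (1 : R))
      (baseChangeSelf_toBaseChange f r)
  · refine ring_hom_ext ?_
    refine (congrArg (baseChangeSelf f).hom (elementMap_one _)).trans ?_
    exact (baseChangeSelf_toBaseChange f 1).trans (map_one f)

variable (W d) in
/-- The identification of `S ⊗_R R` with `S`. -/
abbrev baseChangeRing : baseChange (inclRight W d) (ModuleCat.of (PS W d) (PS W d)) ⟶
    ModuleCat.of (PS₂ W d) (PS₂ W d) := baseChangeSelf (inclRight W d)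

lemma diag_surjective : Function.Surjective (diag W d) := fun r =>
  ⟨inclLeft W d r, diag_inclLeft W d r⟩

variable [Nontrivial W]

/-- After restriction along `σ₂`, multiplication by `s` is multiplication by `σ₂⁻¹ s`. Compatibility
with `diag` keeps this element in the diagonal ideal, so the restricted class is still a Koszul
class for that ideal. -/
lemma isUniversalFrom_map_fundClass {σ : PS W d ≃+* PS W d} {σ₂ : PS₂ W d ≃+* PS₂ W d}
    (h : IsDiagonalLift σ σ₂) (M N : ModuleCat.{u} (PS W d)) :
    IsUniversalFrom (diagRestrict W d N)
      ((fundClass M).mapExactFunctor (ModuleCat.restrictScalars.{u} σ₂.toRingHom)) := by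
  have h1 : KoszulClass (IsScalarIn (RingHom.ker (diag W d)))
      ((fundClass M).mapExactFunctor (ModuleCat.restrictScalars.{u} σ₂.toRingHom)) := by
    refine (koszulClass_fundClass M).map _ ?_
    rintro N f ⟨s, hs, rfl⟩
    refine ⟨σ₂.symm s, ?_, restrictScalars_map_smul_id σ₂ N s⟩
    rw [RingHom.mem_ker, ← σ.injective.eq_iff, ← h.diag, σ₂.apply_symm_apply, RingHom.mem_ker.1 hs,
      map_zero]
  exact h1.isUniversalFrom fun N f hf j y =>
    ext_comp_scalar_eq_zero (smul_id_diagRestrict _) f hf j y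

/-- Universality provides, for each `τ`, a unique comparison map. Evaluating along `R → M`, `1 ↦ m`,
reduces it to the comparison map for `R` and `σ`, that is to a single element `v`. -/
lemma exists_fundClass_comp_skewBaseChange {σ : PS W d ≃+* PS W d} {σ₂ : PS₂ W d ≃+* PS₂ W d}
    (h : IsDiagonalLift σ σ₂) : ∃ v : PS W d, ∀ (M M' : ModuleCat.{u} (PS W d))
      (τ : M →ₛₗ[(σ : PS W d →+* PS W d)] M'),
      (fundClass M).comp (Ext.mk₀ (skewBaseChange h τ)) (add_zero d) =
        (Ext.mk₀ (twistHom σ₂ (diagSkew h τ))).comp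
          (((fundClass M').comp (Ext.mk₀ (inclLeft W d v • 𝟙 _)) (add_zero d)).mapExactFunctor
            (ModuleCat.restrictScalars.{u} σ₂.toRingHom)) (zero_add d) := by
  let E := ModuleCat.restrictScalars.{u} σ₂.toRingHom
  let A : ModuleCat.{u} (PS W d) := ModuleCat.of (PS W d) (PS W d)
  let σA : A →ₛₗ[(σ : PS W d →+* PS W d)] A := ringSemilinear σ
  -- The scalar is the value at `1` of the comparison map for `σ : R → R`.
  obtain ⟨w, hw⟩ := (isUniversalFrom_map_fundClass h A A).exists_eq
    ((fundClass A).comp (Ext.mk₀ (skewBaseChange h σA)) (add_zero d))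
  obtain ⟨v, hv⟩ : ∃ v : PS W d, w.hom (1 : PS W d) = v := ⟨_, rfl⟩
  refine ⟨v, fun M M' τ => ?_⟩
  obtain ⟨x, hx⟩ := (isUniversalFrom_map_fundClass h M' M).exists_eq
    ((fundClass M).comp (Ext.mk₀ (skewBaseChange h τ)) (add_zero d))
  rw [← hx]
  have key : ∀ m : M, x.hom m = (show M' from v • τ m) := by
    intro m
    let D := ModuleCat.restrictScalars.{u} (diag W d)
    let a : A ⟶ M := elementMap m
    let a' : A ⟶ M' := elementMap (τ m)
    have hA : baseChangeMap (inclRight W d) a ≫ skewBaseChange h τ =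
        skewBaseChange h σA ≫ E.map (baseChangeMap (inclRight W d) a') := by
      refine baseChange_hom_ext fun r => ?_
      refine (skewBaseChange_toBaseChange h τ _).trans ?_
      refine Eq.trans ?_ (congrArg (baseChangeMap (inclRight W d) a').hom
        (skewBaseChange_toBaseChange h σA r)).symm
      exact congrArg _ (τ.map_smulₛₗ _ _)
    -- By uniqueness it suffices to compare the pulled back classes; naturality of `fundClass` for
    -- the linear maps `a` and `a'` does this.
    have hu : D.map a ≫ x = w ≫ E.map (D.map a') := by
      apply (isUniversalFrom_map_fundClass h M' A).eq_of_eq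
      rw [← Ext.mk₀_comp_mk₀, Ext.comp_assoc _ _ _ _ (zero_add d) (by omega), hx,
        ← Ext.comp_assoc _ _ _ (zero_add d) _ (by omega), ← fundClass_naturality,
        Ext.comp_assoc _ _ _ _ (add_zero 0) (by omega), Ext.mk₀_comp_mk₀, hA,
        ← Ext.mk₀_comp_mk₀, ← Ext.comp_assoc _ _ _ (add_zero d) _ (by omega), ← hw,
        Ext.comp_assoc _ _ _ _ (add_zero d) (by omega), ← Ext.mapExactFunctor_mk₀ E,
        ← Ext.mapExactFunctor_comp, fundClass_naturality, Ext.mapExactFunctor_comp,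
        Ext.mapExactFunctor_mk₀, ← Ext.comp_assoc _ _ _ (add_zero 0) _ (by omega),
        Ext.mk₀_comp_mk₀]
    have h1 := congrArg (fun t => t.hom (1 : PS W d)) hu
    refine Eq.trans (congrArg x.hom (elementMap_one m).symm) (h1.trans ?_)
    exact congrArg a'.hom hv
  have hxw : x = twistHom σ₂ (diagSkew h τ) ≫
      E.map (inclLeft W d v • 𝟙 (diagRestrict W d M')) := by
    refine ModuleCat.hom_ext (LinearMap.ext fun m => (key m).trans ?_)
    exact congrArg (fun t : PS W d => t • τ m) (diag_inclLeft W d v).symm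
  rw [comp_mk₀_smul_id, Ext.mapExactFunctor_comp, Ext.mapExactFunctor_mk₀,
    ← Ext.comp_assoc _ _ _ (add_zero 0) _ (by omega), Ext.mk₀_comp_mk₀, hxw]

variable (W d) in
/-- The fundamental class in `Ext_S^d(R, S)`. -/
def ringClass : Ext.{u} (diagModule W d) (ModuleCat.of (PS₂ W d) (PS₂ W d)) d :=
  (fundClass (ModuleCat.of (PS W d) (PS W d))).comp (Ext.mk₀ (baseChangeRing W d)) (add_zero d)

instance isIso_cap_ringClass : IsIso (cap (ringClass W d)) := by
  refine isIso_cap (diag_surjective (W := W) (d := d)) _ fun X hX => ?_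
  -- For `M = R` the coefficient module is `S`, which is projective, so its higher `Ext` groups
  -- vanish and `couniversal` applies with `t = 0`.
  have hproj : Projective (baseChange (inclRight W d) (ModuleCat.of (PS W d) (PS W d))) :=
    Projective.of_iso (asIso (baseChangeRing W d)).symm
      ((IsProjective.iff_projective (PS₂ W d)).1 inferInstance)
  have h1 := (koszulClass_fundClass (ModuleCat.of (PS W d) (PS W d))).couniversal (X := X)
    (fun N f hf j y => scalar_comp_ext_eq_zero hX f hf j y) 0
    (fun j hj y => by
      obtain ⟨j, rfl⟩ : ∃ k, j = k + 1 := ⟨j - 1, by omega⟩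
      exact Ext.eq_zero_of_projective y) 0 d rfl (add_zero d)
  have h2 : Function.Bijective fun y : Ext.{u} (ModuleCat.of (PS₂ W d) (PS₂ W d)) X 0 =>
      (Ext.mk₀ (baseChangeRing W d)).comp y (zero_add 0) := by
    refine Function.bijective_iff_has_inverse.2
      ⟨fun y => (Ext.mk₀ (inv (baseChangeRing W d))).comp y (zero_add 0), fun y => ?_, fun y => ?_⟩
    · dsimp only
      rw [← Ext.comp_assoc _ _ _ (zero_add 0) _ (by omega)]; simp
    · dsimp only
      rw [← Ext.comp_assoc _ _ _ (zero_add 0) _ (by omega)]; simp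
  convert h1.comp h2 using 2 with y
  exact Ext.comp_assoc _ _ _ _ _ (by omega)

/-- The scalar by which the fundamental class is twisted is also the one that expresses the action
on `L` in the coordinate `cap`. -/
lemma map_cap_ringClass {σ : PS W d ≃+* PS W d} {σ₂ : PS₂ W d ≃+* PS₂ W d}
    (h : IsDiagonalLift σ σ₂) {v : PS W d}
    (hv : ∀ (M M' : ModuleCat.{u} (PS W d)) (τ : M →ₛₗ[(σ : PS W d →+* PS W d)] M'),
      (fundClass M).comp (Ext.mk₀ (skewBaseChange h τ)) (add_zero d) =
        (Ext.mk₀ (twistHom σ₂ (diagSkew h τ))).comp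
          (((fundClass M').comp (Ext.mk₀ (inclLeft W d v • 𝟙 _)) (add_zero d)).mapExactFunctor
            (ModuleCat.restrictScalars.{u} σ₂.toRingHom)) (zero_add d)) (l : twistModule W d) :
    σ (show PS W d from (cap (ringClass W d)).hom l) =
      v * (show PS W d from (cap (ringClass W d)).hom (twistAction h l)) := by
  let A : ModuleCat.{u} (PS W d) := ModuleCat.of (PS W d) (PS W d)
  let E := ModuleCat.restrictScalars.{u} σ₂.toRingHom
  have hj : skewBaseChange h (ringSemilinear σ) ≫ E.map (baseChangeRing W d) =
      baseChangeRing W d ≫ ringTwist σ₂ := by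
    refine baseChange_hom_ext fun r => ?_
    refine (congrArg (baseChangeRing W d).hom
      (skewBaseChange_toBaseChange h (ringSemilinear σ) r)).trans ?_
    refine (baseChangeSelf_toBaseChange (inclRight W d) (σ r)).trans ?_
    refine Eq.trans ?_ (congrArg σ₂ (baseChangeSelf_toBaseChange (inclRight W d) r)).symm
    exact (h.right r).symm
  have h1 := cap_comp_twistHom σ₂ (diagSemilinear h) (ringClass W d) (inclLeft W d v) (by
    have h2 := hv A A (ringSemilinear σ)
    rw [ringClass, Ext.comp_assoc _ _ _ _ (add_zero 0) (by omega), Ext.mk₀_comp_mk₀, ← hj,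
      ← Ext.mk₀_comp_mk₀, ← Ext.comp_assoc _ _ _ (add_zero d) _ (by omega), h2,
      Ext.comp_assoc _ _ _ _ (add_zero d) (by omega), ← Ext.mapExactFunctor_mk₀ E,
      ← Ext.mapExactFunctor_comp]
    rw [Ext.comp_assoc _ _ _ _ (add_zero 0) (by omega),
      Ext.comp_assoc _ _ _ _ (add_zero 0) (by omega), Ext.mk₀_comp_mk₀, Ext.mk₀_comp_mk₀,
      Linear.smul_comp, Linear.comp_smul, Category.comp_id, Category.id_comp]
    rfl)
  have h2 := congrArg (fun t => t.hom l) h1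
  refine Eq.trans h2 ?_
  change diag W d (inclLeft W d v) * _ = _
  rw [diag_inclLeft]
  rfl

end FundClassTwist

end GrossHopkins
end

noncomputable section

namespace GrossHopkins

/-! ### Left linear maps out of `S ⊗_R M` -/

section LeftExtension

open MvPowerSeries

variable {W : Type u} [CommRing W] {d : ℕ}

/-- The coefficient of `y^b` of an element of `W⟦x, y⟧ = W⟦x⟧⟦y⟧`. -/
def ycoeff (b : Fin d →₀ ℕ) : PS₂ W d →+ PS W d where
  toFun s := fun e => coeff (Finsupp.sumElim e b) s
  map_zero' := by ext e; exact map_zero (coeff (Finsupp.sumElim e b))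
  map_add' s t := by ext e; exact map_add (coeff (Finsupp.sumElim e b)) s t

lemma coeff_ycoeff (b e : Fin d →₀ ℕ) (s : PS₂ W d) :
    coeff e (ycoeff b s) = coeff (Finsupp.sumElim e b) s := rfl

lemma sumElim_add (a a' b b' : Fin d →₀ ℕ) :
    Finsupp.sumElim a b + Finsupp.sumElim a' b' = Finsupp.sumElim (a + a') (b + b') := by
  ext (i | i) <;> simp

lemma ycoeff_mul (b : Fin d →₀ ℕ) (s t : PS₂ W d) :
    ycoeff b (s * t) = ∑ q ∈ Finset.HasAntidiagonal.antidiagonal b, ycoeff q.1 s * ycoeff q.2 t := by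
  classical
  ext e
  rw [coeff_ycoeff, map_sum, coeff_mul]
  simp_rw [coeff_mul, coeff_ycoeff]
  rw [← Finset.sum_product']
  symm
  refine Finset.sum_nbij' (fun q => (Finsupp.sumElim q.2.1 q.1.1, Finsupp.sumElim q.2.2 q.1.2))
    (fun q => ((q.1.comapDomain Sum.inr Sum.inr_injective.injOn,
        q.2.comapDomain Sum.inr Sum.inr_injective.injOn),
      (q.1.comapDomain Sum.inl Sum.inl_injective.injOn,
        q.2.comapDomain Sum.inl Sum.inl_injective.injOn))) ?_ ?_ ?_ ?_ ?_
  · rintro ⟨⟨b₁, b₂⟩, ⟨e₁, e₂⟩⟩ h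
    simp only [Finset.mem_product, Finset.HasAntidiagonal.mem_antidiagonal] at h ⊢
    rw [sumElim_add, h.1, h.2]
  · rintro ⟨q₁, q₂⟩ h
    simp only [Finset.mem_product, Finset.HasAntidiagonal.mem_antidiagonal] at h ⊢
    refine ⟨?_, ?_⟩
    · ext i
      simpa using congrArg (fun f => f (Sum.inr i)) h
    · ext i
      simpa using congrArg (fun f => f (Sum.inl i)) h
  · rintro ⟨⟨b₁, b₂⟩, ⟨e₁, e₂⟩⟩ h
    ext i <;> simp
  · rintro ⟨q₁, q₂⟩ h
    ext (i | i) <;> simp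
  · rintro ⟨⟨b₁, b₂⟩, ⟨e₁, e₂⟩⟩ h
    rfl

lemma ycoeff_inclLeft (b : Fin d →₀ ℕ) (r : PS W d) :
    ycoeff b (inclLeft W d r) = if b = 0 then r else 0 := by
  classical
  ext e
  rw [coeff_ycoeff]
  split_ifs with h
  · subst h
    have h2 : Finsupp.sumElim e (0 : Fin d →₀ ℕ) = Finsupp.embDomain Function.Embedding.inl e := by
      ext (i | i)
      · exact (Finsupp.embDomain_apply_self Function.Embedding.inl e i).symm
      · rw [Finsupp.embDomain_of_notMem_range _ _ _ (by simp)]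
        simp
    rw [h2]
    exact coeff_embDomain_rename Function.Embedding.inl r e
  · by_contra h3
    refine h ?_
    ext i
    have := coeff_rename_apply_eq_zero (Function.Embedding.inl : Fin d ↪ Fin d ⊕ Fin d)
      (j := Sum.inr i) (by simp) r (Finsupp.sumElim e b) h3
    simpa using this

lemma ycoeff_inclRight (b : Fin d →₀ ℕ) (r : PS W d) :
    ycoeff b (inclRight W d r) = C (coeff b r) := by
  classical
  ext e
  rw [coeff_ycoeff, coeff_C]
  split_ifs with h
  · subst h
    have h2 : Finsupp.sumElim (0 : Fin d →₀ ℕ) b = Finsupp.embDomain Function.Embedding.inr b := by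
      ext (i | i)
      · rw [Finsupp.embDomain_of_notMem_range _ _ _ (by simp)]
        simp
      · exact (Finsupp.embDomain_apply_self Function.Embedding.inr b i).symm
    rw [h2]
    exact coeff_embDomain_rename Function.Embedding.inr r b
  · by_contra h3
    refine h ?_
    ext i
    have := coeff_rename_apply_eq_zero (Function.Embedding.inr : Fin d ↪ Fin d ⊕ Fin d)
      (j := Sum.inl i) (by simp) r (Finsupp.sumElim e b) h3
    simpa using this

lemma ycoeff_inclLeft_mul (b : Fin d →₀ ℕ) (r : PS W d) (s : PS₂ W d) :
    ycoeff b (inclLeft W d r * s) = r * ycoeff b s := by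
  classical
  rw [ycoeff_mul]
  simp_rw [ycoeff_inclLeft]
  rw [Finset.sum_eq_single (0, b)]
  · simp
  · rintro ⟨b₁, b₂⟩ h1 h2
    rw [if_neg, zero_mul]
    rintro rfl
    simp only [Finset.HasAntidiagonal.mem_antidiagonal, zero_add] at h1
    exact h2 (by rw [h1])
  · intro h
    simp at h

/-- The exponents below `k` in every variable. -/
def box (d k : ℕ) : Finset (Fin d →₀ ℕ) :=
  (Finset.univ : Finset (Fin d → Fin k)).image fun f => Finsupp.equivFunOnFinite.symm fun i => (f i : ℕ)

lemma mem_box {k : ℕ} {b : Fin d →₀ ℕ} : b ∈ box d k ↔ ∀ i, b i < k := by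
  simp only [box, Finset.mem_image, Finset.mem_univ, true_and]
  constructor
  · rintro ⟨f, rfl⟩ i
    exact (f i).2
  · intro h
    exact ⟨fun i => ⟨b i, h i⟩, by ext i; rfl⟩

lemma sub_sum_monomial_mem (k : ℕ) (r : PS W d) :
    r - ∑ b ∈ box d k, monomial b (coeff b r) ∈
      Ideal.span (Set.range fun i => (X i ^ k : PS W d)) := by
  classical
  refine mem_span_X_pow_of_coeff id k Finset.univ _ fun e he => ?_
  have he' : e ∈ box d k := mem_box.2 fun i => he i (Finset.mem_univ i)
  rw [map_sub, map_sum, Finset.sum_eq_single e]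
  · rw [coeff_monomial_same, sub_self]
  · intro b _ hb
    rw [coeff_monomial, if_neg hb.symm]
  · exact fun h => absurd he' h

lemma sub_sum_ycoeff_mem (k : ℕ) (s : PS₂ W d) :
    s - ∑ b ∈ box d k, inclLeft W d (ycoeff b s) * inclRight W d (monomial b 1) ∈
      Ideal.span (Set.range fun i => (X (Sum.inr i) ^ k : PS₂ W d)) := by
  classical
  refine mem_span_X_pow_of_coeff Sum.inr k Finset.univ _ fun e he => ?_
  obtain ⟨e, b, rfl⟩ : ∃ e' b, e = Finsupp.sumElim e' b :=
    ⟨e.comapDomain Sum.inl Sum.inl_injective.injOn, e.comapDomain Sum.inr Sum.inr_injective.injOn,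
      by ext (i | i) <;> simp⟩
  rw [← coeff_ycoeff, map_sub, map_sum, map_sub, map_sum, Finset.sum_eq_single b]
  · rw [ycoeff_inclLeft_mul, ycoeff_inclRight, coeff_monomial_same, map_one, mul_one, sub_self]
  · intro b' _ hb
    rw [ycoeff_inclLeft_mul, ycoeff_inclRight, coeff_monomial, if_neg hb.symm, map_zero, mul_zero,
      map_zero]
  · intro h
    refine absurd (mem_box.2 fun i => ?_) h
    simpa using he i (Finset.mem_univ i)

lemma smul_eq_zero_of_mem_span {R : Type*} [CommRing R] {M : Type*} [AddCommGroup M] [Module R M]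
    {ι : Type*} {g : ι → R} (hg : ∀ i (m : M), g i • m = 0) {r : R}
    (hr : r ∈ Ideal.span (Set.range g)) (m : M) : r • m = 0 := by
  have : Ideal.span (Set.range g) ≤ Module.annihilator R M := by
    rw [Ideal.span_le]
    rintro _ ⟨i, rfl⟩
    exact Module.mem_annihilator.2 (hg i)
  exact Module.mem_annihilator.1 (this hr) m

lemma smul_eq_sum {M : Type*} [AddCommGroup M] [Module (PS W d) M] {k : ℕ}
    (hM : ∀ i (m : M), (X i ^ k : PS W d) • m = 0) (r : PS W d) (m : M) :
    r • m = ∑ b ∈ box d k, (monomial b (coeff b r) : PS W d) • m := by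
  have h := smul_eq_zero_of_mem_span hM (sub_sum_monomial_mem k r) m
  rwa [sub_smul, sub_eq_zero, Finset.sum_smul] at h

lemma monomial_smul_eq_zero {M : Type*} [AddCommGroup M] [Module (PS W d) M] {k : ℕ}
    (hM : ∀ i (m : M), (X i ^ k : PS W d) • m = 0) {b : Fin d →₀ ℕ} (hb : b ∉ box d k) (w : W)
    (m : M) : (monomial b w : PS W d) • m = 0 := by
  classical
  have h := smul_eq_sum hM (monomial b w) m
  rw [h]
  refine Finset.sum_eq_zero fun b' hb' => ?_
  rw [coeff_monomial, if_neg, map_zero, zero_smul]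
  rintro rfl
  exact hb hb'

section Extension

variable {M : ModuleCat.{u} (PS W d)} {Q : ModuleCat.{u} (PS W d)}

/-- Sum defining the extension of `φ` to `S ⊗_R M`. -/
def extSum (k : ℕ) (φ : M →+ Q) (s : PS₂ W d) (m : M) : Q :=
  ∑ b ∈ box d k, ycoeff b s • φ ((monomial b 1 : PS W d) • m)

/-- This is the balancedness needed to descend to `S ⊗_R M`. Expanding `r` on both sides gives sums
over pairs `(b₁, b₂)`; the sums differ in pairs inside the box whose total leaves it, and those
monomials kill `M`. -/
lemma extSum_inclRight_mul {k : ℕ} (hM : ∀ i (m : M), (X i ^ k : PS W d) • m = 0) (φ : M →+ Q)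
    (hφ : ∀ w m, φ ((C w : PS W d) • m) = (C w : PS W d) • φ m) (s : PS₂ W d) (r : PS W d) (m : M) :
    extSum k φ (inclRight W d r * s) m = extSum k φ s (r • m) := by
  classical
  have h1 : ∀ b₁, ycoeff b₁ s • φ ((monomial b₁ 1 : PS W d) • r • m) =
      ∑ b₂ ∈ box d k, (C (coeff b₂ r) * ycoeff b₁ s) • φ ((monomial (b₂ + b₁) 1 : PS W d) • m) := by
    intro b₁
    rw [smul_eq_sum hM r m, Finset.smul_sum, map_sum, Finset.smul_sum]
    refine Finset.sum_congr rfl fun b₂ _ => ?_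
    have h2 : (monomial b₁ 1 : PS W d) * monomial b₂ (coeff b₂ r) =
        C (coeff b₂ r) * monomial (b₂ + b₁) 1 := by
      rw [monomial_mul_monomial, ← monomial_zero_eq_C_apply, monomial_mul_monomial, one_mul,
        mul_one, zero_add, add_comm]
    rw [smul_smul, h2, mul_smul, hφ, smul_smul, mul_comm]
  rw [extSum, extSum]
  simp_rw [h1, ycoeff_mul, ycoeff_inclRight, Finset.sum_smul]
  rw [Finset.sum_comm, ← Finset.sum_product', Finset.sum_sigma']
  refine Finset.sum_of_injOn (fun q => q.2) ?_ ?_ ?_ ?_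
  · rintro ⟨b, q⟩ h ⟨b', q'⟩ h' hq
    simp only [Finset.coe_sigma, Set.mem_sigma_iff, Finset.mem_coe,
      Finset.HasAntidiagonal.mem_antidiagonal] at h h' hq
    subst hq
    obtain rfl : b = b' := h.2.symm.trans h'.2
    rfl
  · rintro ⟨b, ⟨b₁, b₂⟩⟩ h
    simp only [Finset.coe_sigma, Set.mem_sigma_iff, Finset.mem_coe,
      Finset.HasAntidiagonal.mem_antidiagonal, mem_box] at h
    simp only [Finset.coe_product, Set.mem_prod, Finset.mem_coe, mem_box]
    obtain ⟨h3, rfl⟩ := h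
    exact ⟨fun i => lt_of_le_of_lt (Nat.le_add_right _ _) (h3 i),
      fun i => lt_of_le_of_lt (Nat.le_add_left _ _) (h3 i)⟩
  · rintro ⟨b₁, b₂⟩ h h'
    by_cases hb : b₁ + b₂ ∈ box d k
    · exact absurd ⟨⟨b₁ + b₂, (b₁, b₂)⟩, by simpa using hb, rfl⟩ h'
    · dsimp only
      rw [monomial_smul_eq_zero hM hb, map_zero, smul_zero]
  · rintro ⟨b, ⟨b₁, b₂⟩⟩ h
    simp only [Finset.mem_sigma, Finset.HasAntidiagonal.mem_antidiagonal] at h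
    obtain ⟨h3, rfl⟩ := h
    rfl

/-- Additive maps from a base change. -/
def baseChangeLift {R S : Type u} [CommRing R] [CommRing S] {f : R →+* S} {M : ModuleCat.{u} R}
    {P : Type*} [AddCommGroup P] (F : S →+ M →+ P)
    (hF : ∀ r s m, F (f r * s) m = F s (r • m)) : baseChange f M →+ P :=
  TensorProduct.liftAddHom (R := R) (M := (ModuleCat.restrictScalars f).obj (ModuleCat.of S S))
    (N := M) F hF

lemma baseChangeLift_smul {R S : Type u} [CommRing R] [CommRing S] {f : R →+* S}
    {M : ModuleCat.{u} R} {P : Type*} [AddCommGroup P] (F : S →+ M →+ P)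
    (hF : ∀ r s m, F (f r * s) m = F s (r • m)) (s : S) (m : M) :
    baseChangeLift F hF (s • toBaseChange f M m) = F s m :=
  congrArg (baseChangeLift F hF) (smul_toBaseChange_eq s m)

/-- `extSum` as a biadditive map. -/
def extSumHom (k : ℕ) (φ : M →+ Q) : PS₂ W d →+ M →+ Q where
  toFun s :=
    { toFun := extSum k φ s
      map_zero' := by simp [extSum]
      map_add' := fun a b => by simp [extSum, Finset.sum_add_distrib] }
  map_zero' := by ext m; change extSum k φ 0 m = 0; simp [extSum]
  map_add' s t := by
    ext m
    change extSum k φ (s + t) m = extSum k φ s m + extSum k φ t m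
    simp [extSum, add_smul, Finset.sum_add_distrib]

variable (W d) in
/-- Restriction of scalars along `inclLeft`. -/
abbrev restrictLeft : ModuleCat.{u} (PS₂ W d) ⥤ ModuleCat.{u} (PS W d) :=
  ModuleCat.restrictScalars.{u} (inclLeft W d)

/-- The `y_i ^ k` kill every `1 ⊗ m`, and modulo them `S` is spanned over the left copy of `R` by
the monomials `y^b` of the box. So the elements `1 ⊗ m` generate `S ⊗_R M` on the left. -/
lemma left_hom_ext {k : ℕ} (hM : ∀ i (m : M), (X i ^ k : PS W d) • m = 0)
    {f g : (restrictLeft W d).obj (baseChange (inclRight W d) M) ⟶ Q}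
    (hfg : ∀ m, f.hom (toBaseChange (inclRight W d) M m) =
      g.hom (toBaseChange (inclRight W d) M m)) : f = g := by
  have hX : ∀ i (m : M), (X (Sum.inr i) ^ k : PS₂ W d) • toBaseChange (inclRight W d) M m = 0 := by
    intro i m
    have : inclRight W d (X i ^ k) = (X (Sum.inr i) ^ k : PS₂ W d) := by
      rw [map_pow]
      exact congrArg (· ^ k) (rename_X Sum.inr i)
    rw [← this, ← toBaseChange_smul, hM, map_zero]
  have key : ∀ (s : PS₂ W d) (m : M), s • toBaseChange (inclRight W d) M m =
      ∑ b ∈ box d k, inclLeft W d (ycoeff b s) •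
        toBaseChange (inclRight W d) M ((monomial b 1 : PS W d) • m) := by
    intro s m
    have h : (s - ∑ b ∈ box d k, inclLeft W d (ycoeff b s) * inclRight W d (monomial b 1)) •
        toBaseChange (inclRight W d) M m = 0 := by
      have h1 : Ideal.span (Set.range fun i => (X (Sum.inr i) ^ k : PS₂ W d)) ≤
          LinearMap.ker (LinearMap.toSpanSingleton (PS₂ W d) _
            (toBaseChange (inclRight W d) M m)) := by
        rw [Ideal.span_le]
        rintro _ ⟨i, rfl⟩
        exact hX i m
      exact h1 (sub_sum_ycoeff_mem k s)
    rw [sub_smul, sub_eq_zero, Finset.sum_smul] at h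
    rw [h]
    refine Finset.sum_congr rfl fun b _ => ?_
    rw [mul_smul, toBaseChange_smul]
  refine ModuleCat.hom_ext (LinearMap.ext fun x => ?_)
  refine baseChange_induction (p := fun x => f.hom x = g.hom x) ?_ ?_ ?_ x
  · exact (map_zero f.hom).trans (map_zero g.hom).symm
  · intro a b ha hb
    exact (map_add f.hom a b).trans ((congrArg₂ (· + ·) ha hb).trans (map_add g.hom a b).symm)
  · intro s m
    rw [key]
    refine (map_sum f.hom _ _).trans (Eq.trans ?_ (map_sum g.hom _ _).symm)
    refine Finset.sum_congr rfl fun b _ => ?_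
    refine (map_smul f.hom (ycoeff b s) _).trans (Eq.trans ?_ (map_smul g.hom (ycoeff b s) _).symm)
    rw [hfg]

/-- Expanding in powers of `y`, `S ⊗_R M` behaves as `W⟦x⟧ ⊗_W M`, since only finitely many powers
of `y` act nontrivially on `M`. `W`-linear maps on `M` therefore extend left linearly, by the finite
sum `extSum`. -/
lemma exists_leftExtension {k : ℕ} (hM : ∀ i (m : M), (X i ^ k : PS W d) • m = 0) (φ : M →+ Q)
    (hφ : ∀ w m, φ ((C w : PS W d) • m) = (C w : PS W d) • φ m) :
    ∃ g : (restrictLeft W d).obj (baseChange (inclRight W d) M) ⟶ Q,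
      ∀ m, g.hom (toBaseChange (inclRight W d) M m) = φ m := by
  let F := baseChangeLift (f := inclRight W d) (extSumHom k φ)
    (fun r s m => extSum_inclRight_mul hM φ hφ s r m)
  have hF : ∀ s m, F (s • toBaseChange (inclRight W d) M m) = extSum k φ s m := fun s m =>
    baseChangeLift_smul _ _ s m
  have hF1 : ∀ (r : PS W d) (x : baseChange (inclRight W d) M),
      F (inclLeft W d r • x) = r • F x := by
    intro r x
    refine baseChange_induction (p := fun x => F (inclLeft W d r • x) = r • F x) ?_ ?_ ?_ x
    · rw [smul_zero, map_zero, smul_zero]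
    · intro a b ha hb
      rw [smul_add, map_add, ha, hb, map_add, smul_add]
    · intro s m
      rw [smul_smul, hF, hF, extSum, extSum, Finset.smul_sum]
      refine Finset.sum_congr rfl fun b _ => ?_
      rw [ycoeff_inclLeft_mul, mul_smul]
  refine ⟨ModuleCat.ofHom (X := (restrictLeft W d).obj (baseChange (inclRight W d) M))
    { toFun := F, map_add' := map_add F, map_smul' := hF1 }, fun m => ?_⟩
  change F (toBaseChange (inclRight W d) M m) = φ m
  rw [← one_smul (PS₂ W d) (toBaseChange (inclRight W d) M m), hF]
  classical
  have hy : ∀ b : Fin d →₀ ℕ, ycoeff b (1 : PS₂ W d) = if b = 0 then 1 else 0 := fun b => by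
    rw [← map_one (inclLeft W d), ycoeff_inclLeft]
  simp_rw [extSum, hy]
  by_cases h0 : (0 : Fin d →₀ ℕ) ∈ box d k
  · rw [Finset.sum_eq_single 0 (fun b _ hb => by rw [if_neg hb, zero_smul])
      (fun h => absurd h0 h), if_pos rfl, one_smul, monomial_zero_one, one_smul]
  -- If the zero exponent lies outside the box, then `1` itself kills `M`.
  · have hm : m = 0 := by
      have := monomial_smul_eq_zero hM h0 1 m
      rwa [monomial_zero_one, one_smul] at this
    rw [hm]
    simp

/-- The left-linear extension of a `W`-linear map `φ : M → Q` to `S ⊗_R M`. -/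
def leftExtension {k : ℕ} (hM : ∀ i (m : M), (X i ^ k : PS W d) • m = 0) (φ : M →+ Q)
    (hφ : ∀ w m, φ ((C w : PS W d) • m) = (C w : PS W d) • φ m) :
    (restrictLeft W d).obj (baseChange (inclRight W d) M) ⟶ Q :=
  (exists_leftExtension hM φ hφ).choose

lemma leftExtension_toBaseChange {k : ℕ} (hM : ∀ i (m : M), (X i ^ k : PS W d) • m = 0)
    (φ : M →+ Q) (hφ : ∀ w m, φ ((C w : PS W d) • m) = (C w : PS W d) • φ m) (m : M) :
    (leftExtension hM φ hφ).hom (toBaseChange (inclRight W d) M m) = φ m :=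
  (exists_leftExtension hM φ hφ).choose_spec m

end Extension

end LeftExtension

end GrossHopkins
end

noncomputable section

namespace GrossHopkins

/-! ### The extension of `R ⊗ ℚ_p / ℤ_p` by `R` -/

section Coefficients

open Abelian

variable (p : ℕ) [Fact p.Prime]

section

variable (R : Type u) [CommRing R] [Algebra ℤ_[p] R]

/-- The `R`-module `R ⊗ ℚ_p`. -/
abbrev ratModule : ModuleCat.{u} R := ModuleCat.of R (R ⊗[ℤ_[p]] ℚ_[p])

/-- The `R`-module `R ⊗ ℚ_p / ℤ_p`. -/
abbrev torsModule : ModuleCat.{u} R := ModuleCat.of R (R ⊗[ℤ_[p]] ZModPInfty p)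

/-- The map `r ↦ r ⊗ 1`. -/
def toRatModule : ModuleCat.of R R ⟶ ratModule p R :=
  ModuleCat.ofHom (LinearMap.toSpanSingleton R (R ⊗[ℤ_[p]] ℚ_[p]) (1 ⊗ₜ 1))

/-- The projection `R ⊗ ℚ_p ⟶ R ⊗ ℚ_p / ℤ_p`. -/
def ratToTors : ratModule p R ⟶ torsModule p R :=
  ModuleCat.ofHom (TensorProduct.AlgebraTensorModule.lTensor R R
    (LinearMap.range (Algebra.linearMap ℤ_[p] ℚ_[p])).mkQ)

lemma toRatModule_apply (r : R) : (toRatModule p R).hom r = r ⊗ₜ[ℤ_[p]] (1 : ℚ_[p]) := by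
  change r • ((1 : R) ⊗ₜ[ℤ_[p]] (1 : ℚ_[p])) = _
  rw [TensorProduct.smul_tmul', smul_eq_mul, mul_one]

lemma lTensor_rid_symm (r : R) :
    LinearMap.lTensor R (Algebra.linearMap ℤ_[p] ℚ_[p]) ((TensorProduct.rid ℤ_[p] R).symm r) =
      (toRatModule p R).hom r := by
  rw [toRatModule_apply, TensorProduct.rid_symm_apply, LinearMap.lTensor_tmul]
  simp

lemma exact_toRatModule_ratToTors :
    Function.Exact (toRatModule p R).hom (ratToTors p R).hom := by
  have h := lTensor_exact R (LinearMap.exact_map_mkQ_range (Algebra.linearMap ℤ_[p] ℚ_[p]))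
    (Submodule.mkQ_surjective _)
  intro x
  refine (h x).trans ⟨?_, ?_⟩
  · rintro ⟨y, rfl⟩
    refine ⟨TensorProduct.rid ℤ_[p] R y, ?_⟩
    rw [← lTensor_rid_symm, LinearEquiv.symm_apply_apply]
  · rintro ⟨r, rfl⟩
    exact ⟨_, lTensor_rid_symm p R r⟩

lemma toRatModule_ratToTors : toRatModule p R ≫ ratToTors p R = 0 :=
  ModuleCat.hom_ext (LinearMap.ext fun r => (exact_toRatModule_ratToTors p R).apply_apply_eq_zero r)

section

variable {R}

/-- The map `σ ⊗ 1` on `R ⊗ N`. -/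
def tensorTwist (σ : R ≃ₐ[ℤ_[p]] R) (N : Type) [AddCommGroup N] [Module ℤ_[p] N] :
    ModuleCat.of R (R ⊗[ℤ_[p]] N) ⟶
      (ModuleCat.restrictScalars.{u} σ.toRingEquiv.toRingHom).obj (ModuleCat.of R (R ⊗[ℤ_[p]] N)) :=
  ModuleCat.ofHom (Y := (ModuleCat.restrictScalars.{u} σ.toRingEquiv.toRingHom).obj
      (ModuleCat.of R (R ⊗[ℤ_[p]] N)))
    { toFun := fun x => (LinearMap.rTensor N σ.toLinearMap x : R ⊗[ℤ_[p]] N)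
      map_add' := map_add (LinearMap.rTensor N σ.toLinearMap)
      map_smul' := fun r x => by
        change LinearMap.rTensor N σ.toLinearMap (r • x) =
          σ r • LinearMap.rTensor N σ.toLinearMap x
        induction x using TensorProduct.induction_on with
        | zero => rw [smul_zero, map_zero, smul_zero]
        | tmul a b => simp [TensorProduct.smul_tmul']
        | add a b ha hb => rw [smul_add, map_add, ha, hb, map_add, smul_add] }

lemma tensorTwist_tmul (σ : R ≃ₐ[ℤ_[p]] R) (N : Type) [AddCommGroup N] [Module ℤ_[p] N] (r : R)
    (x : N) : (tensorTwist p σ N).hom (r ⊗ₜ[ℤ_[p]] x) = σ r ⊗ₜ[ℤ_[p]] x := rfl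

end

variable [Module.Flat ℤ_[p] R]

lemma rat_shortExact :
    (ShortComplex.mk _ _ (toRatModule_ratToTors p R)).ShortExact where
  exact := (ShortComplex.ShortExact.moduleCat_exact_iff_function_exact _).2
    (exact_toRatModule_ratToTors p R)
  mono_f := by
    refine (ModuleCat.mono_iff_injective _).2 fun r r' h => ?_
    change (toRatModule p R).hom r = (toRatModule p R).hom r' at h
    rw [← lTensor_rid_symm, ← lTensor_rid_symm] at h
    refine (TensorProduct.rid ℤ_[p] R).symm.injective
      (Module.Flat.lTensor_preserves_injective_linearMap (M := R) _ ?_ h)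
    exact FaithfulSMul.algebraMap_injective ℤ_[p] ℚ_[p]
  epi_g := (ModuleCat.epi_iff_surjective _).2
    (LinearMap.lTensor_surjective R (Submodule.mkQ_surjective _))

/-- The class of the extension `0 → R → R ⊗ ℚ_p → R ⊗ ℚ_p / ℤ_p → 0`. -/
def ratClass : Ext.{u} (torsModule p R) (ModuleCat.of R R) 1 := (rat_shortExact p R).extClass

variable {R}

lemma ratClass_comp_ringTwist (σ : R ≃ₐ[ℤ_[p]] R) :
    (ratClass p R).comp (Ext.mk₀ (ringTwist σ.toRingEquiv)) (add_zero 1) =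
      (Ext.mk₀ (tensorTwist p σ (ZModPInfty p))).comp ((ratClass p R).mapExactFunctor
        (ModuleCat.restrictScalars.{u} σ.toRingEquiv.toRingHom)) (zero_add 1) := by
  let E := ModuleCat.restrictScalars.{u} σ.toRingEquiv.toRingHom
  let φ : ShortComplex.mk _ _ (toRatModule_ratToTors p R) ⟶
      (ShortComplex.mk _ _ (toRatModule_ratToTors p R)).map E :=
    { τ₁ := ringTwist σ.toRingEquiv
      τ₂ := tensorTwist p σ ℚ_[p]
      τ₃ := tensorTwist p σ (ZModPInfty p)
      comm₁₂ := by
        refine ModuleCat.hom_ext (LinearMap.ext fun r => ?_)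
        refine (toRatModule_apply p R (σ r)).trans ?_
        exact (congrArg (tensorTwist p σ ℚ_[p]).hom (toRatModule_apply p R r)).symm
      comm₂₃ := by
        refine ModuleCat.hom_ext (LinearMap.ext fun x => ?_)
        induction x using TensorProduct.induction_on with
        | zero => exact (map_zero _).trans (map_zero _).symm
        | tmul a b => rfl
        | add a b ha hb => exact (map_add _ a b).trans ((congrArg₂ (· + ·) ha hb).trans
            (map_add _ a b).symm) }
  have h := ShortComplex.ShortExact.extClass_naturality (rat_shortExact p R)
    ((rat_shortExact p R).map_of_exact E) φ
  rw [ratClass, Ext.mapExactFunctor_extClass]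
  exact h

end

end Coefficients

/-! ### The separability idempotent -/

section Unramified

open Algebra.FormallyUnramified

variable {A W : Type*} [CommRing A] [CommRing W] [Algebra A W] [Algebra.FormallyUnramified A W]
  [Algebra.EssFiniteType A W]

lemma mul_elem_eq (t : W ⊗[A] W) :
    t * elem A W = (1 ⊗ₜ Algebra.TensorProduct.lmul' A t) * elem A W := by
  induction t using TensorProduct.induction_on with
  | zero => simp
  | tmul a b =>
    have h : (a ⊗ₜ[A] b : W ⊗[A] W) = (1 ⊗ₜ b) * (a ⊗ₜ 1) := by simp
    rw [h, mul_assoc, ← one_tmul_mul_elem, ← mul_assoc]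
    simp [mul_comm]
  | add a b ha hb => rw [add_mul, ha, hb, map_add, TensorProduct.tmul_add, add_mul]

/-- The product of `t` and `elem` equals `elem`, because `t` multiplies out to `1`, and equals `t`
for the symmetric reason. -/
lemma eq_elem {t : W ⊗[A] W} (h₁ : ∀ w : W, (1 ⊗ₜ w) * t = (w ⊗ₜ 1) * t)
    (h₂ : Algebra.TensorProduct.lmul' A t = 1) : t = elem A W := by
  have h3 : t * elem A W = elem A W := by
    rw [mul_elem_eq, h₂, ← Algebra.TensorProduct.one_def, one_mul]
  have h4 : ∀ s : W ⊗[A] W, s * t = (1 ⊗ₜ Algebra.TensorProduct.lmul' A s) * t := by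
    intro s
    induction s using TensorProduct.induction_on with
    | zero => simp
    | tmul a b =>
      have h : (a ⊗ₜ[A] b : W ⊗[A] W) = (1 ⊗ₜ b) * (a ⊗ₜ 1) := by simp
      rw [h, mul_assoc, ← h₁, ← mul_assoc]
      simp [mul_comm]
    | add a b ha hb => rw [add_mul, ha, hb, map_add, TensorProduct.tmul_add, add_mul]
  rw [← h3, mul_comm, h4, lmul_elem, ← Algebra.TensorProduct.one_def, one_mul]

/-- Uniqueness makes the idempotent invariant under automorphisms. This is why forms are converted
into `W`-linear maps without choosing a basis, and why the conversion respects `σ`. -/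
lemma map_elem (σ : W ≃ₐ[A] W) :
    Algebra.TensorProduct.map σ.toAlgHom σ.toAlgHom (elem A W) = elem A W := by
  refine eq_elem (fun w => ?_) ?_
  · have h := congrArg (Algebra.TensorProduct.map σ.toAlgHom σ.toAlgHom)
      (one_tmul_mul_elem (R := A) (σ.symm w))
    simpa using h
  · have h : ∀ t : W ⊗[A] W, Algebra.TensorProduct.lmul' A
        (Algebra.TensorProduct.map σ.toAlgHom σ.toAlgHom t) =
        σ (Algebra.TensorProduct.lmul' A t) := by
      intro t
      induction t using TensorProduct.induction_on with
      | zero => simp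
      | tmul a b => simp
      | add a b ha hb => rw [map_add, map_add, ha, hb, map_add, map_add]
    rw [h, lmul_elem, map_one]

end Unramified

end GrossHopkins
end

noncomputable section

namespace GrossHopkins

/-! ### The duality map into `Ext^{d+1}(M, R)` -/

section Theta

open Abelian MvPowerSeries Algebra.FormallyUnramified

variable {p : ℕ} [Fact p.Prime] {W : Type u} [CommRing W] [Algebra ℤ_[p] W] {d : ℕ}

/-- The underlying linear map of an element of the Pontryagin dual. -/
def PontryaginDual.toLin {M : ModuleCat.{u} (PS W d)} (f : PontryaginDual p M) :
    (ModuleCat.restrictScalars.{u} (algebraMap ℤ_[p] (PS W d))).obj M →ₗ[ℤ_[p]] ZModPInfty p := f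

/-- The linear map `w ↦ w • m`. -/
def orbitMap (M : ModuleCat.{u} (PS W d)) (m : M) : W →ₗ[ℤ_[p]]
    (ModuleCat.restrictScalars.{u} (algebraMap ℤ_[p] (PS W d))).obj M where
  toFun w := ((C w : PS W d) • m : M)
  map_add' a b := by
    change (C (a + b) : PS W d) • m = (C a : PS W d) • m + (C b : PS W d) • m
    rw [map_add, add_smul]
  map_smul' a w := by
    change (C (a • w) : PS W d) • m = algebraMap ℤ_[p] (PS W d) a • (C w : PS W d) • m
    rw [smul_smul, Algebra.smul_def, map_mul, MvPowerSeries.algebraMap_apply]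

variable (p W d) in
/-- The inclusion of the constants. -/
def constMap : W →ₗ[ℤ_[p]] PS W d where
  toFun w := C w
  map_add' := map_add C
  map_smul' a w := by
    rw [Algebra.smul_def, map_mul, RingHom.id_apply, Algebra.smul_def,
      MvPowerSeries.algebraMap_apply]

/-- The map `w ⊗ w' ↦ w' ⊗ f (w m)`. -/
def dualPairing {M : ModuleCat.{u} (PS W d)} (f : PontryaginDual p M) (m : M) :
    W ⊗[ℤ_[p]] W →ₗ[ℤ_[p]] (PS W d) ⊗[ℤ_[p]] ZModPInfty p :=
  TensorProduct.map (constMap p W d) (f.toLin ∘ₗ orbitMap M m) ∘ₗ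
    (TensorProduct.comm ℤ_[p] W W).toLinearMap

lemma dualPairing_tmul {M : ModuleCat.{u} (PS W d)} (f : PontryaginDual p M) (m : M) (w w' : W) :
    dualPairing f m (w ⊗ₜ w') = (C w' : PS W d) ⊗ₜ[ℤ_[p]] f ((C w : PS W d) • m) := rfl

lemma dualPairing_add {M : ModuleCat.{u} (PS W d)} (f : PontryaginDual p M) (m m' : M)
    (t : W ⊗[ℤ_[p]] W) : dualPairing f (m + m') t = dualPairing f m t + dualPairing f m' t := by
  induction t using TensorProduct.induction_on with
  | zero => simp
  | tmul a b =>
    rw [dualPairing_tmul, dualPairing_tmul, dualPairing_tmul, smul_add,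
      ← TensorProduct.tmul_add]
    exact congrArg (fun x => (C b : PS W d) ⊗ₜ[ℤ_[p]] x) (map_add f.toLin _ _)
  | add a b ha hb =>
    rw [map_add, ha, hb, map_add, map_add]
    abel

lemma dualPairing_smul {M : ModuleCat.{u} (PS W d)} (f : PontryaginDual p M) (m : M) (w : W)
    (t : W ⊗[ℤ_[p]] W) : dualPairing f ((C w : PS W d) • m) t = dualPairing f m ((w ⊗ₜ 1) * t) := by
  induction t using TensorProduct.induction_on with
  | zero => simp
  | tmul a b =>
    rw [Algebra.TensorProduct.tmul_mul_tmul, dualPairing_tmul, dualPairing_tmul, smul_smul,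
      ← map_mul, mul_comm a w, one_mul]
  | add a b ha hb => rw [map_add, ha, hb, mul_add, map_add]

lemma dualPairing_mul {M : ModuleCat.{u} (PS W d)} (f : PontryaginDual p M) (m : M) (w : W)
    (t : W ⊗[ℤ_[p]] W) : dualPairing f m ((1 ⊗ₜ w) * t) = (C w : PS W d) • dualPairing f m t := by
  induction t using TensorProduct.induction_on with
  | zero => simp
  | tmul a b =>
    rw [Algebra.TensorProduct.tmul_mul_tmul, dualPairing_tmul, dualPairing_tmul,
      TensorProduct.smul_tmul', smul_eq_mul, ← map_mul, one_mul]
  | add a b ha hb => rw [mul_add, map_add, ha, hb, map_add, smul_add]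

variable [Algebra.FormallyUnramified ℤ_[p] W] [Algebra.EssFiniteType ℤ_[p] W]

/-- The `W`-linear map `M → R ⊗ ℚ_p / ℤ_p` corresponding to an element of the Pontryagin dual. -/
def dualMap {M : ModuleCat.{u} (PS W d)} (f : PontryaginDual p M) :
    M →+ torsModule p (PS W d) :=
  AddMonoidHom.mk' (fun m => dualPairing f m (elem ℤ_[p] W)) fun m m' => dualPairing_add f m m' _

lemma dualMap_apply {M : ModuleCat.{u} (PS W d)} (f : PontryaginDual p M) (m : M) :
    dualMap f m = dualPairing f m (elem ℤ_[p] W) := rfl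

/-- The identity `(w ⊗ 1) * elem = (1 ⊗ w) * elem` moves `w` from inside the form to the outer
factor. -/
lemma dualMap_smul {M : ModuleCat.{u} (PS W d)} (f : PontryaginDual p M) (w : W) (m : M) :
    dualMap f ((C w : PS W d) • m) = (C w : PS W d) • dualMap f m := by
  rw [dualMap_apply, dualPairing_smul, ← one_tmul_mul_elem, dualPairing_mul, dualMap_apply]

/-- Modules on which every variable acts nilpotently, with bounded exponent. -/
def IsXTorsion (M : ModuleCat.{u} (PS W d)) : Prop :=
  ∃ k : ℕ, ∀ (i : Fin d) (m : M), (X i ^ k : PS W d) • m = 0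

/-- The left linear map `S ⊗_R M ⟶ R ⊗ ℚ_p / ℤ_p` extending `dualMap`. -/
def dualExtension {M : ModuleCat.{u} (PS W d)} (hM : IsXTorsion M) (f : PontryaginDual p M) :
    (restrictLeft W d).obj (baseChange (inclRight W d) M) ⟶ torsModule p (PS W d) :=
  leftExtension hM.choose_spec (dualMap f) (dualMap_smul f)

lemma dualExtension_toBaseChange {M : ModuleCat.{u} (PS W d)} (hM : IsXTorsion M)
    (f : PontryaginDual p M) (m : M) : (dualExtension hM f).hom
      (toBaseChange (inclRight W d) M m) = dualPairing f m (elem ℤ_[p] W) :=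
  leftExtension_toBaseChange _ _ _ m

/-- In particular the extension does not depend on the exponent chosen from `IsXTorsion`. -/
lemma dualExtension_eq {M : ModuleCat.{u} (PS W d)} (hM : IsXTorsion M) (f : PontryaginDual p M)
    (g : (restrictLeft W d).obj (baseChange (inclRight W d) M) ⟶ torsModule p (PS W d))
    (hg : ∀ m, g.hom (toBaseChange (inclRight W d) M m) = dualPairing f m (elem ℤ_[p] W)) :
    dualExtension hM f = g :=
  left_hom_ext hM.choose_spec fun m => (dualExtension_toBaseChange hM f m).trans (hg m).symm

variable (W d) in
/-- The identification of `M` with the restriction of `M_Δ` along `inclLeft`. -/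
def diagUnit (M : ModuleCat.{u} (PS W d)) : M ⟶ (restrictLeft W d).obj (diagRestrict W d M) :=
  ModuleCat.ofHom (Y := (restrictLeft W d).obj (diagRestrict W d M))
    { toFun := fun m => m
      map_add' := fun _ _ => rfl
      map_smul' := fun r m => by
        change r • m = diag W d (inclLeft W d r) • m
        rw [diag_inclLeft] }

instance (M : ModuleCat.{u} (PS W d)) : IsIso (diagUnit W d M) :=
  (ConcreteCategory.isIso_iff_bijective _).2 Function.bijective_id

variable [Nontrivial W] [Module.Flat ℤ_[p] (PS W d)]

/-- The duality map from the Pontryagin dual to `Ext^{d+1}(M, R)`. -/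
def theta {M : ModuleCat.{u} (PS W d)} (hM : IsXTorsion M) (f : PontryaginDual p M) :
    Ext.{u} M (ModuleCat.of (PS W d) (PS W d)) (d + 1) :=
  (Ext.mk₀ (diagUnit W d M)).comp (((fundClass M).mapExactFunctor (restrictLeft W d)).comp
    ((Ext.mk₀ (dualExtension hM f)).comp (ratClass p (PS W d)) (zero_add 1)) rfl) (zero_add _)

lemma theta_add {M : ModuleCat.{u} (PS W d)} (hM : IsXTorsion M) (f g : PontryaginDual p M) :
    theta hM (f + g) = theta hM f + theta hM g := by
  have h : dualExtension hM (f + g) = dualExtension hM f + dualExtension hM g := by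
    refine dualExtension_eq hM _ _ fun m => ?_
    refine (congrArg₂ (· + ·) (dualExtension_toBaseChange hM f m)
      (dualExtension_toBaseChange hM g m)).trans ?_
    generalize elem ℤ_[p] W = t
    induction t using TensorProduct.induction_on with
    | zero => simp
    | tmul a b =>
      simp only [dualPairing_tmul]
      exact (TensorProduct.tmul_add _ _ _).symm
    | add a b ha hb =>
      simp only [map_add] at ha hb ⊢
      rw [← ha, ← hb]
      abel
  simp only [theta, h, Ext.mk₀_add, Ext.add_comp, Ext.comp_add]

/-- On a form, `r` acts through the right copy of `R` on `S ⊗_R M`; on `Ext` it acts through the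
left copy. Both act in the same way on the source `M` of the `S`-linear fundamental class. -/
lemma theta_smul {M : ModuleCat.{u} (PS W d)} (hM : IsXTorsion M) (r : PS W d)
    (f : PontryaginDual p M) : theta hM (r • f) = r • theta hM f := by
  have h : dualExtension hM (r • f) =
      (restrictLeft W d).map (inclRight W d r • 𝟙 _) ≫ dualExtension hM f := by
    refine dualExtension_eq hM _ _ fun m => ?_
    refine (congrArg (dualExtension hM f).hom (toBaseChange_smul r m).symm).trans ?_
    refine (dualExtension_toBaseChange hM f _).trans ?_
    generalize elem ℤ_[p] W = t
    induction t using TensorProduct.induction_on with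
    | zero => simp
    | tmul a b =>
      simp only [dualPairing_tmul]
      rw [smul_comm]
      rfl
    | add a b ha hb => rw [map_add, map_add, ha, hb]
  have h2 : diagUnit W d M ≫ (restrictLeft W d).map (inclRight W d r • 𝟙 _) =
      r • diagUnit W d M := by
    refine ModuleCat.hom_ext (LinearMap.ext fun m => ?_)
    change diag W d (inclRight W d r) • m = diag W d (inclLeft W d r) • m
    rw [diag_inclLeft, diag_inclRight]
  rw [theta, h, ← Ext.mk₀_comp_mk₀, Ext.comp_assoc _ _ _ _ (zero_add 1) (by omega),
    ← Ext.comp_assoc _ _ _ (add_zero d) _ (by omega), ← Ext.mapExactFunctor_mk₀,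
    ← Ext.mapExactFunctor_comp, comp_mk₀_smul_id, Ext.mapExactFunctor_comp,
    Ext.mapExactFunctor_mk₀, Ext.comp_assoc _ _ _ _ (rfl : d + 1 = d + 1) (by omega),
    ← Ext.comp_assoc _ _ _ (zero_add 0) _ (by omega), Ext.mk₀_comp_mk₀, h2, Ext.mk₀_smul,
    Ext.smul_comp, theta]

lemma theta_naturality {M M' : ModuleCat.{u} (PS W d)} (hM : IsXTorsion M) (hM' : IsXTorsion M')
    (g : M ⟶ M') (f : PontryaginDual p M) (f' : PontryaginDual p M')
    (hf : ∀ m, f m = f' (g.hom m)) :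
    theta hM f = (Ext.mk₀ g).comp (theta hM' f') (zero_add _) := by
  have h : dualExtension hM f =
      (restrictLeft W d).map (baseChangeMap (inclRight W d) g) ≫ dualExtension hM' f' := by
    refine dualExtension_eq hM _ _ fun m => ?_
    refine (congrArg (dualExtension hM' f').hom (baseChangeMap_toBaseChange g m)).trans ?_
    refine (dualExtension_toBaseChange hM' f' _).trans ?_
    generalize elem ℤ_[p] W = t
    induction t using TensorProduct.induction_on with
    | zero => simp
    | tmul a b =>
      simp only [dualPairing_tmul]
      rw [hf, LinearMap.map_smul g.hom]
    | add a b ha hb => rw [map_add, map_add, ha, hb]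
  have h2 : diagUnit W d M ≫ (restrictLeft W d).map
      ((ModuleCat.restrictScalars.{u} (diag W d)).map g) = g ≫ diagUnit W d M' := rfl
  rw [theta, h, ← Ext.mk₀_comp_mk₀, Ext.comp_assoc _ _ _ _ (zero_add 1) (by omega),
    ← Ext.comp_assoc _ _ _ (add_zero d) _ (by omega), ← Ext.mapExactFunctor_mk₀,
    ← Ext.mapExactFunctor_comp, fundClass_naturality, Ext.mapExactFunctor_comp,
    Ext.mapExactFunctor_mk₀, Ext.comp_assoc _ _ _ _ (rfl : d + 1 = d + 1) (by omega),
    ← Ext.comp_assoc _ _ _ (zero_add 0) _ (by omega), Ext.mk₀_comp_mk₀, h2,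
    ← Ext.mk₀_comp_mk₀, Ext.comp_assoc _ _ _ _ (zero_add (d + 1)) (by omega), theta]

end Theta

end GrossHopkins
end

noncomputable section

namespace GrossHopkins

/-! ### The duality map under skew homomorphisms -/

section ThetaSkew

open Abelian MvPowerSeries Algebra.FormallyUnramified

variable {W : Type u} [CommRing W] {d : ℕ}

/-- The comparison of the two ways to restrict scalars along `σ₂ ∘ inclLeft = inclLeft ∘ σ`. -/
def leftTwist {σ : PS W d ≃+* PS W d} {σ₂ : PS₂ W d ≃+* PS₂ W d} (h : IsDiagonalLift σ σ₂) :
    ModuleCat.restrictScalars.{u} σ₂.toRingHom ⋙ restrictLeft W d ⟶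
      restrictLeft W d ⋙ ModuleCat.restrictScalars.{u} σ.toRingHom where
  app N := ModuleCat.ofHom
    (X := (restrictLeft W d).obj ((ModuleCat.restrictScalars.{u} σ₂.toRingHom).obj N))
    (Y := (ModuleCat.restrictScalars.{u} σ.toRingHom).obj ((restrictLeft W d).obj N))
    { toFun := fun x => x
      map_add' := fun _ _ => rfl
      map_smul' := fun r x => by
        change σ₂ (inclLeft W d r) • (show N from x) = inclLeft W d (σ r) • (show N from x)
        rw [h.left] }
  naturality _ _ _ := rfl

lemma ringTwist_restrictScalarsIsoOfEquiv {R : Type u} [CommRing R] (σ : R ≃+* R) :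
    ringTwist σ ≫ (ModuleCat.restrictScalarsIsoOfEquiv σ).hom = 𝟙 (ModuleCat.of R R) :=
  ModuleCat.hom_ext (LinearMap.ext fun r => σ.symm_apply_apply r)

variable {p : ℕ} [Fact p.Prime] [Algebra ℤ_[p] W]
variable [Algebra.FormallyUnramified ℤ_[p] W] [Algebra.EssFiniteType ℤ_[p] W]

lemma dualExtension_comp_tensorTwist (σ : PS W d ≃ₐ[ℤ_[p]] PS W d) (σW : W ≃ₐ[ℤ_[p]] W)
    (hσW : ∀ w, σ (C w) = C (σW w)) {σ₂ : PS₂ W d ≃+* PS₂ W d}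
    (h : IsDiagonalLift σ.toRingEquiv σ₂)
    {M M' : ModuleCat.{u} (PS W d)} (hM : IsXTorsion M) (hM' : IsXTorsion M')
    (τ : M →ₛₗ[(σ.toRingEquiv : PS W d →+* PS W d)] M')
    (f : PontryaginDual p M) (f' : PontryaginDual p M') (hf : ∀ m, f m = f' (τ m)) :
    dualExtension hM f ≫ tensorTwist p σ (ZModPInfty p) =
      (restrictLeft W d).map (skewBaseChange h τ) ≫ (leftTwist h).app _ ≫
        (ModuleCat.restrictScalars.{u} σ.toRingEquiv.toRingHom).map (dualExtension hM' f') := by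
  refine left_hom_ext hM.choose_spec fun m => ?_
  refine (congrArg (tensorTwist p σ (ZModPInfty p)).hom
    (dualExtension_toBaseChange hM f m)).trans ?_
  refine Eq.trans ?_ (congrArg (dualExtension hM' f').hom (skewBaseChange_toBaseChange h τ m)).symm
  refine Eq.trans ?_ (dualExtension_toBaseChange hM' f' _).symm
  -- For a general tensor, `σ` moves `t` to `(σ ⊗ σ) t`; invariance of `elem` removes this change.
  have key : ∀ t : W ⊗[ℤ_[p]] W, (tensorTwist p σ (ZModPInfty p)).hom (dualPairing f m t) =
      dualPairing f' (τ m) (Algebra.TensorProduct.map σW.toAlgHom σW.toAlgHom t) := by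
    intro t
    induction t using TensorProduct.induction_on with
    | zero =>
      rw [map_zero, map_zero, map_zero]
      exact map_zero (tensorTwist p σ (ZModPInfty p)).hom
    | tmul a b =>
      rw [dualPairing_tmul, Algebra.TensorProduct.map_tmul, dualPairing_tmul]
      refine (tensorTwist_tmul p σ (ZModPInfty p) _ _).trans ?_
      rw [hσW, hf]
      have h2 : τ ((C a : PS W d) • m) = (C (σW a) : PS W d) • τ m :=
        (τ.map_smulₛₗ _ _).trans (congrArg (fun t : PS W d => t • τ m) (hσW a))
      rw [h2]
      rfl
    | add a b ha hb =>
      rw [map_add, map_add, map_add, map_add, ha, hb]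
      rfl
  rw [key, map_elem]

variable [Nontrivial W] [Module.Flat ℤ_[p] (PS W d)]

/-- The twist is moved through the three factors of `theta`. The rational extension and the extended
form are strictly equivariant; the fundamental class contributes the scalar `v`. -/
lemma theta_skew (σ : PS W d ≃ₐ[ℤ_[p]] PS W d) (σW : W ≃ₐ[ℤ_[p]] W)
    (hσW : ∀ w, σ (C w) = C (σW w)) {σ₂ : PS₂ W d ≃+* PS₂ W d}
    (h : IsDiagonalLift σ.toRingEquiv σ₂) {v : PS W d}
    {M M' : ModuleCat.{u} (PS W d)} (hM : IsXTorsion M) (hM' : IsXTorsion M')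
    (τ : M →ₛₗ[(σ.toRingEquiv : PS W d →+* PS W d)] M')
    (hv : (fundClass M).comp (Ext.mk₀ (skewBaseChange h τ)) (add_zero d) =
        (Ext.mk₀ (twistHom σ₂ (diagSkew h τ))).comp
          (((fundClass M').comp (Ext.mk₀ (inclLeft W d v • 𝟙 _)) (add_zero d)).mapExactFunctor
            (ModuleCat.restrictScalars.{u} σ₂.toRingHom)) (zero_add d))
    (f : PontryaginDual p M) (f' : PontryaginDual p M') (hf : ∀ m, f m = f' (τ m)) :
    theta hM f = extSkew σ.toRingEquiv τ (d + 1) (v • theta hM' f') := by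
  let E := ModuleCat.restrictScalars.{u} σ.toRingEquiv.toRingHom
  let E₂ := ModuleCat.restrictScalars.{u} σ₂.toRingHom
  let EL := restrictLeft W d
  have hsmul : EL.map (inclLeft W d v • 𝟙 (baseChange (inclRight W d) M')) =
      v • 𝟙 (EL.obj (baseChange (inclRight W d) M')) := rfl
  have key : (theta hM f).comp (Ext.mk₀ (ringTwist σ.toRingEquiv)) (add_zero _) =
      (Ext.mk₀ (twistHom σ.toRingEquiv τ)).comp ((v • theta hM' f').mapExactFunctor E)
        (zero_add _) := by
    have e1 : (theta hM f).comp (Ext.mk₀ (ringTwist σ.toRingEquiv)) (add_zero _) =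
        (Ext.mk₀ (diagUnit W d M)).comp (((fundClass M).mapExactFunctor EL).comp
          ((Ext.mk₀ (EL.map (skewBaseChange h τ) ≫ (leftTwist h).app _)).comp
            (((Ext.mk₀ (dualExtension hM' f')).comp (ratClass p (PS W d))
              (zero_add 1)).mapExactFunctor E) (zero_add 1)) rfl) (zero_add _) := by
      rw [theta, Ext.comp_assoc _ _ _ _ (add_zero (d + 1)) (by omega),
        Ext.comp_assoc _ _ _ _ (add_zero 1) (by omega),
        Ext.comp_assoc _ _ _ _ (add_zero 1) (by omega), ratClass_comp_ringTwist,
        ← Ext.comp_assoc _ _ _ (add_zero 0) _ (by omega), Ext.mk₀_comp_mk₀,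
        dualExtension_comp_tensorTwist σ σW hσW h hM hM' τ f f' hf, Ext.mapExactFunctor_comp,
        Ext.mapExactFunctor_mk₀, ← Ext.comp_assoc _ _ _ (add_zero 0) _ (by omega),
        Ext.mk₀_comp_mk₀, Category.assoc]
    -- The hypothesis `hv` lives over `S`. It is restricted to the left copy of `R`, where the two
    -- orders of restriction are compared by `leftTwist`.
    have e2 : ((fundClass M).mapExactFunctor EL).comp
        (Ext.mk₀ (EL.map (skewBaseChange h τ) ≫ (leftTwist h).app _)) (add_zero d) =
        (Ext.mk₀ (EL.map (twistHom σ₂ (diagSkew h τ)) ≫ (leftTwist h).app _)).comp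
          ((((fundClass M').comp (Ext.mk₀ (inclLeft W d v • 𝟙 _)) (add_zero d)).mapExactFunctor
            EL).mapExactFunctor E) (zero_add d) := by
      have h3 := mapExactFunctor_naturality E₂ EL EL E (leftTwist h)
        ((fundClass M').comp (Ext.mk₀ (inclLeft W d v • 𝟙 _)) (add_zero d))
      rw [← Ext.mk₀_comp_mk₀, ← Ext.comp_assoc _ _ _ (add_zero d) _ (by omega),
        ← Ext.mapExactFunctor_mk₀ EL, ← Ext.mapExactFunctor_comp, hv, Ext.mapExactFunctor_comp,
        Ext.mapExactFunctor_mk₀, Ext.comp_assoc _ _ _ _ (add_zero d) (by omega), h3,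
        ← Ext.comp_assoc _ _ _ (add_zero 0) _ (by omega), Ext.mk₀_comp_mk₀]
    have e3 : diagUnit W d M ≫ EL.map (twistHom σ₂ (diagSkew h τ)) ≫ (leftTwist h).app _ =
        twistHom σ.toRingEquiv τ ≫ E.map (diagUnit W d M') := rfl
    have e4 : v • theta hM' f' = (Ext.mk₀ (diagUnit W d M')).comp
        ((((fundClass M').comp (Ext.mk₀ (inclLeft W d v • 𝟙 _)) (add_zero d)).mapExactFunctor
          EL).comp ((Ext.mk₀ (dualExtension hM' f')).comp (ratClass p (PS W d)) (zero_add 1)) rfl)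
          (zero_add _) := by
      rw [Ext.mapExactFunctor_comp, Ext.mapExactFunctor_mk₀, hsmul, Ext.mk₀_smul, Ext.comp_smul,
        Ext.comp_mk₀_id, Ext.smul_comp, Ext.comp_smul, theta]
    generalize ((fundClass M').comp (Ext.mk₀ (inclLeft W d v • 𝟙 _)) (add_zero d)).mapExactFunctor
      EL = c at e2 e4
    generalize (Ext.mk₀ (dualExtension hM' f')).comp (ratClass p (PS W d)) (zero_add 1) = b at e1 e4
    rw [e1, ← Ext.comp_assoc _ _ _ (add_zero d) _ (by omega), e2,
      Ext.comp_assoc _ _ _ _ (rfl : d + 1 = d + 1) (by omega),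
      ← Ext.comp_assoc _ _ _ (zero_add 0) _ (by omega), Ext.mk₀_comp_mk₀, e3, e4,
      ← Ext.mk₀_comp_mk₀, Ext.mapExactFunctor_comp, Ext.mapExactFunctor_mk₀,
      Ext.mapExactFunctor_comp, Ext.comp_assoc _ _ _ _ (zero_add (d + 1)) (by omega)]
  -- The coefficients are untwisted at the end: `σ` followed by the identification of the twisted
  -- ring with `R` is the identity.
  have h5 : theta hM f = ((theta hM f).comp (Ext.mk₀ (ringTwist σ.toRingEquiv)) (add_zero _)).comp
      (Ext.mk₀ (ModuleCat.restrictScalarsIsoOfEquiv σ.toRingEquiv).hom) (add_zero _) := by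
    rw [Ext.comp_assoc _ _ _ _ (add_zero 0) (by omega), Ext.mk₀_comp_mk₀,
      ringTwist_restrictScalarsIsoOfEquiv, Ext.comp_mk₀_id]
  rw [h5, key, extSkew, Ext.comp_assoc _ _ _ _ (add_zero (d + 1)) (by omega)]

end ThetaSkew

end GrossHopkins
end

noncomputable section

namespace GrossHopkins

/-! ### Residue modules and the generator of their top `Ext` -/

section ResidueModules

open Abelian MvPowerSeries Algebra.FormallyUnramified IsLocalRing

/-- A property of the successive quotients is recorded so that, after restriction to the left copy
of `R`, the scalars `x_i - y_i` can be replaced by `x_i` on them. -/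
lemma koszulClass_koszulExt_of_quotBy {S : Type u} [CommRing S] (Q : ModuleCat.{u} S → Prop)
    (hQ : ∀ z N, Q N → Q (quotBy z N)) (I : Set S) (zs : List S) (hzs : ∀ z ∈ zs, z ∈ I)
    (N : ModuleCat.{u} S) (h : IsKoszulRegular zs N) (hN : Q N) :
    KoszulClass (fun N f => Q N ∧ ∃ z ∈ I, f = z • 𝟙 N) (koszulExt zs N h) := by
  induction zs generalizing N with
  | nil => exact KoszulClass.iso _ (IsIso.id N)
  | cons z zs ih =>
    exact KoszulClass.step _ _ _ (quotBy_shortExact h.1) ⟨hN, z, hzs z List.mem_cons_self, rfl⟩ _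
      (ih (fun w hw => hzs w (List.mem_cons_of_mem _ hw)) _ h.2 (hQ _ _ hN))

variable {W : Type u} [CommRing W] {d : ℕ}

/-- If the variables annihilate `T`, then `x_i - y_i` acts on `S ⊗_R T` as `x_i`. -/
lemma koszulClass_map_fundClass [Nontrivial W] {I : Ideal (PS W d)} (hI : ∀ i, X i ∈ I)
    {T : ModuleCat.{u} (PS W d)} (hT : ∀ i (m : T), (X i : PS W d) • m = 0) :
    KoszulClass (IsScalarIn I) ((fundClass T).mapExactFunctor (restrictLeft W d)) := by
  let Q : ModuleCat.{u} (PS₂ W d) → Prop := fun N => ∀ i (n : N), (X (Sum.inr i) : PS₂ W d) • n = 0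
  have key : ∀ (k : ℕ) (h : 0 + (diagGens W d).length = k),
      KoszulClass (fun N f => Q N ∧ ∃ z ∈ Set.range (diagGen W d), f = z • 𝟙 N)
        ((Ext.mk₀ (toKoszulQuot W d T)).comp
          (koszulExt (diagGens W d) _ (isKoszulRegular_diagGens T)) h) := by
    rintro k h
    obtain rfl : k = (diagGens W d).length := by omega
    refine (koszulClass_koszulExt_of_quotBy Q (fun z N hN i n => ?_) _ _ (fun z hz => ?_) _ _
      fun i n => ?_).iso_comp _
    · obtain ⟨n, rfl⟩ := quotByProj_surjective z N n
      exact (map_smul (quotByProj z N).hom _ _).symm.trans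
        ((congrArg (quotByProj z N).hom (hN i n)).trans (map_zero _))
    · exact (List.mem_ofFn' _ _).1 hz
    · refine baseChange_induction (p := fun n => (X (Sum.inr i) : PS₂ W d) • n = 0) (smul_zero _)
        (fun a b ha hb => by rw [smul_add, ha, hb, add_zero]) (fun s m => ?_) n
      have h1 : (X (Sum.inr i) : PS₂ W d) = inclRight W d (X i) := (rename_X _ _).symm
      rw [smul_comm, h1, ← toBaseChange_smul, hT, map_zero, smul_zero]
  refine (key d _).map (restrictLeft W d) ?_
  rintro N _ ⟨hN, _, ⟨i, rfl⟩, rfl⟩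
  refine ⟨X i, hI i, ?_⟩
  refine ModuleCat.hom_ext (LinearMap.ext fun n => ?_)
  change diagGen W d i • (show N from n) = inclLeft W d (X i) • (show N from n)
  rw [diagGen, sub_smul, hN, sub_zero]
  exact congrArg (fun t : PS₂ W d => t • (show N from n)) (rename_X _ _).symm

/-- `t` generates `T`, the variables annihilate `T` and `T ≅ W / p W`. -/
structure IsResidueGenerator (p : ℕ) {T : ModuleCat.{u} (PS W d)} (t : T) : Prop where
  X_smul : ∀ (i : Fin d) (m : T), (X i : PS W d) • m = 0
  exists_eq : ∀ m : T, ∃ w : W, m = (C w : PS W d) • t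
  C_smul_eq_zero_iff : ∀ w : W, (C w : PS W d) • t = 0 ↔ (p : W) ∣ w

namespace IsResidueGenerator

variable {p : ℕ} {T : ModuleCat.{u} (PS W d)} {t : T}

lemma pow_X_smul (h : IsResidueGenerator p t) (i : Fin d) (m : T) : (X i ^ 1 : PS W d) • m = 0 := by
  rw [pow_one]
  exact h.X_smul i m

lemma isXTorsion (h : IsResidueGenerator p t) : IsXTorsion T := ⟨1, h.pow_X_smul⟩

lemma p_smul (h : IsResidueGenerator p t) (m : T) : (p : PS W d) • m = 0 := by
  obtain ⟨w, rfl⟩ := h.exists_eq m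
  have := (h.C_smul_eq_zero_iff p).2 dvd_rfl
  rw [map_natCast] at this
  rw [smul_comm, this, smul_zero]

/-- Additive maps out of `W / p W`. -/
lemma exists_lift (h : IsResidueGenerator p t) {Q : Type*} [AddCommGroup Q] (ψ : W →+ Q)
    (hψ : ∀ w, ψ (p * w) = 0) : ∃ φ : T →+ Q, ∀ w, φ ((C w : PS W d) • t) = ψ w := by
  choose w hw using h.exists_eq
  have key : ∀ a b : W, (C a : PS W d) • t = (C b : PS W d) • t → ψ a = ψ b := by
    intro a b hab
    rw [← sub_eq_zero, ← sub_smul, ← map_sub, h.C_smul_eq_zero_iff] at hab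
    obtain ⟨c, hc⟩ := hab
    rw [← sub_eq_zero, ← map_sub, hc, hψ]
  refine ⟨AddMonoidHom.mk' (fun m => ψ (w m)) fun a b => ?_, fun a => key _ _ (hw _).symm⟩
  rw [← map_add]
  apply key
  rw [← hw, map_add, add_smul, ← hw, ← hw]

/-- The map `R ⟶ S ⊗_R T`, `r ↦ r ⊗ t`. -/
def leftOrbit (t : T) :
    ModuleCat.of (PS W d) (PS W d) ⟶ (restrictLeft W d).obj (baseChange (inclRight W d) T) :=
  ModuleCat.ofHom (Y := (restrictLeft W d).obj (baseChange (inclRight W d) T))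
    (LinearMap.toSpanSingleton (PS W d) ((restrictLeft W d).obj (baseChange (inclRight W d) T))
      (show (restrictLeft W d).obj (baseChange (inclRight W d) T) from
        toBaseChange (inclRight W d) T t))

lemma leftOrbit_apply (r : PS W d) : (leftOrbit t).hom r =
    (inclLeft W d r • toBaseChange (inclRight W d) T t : baseChange (inclRight W d) T) := rfl

lemma p_smul_comp_leftOrbit (h : IsResidueGenerator p t) :
    ((p : PS W d) • 𝟙 (ModuleCat.of (PS W d) (PS W d))) ≫ leftOrbit t = 0 := by
  refine ModuleCat.hom_ext (LinearMap.ext fun r => ?_)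
  change (leftOrbit t).hom ((p : PS W d) * r) = 0
  rw [leftOrbit_apply, map_mul, map_natCast, mul_comm, mul_smul,
    ← map_natCast (inclRight W d) p, ← toBaseChange_smul, h.p_smul, map_zero, smul_zero]
  rfl

/-- The `y_i` act as zero on `S ⊗_R T`, so an element of `S` acts through its coefficient of `y^0`.
-/
lemma leftOrbit_surjective (h : IsResidueGenerator p t) :
    Function.Surjective (leftOrbit t).hom := by
  intro x
  refine baseChange_induction (M := T) (p := fun x => ∃ r, (leftOrbit t).hom r = x)
    ⟨0, map_zero _⟩ ?_ ?_ x
  · rintro _ _ ⟨a, rfl⟩ ⟨b, rfl⟩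
    exact ⟨a + b, map_add _ _ _⟩
  · intro s m
    obtain ⟨w, rfl⟩ := h.exists_eq m
    rw [toBaseChange_smul, smul_smul]
    refine ⟨ycoeff 0 (s * inclRight W d (C w)), ?_⟩
    rw [leftOrbit_apply]
    generalize s * inclRight W d (C w) = s
    have h1 := sub_sum_ycoeff_mem 1 s
    have h2 := smul_eq_zero_of_mem_span (M := baseChange (inclRight W d) T) (fun i n => ?_) h1
      (toBaseChange (inclRight W d) T t)
    · have h3 : box d 1 = {0} := by
        ext b
        rw [mem_box, Finset.mem_singleton, Finsupp.ext_iff]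
        simp
      rw [h3, Finset.sum_singleton, sub_smul, sub_eq_zero] at h2
      rw [h2]
      have h4 : (monomial 0 1 : PS W d) = 1 := rfl
      rw [h4, map_one, mul_one]
    · refine baseChange_induction (p := fun n => (X (Sum.inr i) ^ 1 : PS₂ W d) • n = 0) (smul_zero _)
        (fun a b ha hb => by rw [smul_add, ha, hb, add_zero]) (fun s m => ?_) n
      have h1 : (X (Sum.inr i) : PS₂ W d) = inclRight W d (X i) := (rename_X _ _).symm
      rw [pow_one, smul_comm, h1, ← toBaseChange_smul, h.X_smul, map_zero, smul_zero]

/-- The map from `T ≅ W/p` to `R/p` extends left linearly to `S ⊗_R T`, and the extension carries `r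
⊗ t` to the class of `r`. -/
lemma dvd_of_leftOrbit_eq_zero (h : IsResidueGenerator p t) (r : PS W d)
    (hr : (leftOrbit t).hom r = 0) : (p : PS W d) ∣ r := by
  let Q := ModuleCat.of (PS W d) (PS W d ⧸ Ideal.span {(p : PS W d)})
  obtain ⟨φ, hφ⟩ := h.exists_lift
    (((Ideal.Quotient.mk (Ideal.span {(p : PS W d)})).comp C).toAddMonoidHom) (fun w => by
      refine Ideal.Quotient.eq_zero_iff_mem.2 (Ideal.mem_span_singleton.2 ?_)
      rw [map_mul, map_natCast]
      exact dvd_mul_right _ _)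
  obtain ⟨g, hg⟩ := exists_leftExtension (Q := Q) h.pow_X_smul φ (fun w m => by
    obtain ⟨w', rfl⟩ := h.exists_eq m
    rw [smul_smul, ← map_mul, hφ, hφ]
    exact map_mul ((Ideal.Quotient.mk (Ideal.span {(p : PS W d)})).comp C) w w')
  have h1 : (leftOrbit t ≫ g).hom r = r • φ t :=
    (map_smul g.hom r _).trans (congrArg (fun q : Q => r • q) (hg t))
  have h2 : (leftOrbit t ≫ g).hom r = 0 := (congrArg g.hom hr).trans (map_zero _)
  have h3 : φ t = (1 : PS W d ⧸ Ideal.span {(p : PS W d)}) := by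
    have := hφ 1
    rw [map_one, one_smul] at this
    rw [this]
    exact map_one ((Ideal.Quotient.mk (Ideal.span {(p : PS W d)})).comp C)
  rw [h1, h3] at h2
  rw [← Ideal.mem_span_singleton, ← Ideal.Quotient.eq_zero_iff_mem]
  refine Eq.trans ?_ h2
  exact (mul_one _).symm

variable [IsDomain W]

lemma leftOrbit_shortExact (h : IsResidueGenerator p t) (hp : (p : W) ≠ 0) :
    (ShortComplex.mk _ _ h.p_smul_comp_leftOrbit).ShortExact where
  exact := by
    rw [ShortComplex.ShortExact.moduleCat_exact_iff_function_exact]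
    refine fun r => ⟨fun hr => ?_, ?_⟩
    · obtain ⟨r', rfl⟩ := h.dvd_of_leftOrbit_eq_zero r hr
      exact ⟨r', rfl⟩
    · rintro ⟨r', rfl⟩
      exact congrArg (fun t => t.hom r') h.p_smul_comp_leftOrbit
  mono_f := by
    refine (ModuleCat.mono_iff_injective _).2 fun a b hab => ?_
    have hp' : (p : PS W d) ≠ 0 := by
      rw [← map_natCast (C : W →+* PS W d)]
      exact fun h0 => hp (C_injective (by rw [h0, map_zero]))
    exact mul_left_cancel₀ hp' hab
  epi_g := (ModuleCat.epi_iff_surjective _).2 h.leftOrbit_surjective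

/-- The generator of `Ext^{d+1}(T, R)`. -/
def extGen (h : IsResidueGenerator p t) (hp : (p : W) ≠ 0) :
    Ext.{u} T (ModuleCat.of (PS W d) (PS W d)) (d + 1) :=
  (Ext.mk₀ (diagUnit W d T)).comp (((fundClass T).mapExactFunctor (restrictLeft W d)).comp
    (h.leftOrbit_shortExact hp).extClass rfl) (zero_add _)

/-- `extGen` is a Koszul class for multiplications by `p` and the variables, all of which annihilate
`X`. -/
lemma isUniversalFrom_extGen (h : IsResidueGenerator p t) (hp : (p : W) ≠ 0)
    {X : ModuleCat.{u} (PS W d)} (hX : ∀ i (x : X), (MvPowerSeries.X i : PS W d) • x = 0)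
    (hpX : ∀ x : X, (p : PS W d) • x = 0) : IsUniversalFrom X (h.extGen hp) := by
  let I := Module.annihilator (PS W d) X
  have h1 : KoszulClass (IsScalarIn I) (h.extGen hp) := by
    refine KoszulClass.iso_comp ?_ _
    exact KoszulClass.step _ _ _ (h.leftOrbit_shortExact hp)
      ⟨p, Module.mem_annihilator.2 hpX, rfl⟩ _
      (koszulClass_map_fundClass (fun i => Module.mem_annihilator.2 (hX i)) h.X_smul)
  refine h1.isUniversalFrom fun N f hf j y => ext_comp_scalar_eq_zero (fun s hs => ?_) f hf j y
  exact ModuleCat.hom_ext (LinearMap.ext fun x => Module.mem_annihilator.1 hs x)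

variable [Fact p.Prime] [Algebra ℤ_[p] W]
variable [Algebra.FormallyUnramified ℤ_[p] W] [Algebra.EssFiniteType ℤ_[p] W]
variable [Module.Flat ℤ_[p] (PS W d)]

variable (p) in
/-- The class of `1 / p`. -/
def invP : ZModPInfty p := Submodule.Quotient.mk (p : ℚ_[p])⁻¹

/-- The extension `0 → R → R → S ⊗_R T → 0` given by `p` maps to the rational one: `1 ↦ r ⊗ 1/p` in
the middle, multiplication by `r` on the left, and the extended form on the right. -/
lemma theta_eq_smul (h : IsResidueGenerator p t) (hp : (p : W) ≠ 0) (f : PontryaginDual p T)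
    (r : PS W d) (hr : dualPairing f t (elem ℤ_[p] W) = r ⊗ₜ[ℤ_[p]] invP p) :
    theta h.isXTorsion f = r • h.extGen hp := by
  let τ₂ : ModuleCat.of (PS W d) (PS W d) ⟶ ratModule p (PS W d) :=
    ModuleCat.ofHom (LinearMap.toSpanSingleton (PS W d) _ (r ⊗ₜ[ℤ_[p]] (p : ℚ_[p])⁻¹))
  have hp0 : (p : ℚ_[p]) ≠ 0 := by exact_mod_cast (Fact.out : p.Prime).ne_zero
  let φ : ShortComplex.mk _ _ h.p_smul_comp_leftOrbit ⟶
      ShortComplex.mk _ _ (toRatModule_ratToTors p (PS W d)) :=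
    { τ₁ := r • 𝟙 _
      τ₂ := τ₂
      τ₃ := dualExtension h.isXTorsion f
      comm₁₂ := by
        refine ModuleCat.hom_ext (LinearMap.ext fun (a : PS W d) => ?_)
        refine (toRatModule_apply p (PS W d) (r * a)).trans ?_
        change _ = ((p : PS W d) * a) • (r ⊗ₜ[ℤ_[p]] (p : ℚ_[p])⁻¹)
        rw [TensorProduct.smul_tmul', smul_eq_mul, mul_assoc, ← nsmul_eq_mul,
          TensorProduct.smul_tmul, nsmul_eq_mul, mul_inv_cancel₀ hp0, mul_comm r a]
      comm₂₃ := by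
        refine ModuleCat.hom_ext (LinearMap.ext fun (a : PS W d) => Eq.symm ?_)
        refine (map_smul (dualExtension h.isXTorsion f).hom a
          (show (restrictLeft W d).obj (baseChange (inclRight W d) T) from
            toBaseChange (inclRight W d) T t)).trans ?_
        refine Eq.trans ?_ (map_smul (ratToTors p (PS W d)).hom a
          (r ⊗ₜ[ℤ_[p]] (p : ℚ_[p])⁻¹)).symm
        refine congrArg (fun q => a • q) ?_
        exact (dualExtension_toBaseChange h.isXTorsion f t).trans hr }
  have hn := ShortComplex.ShortExact.extClass_naturality (h.leftOrbit_shortExact hp)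
    (rat_shortExact p (PS W d)) φ
  have hn' : (Ext.mk₀ (dualExtension h.isXTorsion f)).comp (ratClass p (PS W d)) (zero_add 1) =
      r • (h.leftOrbit_shortExact hp).extClass := by
    refine hn.symm.trans ?_
    change (h.leftOrbit_shortExact hp).extClass.comp (Ext.mk₀ (r • 𝟙 _)) (add_zero 1) = _
    rw [Ext.mk₀_smul, Ext.comp_smul, Ext.comp_mk₀_id]
  rw [theta, hn', Ext.comp_smul, Ext.comp_smul, extGen]

end IsResidueGenerator

end ResidueModules

end GrossHopkins
end

noncomputable section

namespace GrossHopkins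

/-! ### Bijectivity of the duality map for residue modules -/

section Bijectivity

open Abelian MvPowerSeries Algebra.FormallyUnramified IsLocalRing

section

variable {p : ℕ} [Fact p.Prime] {W : Type u} [CommRing W] [Algebra ℤ_[p] W] {d : ℕ}

lemma p_smul_invP : (p : ℤ_[p]) • IsResidueGenerator.invP p = 0 := by
  have hp0 : (p : ℚ_[p]) ≠ 0 := by exact_mod_cast (Fact.out : p.Prime).ne_zero
  rw [IsResidueGenerator.invP, ← Submodule.Quotient.mk_smul, Submodule.Quotient.mk_eq_zero]
  refine ⟨1, ?_⟩
  rw [Algebra.smul_def, map_natCast, mul_inv_cancel₀ hp0, Algebra.linearMap_apply, map_one]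

lemma exists_eq_invP_of_smul_eq_zero (x : ZModPInfty p) (hx : (p : ℤ_[p]) • x = 0) :
    ∃ a : ℤ_[p], x = a • IsResidueGenerator.invP p := by
  have hp0 : (p : ℚ_[p]) ≠ 0 := by exact_mod_cast (Fact.out : p.Prime).ne_zero
  obtain ⟨y, rfl⟩ := Submodule.Quotient.mk_surjective _ x
  rw [← Submodule.Quotient.mk_smul, Submodule.Quotient.mk_eq_zero] at hx
  obtain ⟨a, ha⟩ := hx
  refine ⟨a, ?_⟩
  rw [IsResidueGenerator.invP, ← Submodule.Quotient.mk_smul]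
  congr 1
  rw [Algebra.linearMap_apply, Algebra.smul_def, map_natCast] at ha
  rw [Algebra.smul_def, ha, mul_comm, inv_mul_cancel_left₀ hp0]

/-- Contracting the second factor with a linear form. -/
def contract (l : W →ₗ[ℤ_[p]] ℤ_[p]) : W ⊗[ℤ_[p]] W →ₗ[ℤ_[p]] W :=
  (TensorProduct.rid ℤ_[p] W).toLinearMap ∘ₗ LinearMap.lTensor W l

lemma contract_tmul (l : W →ₗ[ℤ_[p]] ℤ_[p]) (a b : W) : contract l (a ⊗ₜ b) = l b • a := by
  simp [contract]

lemma sum_contract_mul {ι : Type*} [Fintype ι] (b : Module.Basis ι ℤ_[p] W) (t : W ⊗[ℤ_[p]] W) :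
    ∑ j, contract (b.coord j) t * b j = Algebra.TensorProduct.lmul' ℤ_[p] t := by
  induction t using TensorProduct.induction_on with
  | zero => simp
  | tmul x y =>
    simp only [contract_tmul, Algebra.TensorProduct.lmul'_apply_tmul, Module.Basis.coord_apply]
    conv_rhs => rw [← b.sum_repr y, Finset.mul_sum]
    exact Finset.sum_congr rfl fun j _ => by rw [smul_mul_assoc, mul_smul_comm]
  | add x y hx hy => simp only [map_add, add_mul, Finset.sum_add_distrib, hx, hy]

lemma contract_dualPairing (l : W →ₗ[ℤ_[p]] ℤ_[p]) {M : ModuleCat.{u} (PS W d)}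
    (f : PontryaginDual p M) (m : M) (t : W ⊗[ℤ_[p]] W) :
    TensorProduct.lid ℤ_[p] (ZModPInfty p) (LinearMap.rTensor (ZModPInfty p)
      (l ∘ₗ (coeff (R := W) (0 : Fin d →₀ ℕ)).restrictScalars ℤ_[p]) (dualPairing f m t)) =
      f ((C (contract l t) : PS W d) • m) := by
  induction t using TensorProduct.induction_on with
  | zero =>
    rw [map_zero, map_zero, map_zero, map_zero, map_zero, zero_smul]
    exact (map_zero f.toLin).symm
  | tmul x y =>
    rw [dualPairing_tmul, contract_tmul, LinearMap.rTensor_tmul, TensorProduct.lid_tmul]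
    have h1 : (l ∘ₗ (coeff (R := W) (0 : Fin d →₀ ℕ)).restrictScalars ℤ_[p]) (C y) = l y :=
      congrArg l (coeff_zero_C y)
    rw [h1]
    refine (map_smul f.toLin (l y) _).symm.trans ?_
    refine congrArg f.toLin ?_
    exact (map_smul (orbitMap M m) (l y) x).symm
  | add x y hx hy =>
    rw [map_add, map_add, map_add, hx, hy, map_add, map_add, add_smul]
    exact (map_add f.toLin _ _).symm

/-- Contracting the idempotent with the coordinates of a basis `b_j` gives `c_j` with `∑ c_j b_j =
1`, and the vanishing of the pairing gives `f (c_j m) = 0` for all `m`. Applied to the elements `b_j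
m`, this shows that `f m = 0`. -/
lemma eq_zero_of_dualPairing_eq_zero [Algebra.FormallyUnramified ℤ_[p] W]
    [Algebra.EssFiniteType ℤ_[p] W] [Module.Free ℤ_[p] W] [Module.Finite ℤ_[p] W]
    {M : ModuleCat.{u} (PS W d)} (f : PontryaginDual p M)
    (hf : ∀ m, dualPairing f m (elem ℤ_[p] W) = 0) : f = 0 := by
  let b := Module.Free.chooseBasis ℤ_[p] W
  have h1 : ∀ j m, f ((C (contract (b.coord j) (elem ℤ_[p] W)) : PS W d) • m) = 0 := fun j m => by
    rw [← contract_dualPairing, hf, map_zero, map_zero]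
  refine LinearMap.ext fun m : M => ?_
  have h2 := sum_contract_mul b (elem ℤ_[p] W)
  rw [lmul_elem] at h2
  have h3 : m = ∑ j, (C (contract (b.coord j) (elem ℤ_[p] W)) : PS W d) • (C (b j) : PS W d) • m := by
    simp_rw [smul_smul, ← map_mul]
    rw [← Finset.sum_smul, ← map_sum, h2, map_one, one_smul]
  change f m = 0
  rw [h3]
  refine (map_sum f.toLin _ _).trans (Finset.sum_eq_zero fun j _ => h1 j _)

lemma exists_dualPairing_eq {M : ModuleCat.{u} (PS W d)} {m : M}
    (hm : (p : PS W d) • m = 0) (f : PontryaginDual p M) (t : W ⊗[ℤ_[p]] W) :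
    ∃ w : W, dualPairing f m t = (C w : PS W d) ⊗ₜ[ℤ_[p]] IsResidueGenerator.invP p := by
  induction t using TensorProduct.induction_on with
  | zero => exact ⟨0, by simp⟩
  | tmul x y =>
    rw [dualPairing_tmul]
    obtain ⟨a, ha⟩ := exists_eq_invP_of_smul_eq_zero (f ((C x : PS W d) • m)) (by
      refine (map_smul f.toLin (p : ℤ_[p]) _).symm.trans ?_
      refine (congrArg f.toLin (?_ : _ = (0 : M))).trans (map_zero f.toLin)
      change algebraMap ℤ_[p] (PS W d) p • (C x : PS W d) • m = 0
      rw [map_natCast, smul_comm, hm, smul_zero])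
    refine ⟨a • y, ?_⟩
    rw [ha, ← TensorProduct.smul_tmul]
    exact congrArg (fun x => x ⊗ₜ[ℤ_[p]] IsResidueGenerator.invP p)
      (map_smul (constMap p W d) a y).symm
  | add x y hx hy =>
    obtain ⟨a, ha⟩ := hx
    obtain ⟨b, hb⟩ := hy
    exact ⟨a + b, by rw [map_add, map_add, ha, hb, TensorProduct.add_tmul]⟩

lemma exists_pontryaginDual_ne_zero [Nontrivial W] [Module.Free ℤ_[p] W] [Module.Finite ℤ_[p] W]
    {T : ModuleCat.{u} (PS W d)} {t : T} (h : IsResidueGenerator p t) :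
    ∃ f : PontryaginDual p T, f ≠ 0 := by
  let b := Module.Free.chooseBasis ℤ_[p] W
  obtain ⟨j⟩ : Nonempty (Module.Free.ChooseBasisIndex ℤ_[p] W) := b.index_nonempty
  have hp0 : (p : ℚ_[p]) ≠ 0 := by exact_mod_cast (Fact.out : p.Prime).ne_zero
  obtain ⟨φ, hφ⟩ := h.exists_lift (Q := ZModPInfty p)
    ((LinearMap.toSpanSingleton ℤ_[p] _ (IsResidueGenerator.invP p) ∘ₗ b.coord j).toAddMonoidHom)
    (fun w => by
      change b.coord j (p * w) • IsResidueGenerator.invP p = 0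
      rw [← nsmul_eq_mul, map_nsmul, nsmul_eq_mul, mul_comm, mul_smul, p_smul_invP, smul_zero])
  have hφ' : ∀ w, φ ((C w : PS W d) • t) = b.coord j w • IsResidueGenerator.invP p := hφ
  refine ⟨({ toFun := φ, map_add' := φ.map_add, map_smul' := fun a (m : T) => ?_ } :
    (ModuleCat.restrictScalars.{u} (algebraMap ℤ_[p] (PS W d))).obj T →ₗ[ℤ_[p]] ZModPInfty p), ?_⟩
  · obtain ⟨w, rfl⟩ := h.exists_eq m
    change φ (algebraMap ℤ_[p] (PS W d) a • (C w : PS W d) • t) = a • φ _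
    rw [MvPowerSeries.algebraMap_apply, smul_smul, ← map_mul, ← Algebra.smul_def, hφ', hφ', map_smul,
      smul_eq_mul, mul_smul]
  · intro h0
    have h1 : φ ((C (b j) : PS W d) • t) = 0 :=
      congrArg (fun f : PontryaginDual p T => f ((C (b j) : PS W d) • t)) h0
    rw [hφ', Module.Basis.coord_apply, Module.Basis.repr_self, Finsupp.single_eq_same, one_smul,
      IsResidueGenerator.invP, Submodule.Quotient.mk_eq_zero] at h1
    obtain ⟨a, ha⟩ := h1
    have h2 : (p : ℤ_[p]) * a = 1 := by
      apply FaithfulSMul.algebraMap_injective ℤ_[p] ℚ_[p]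
      rw [map_mul, map_natCast, map_one]
      exact (congrArg (fun x => (p : ℚ_[p]) * x) ha).trans (mul_inv_cancel₀ hp0)
    exact PadicInt.prime_p.not_isUnit (IsUnit.of_mul_eq_one a h2)

end

variable {p : ℕ} [Fact p.Prime] {W : Type u} [CommRing W] [Algebra ℤ_[p] W] {d : ℕ}
variable [Algebra.FormallyUnramified ℤ_[p] W] [Algebra.EssFiniteType ℤ_[p] W] [IsDomain W]
variable [Module.Flat ℤ_[p] (PS W d)] [Module.Free ℤ_[p] W] [Module.Finite ℤ_[p] W]

/-- By universality every class is `C a` times `extGen`, and such a multiple vanishes only if `p ∣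
a`: the target is a line over `W/p`. A nonzero form goes to a multiple by some `w` not divisible by
`p`, so injectivity is clear and surjectivity follows from one nonzero form. -/
lemma IsResidueGenerator.theta_bijective (hp : (p : W) ≠ 0)
    (hmax : (Ideal.span {(p : W)}).IsMaximal)
    {T : ModuleCat.{u} (PS W d)} {t : T} (h : IsResidueGenerator p t) :
    Function.Bijective fun f : PontryaginDual p T => theta h.isXTorsion f := by
  have hpt := h.p_smul
  have huniv := h.isUniversalFrom_extGen hp h.X_smul hpt
  have hsmul : ∀ r : PS W d, (Ext.mk₀ (r • 𝟙 T)).comp (h.extGen hp) (zero_add _) =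
      r • h.extGen hp := fun r => by rw [Ext.mk₀_smul, Ext.smul_comp, Ext.mk₀_id_comp]
  have hzero : ∀ w : W, (C w : PS W d) • h.extGen hp = 0 → (p : W) ∣ w := by
    intro w hw
    rw [← hsmul] at hw
    have h1 := huniv.eq_of_eq ((C w : PS W d) • 𝟙 T) 0 (by rw [hw, Ext.mk₀_zero, Ext.zero_comp])
    exact (h.C_smul_eq_zero_iff w).1 (congrArg (fun g => g.hom t) h1)
  have hex : ∀ f : PontryaginDual p T, f ≠ 0 → ∃ w : W, ¬ (p : W) ∣ w ∧
      theta h.isXTorsion f = (C w : PS W d) • h.extGen hp := by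
    intro f hf
    obtain ⟨w, hw⟩ := exists_dualPairing_eq (hpt t) f (elem ℤ_[p] W)
    refine ⟨w, ?_, h.theta_eq_smul hp f _ hw⟩
    rintro ⟨w', rfl⟩
    refine hf (eq_zero_of_dualPairing_eq_zero f fun m => ?_)
    obtain ⟨a, rfl⟩ := h.exists_eq m
    have h0 : dualPairing f t (elem ℤ_[p] W) = 0 := by
      have hsm : (p : PS W d) * C w' = (p : ℤ_[p]) • (C w' : PS W d) := by
        rw [Algebra.smul_def, map_natCast]
      rw [hw, map_mul, map_natCast, hsm, TensorProduct.smul_tmul, p_smul_invP,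
        TensorProduct.tmul_zero]
    rw [← dualMap_apply, dualMap_smul, dualMap_apply, h0, smul_zero]
  refine ⟨fun f g hfg => ?_, fun y => ?_⟩
  · by_contra hne
    obtain ⟨w, hw, hw'⟩ := hex (f - g) (sub_ne_zero.2 hne)
    have h1 : theta h.isXTorsion (f - g) = 0 := by
      have h2 := theta_add h.isXTorsion (f - g) g
      rw [sub_add_cancel] at h2
      exact add_eq_right.1 (h2.symm.trans hfg)
    exact hw (hzero w (hw'.symm.trans h1))
  · obtain ⟨g, rfl⟩ := huniv.exists_eq y
    obtain ⟨a, ha⟩ := h.exists_eq (g.hom t)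
    have hg : g = (C a : PS W d) • 𝟙 T := by
      refine ModuleCat.hom_ext (LinearMap.ext fun m => ?_)
      obtain ⟨b, rfl⟩ := h.exists_eq m
      rw [map_smul, ha]
      exact smul_comm _ _ _
    obtain ⟨f, hf⟩ := exists_pontryaginDual_ne_zero h
    obtain ⟨w, hw, hw'⟩ := hex f hf
    -- `c` inverts `w` modulo the maximal ideal `(p)`; scaling the form by `a * c` then hits `a`
    -- times the generator.
    obtain ⟨c, hc⟩ : ∃ c, (p : W) ∣ c * w - 1 := by
      obtain ⟨c, hc⟩ := hmax.exists_inv (x := w) (fun h => hw (Ideal.mem_span_singleton.1 h))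
      obtain ⟨i, hi, hc⟩ := hc
      refine ⟨c, ?_⟩
      rw [← Ideal.mem_span_singleton, ← hc, sub_add_cancel_left]
      exact neg_mem hi
    refine ⟨(C (a * c) : PS W d) • f, ?_⟩
    dsimp only
    rw [hg, hsmul, theta_smul, hw', smul_smul, map_mul, mul_assoc, mul_smul, ← map_mul]
    congr 1
    rw [← hsmul]
    have : (C (c * w) : PS W d) • 𝟙 T = 𝟙 T := by
      refine ModuleCat.hom_ext (LinearMap.ext fun m => ?_)
      obtain ⟨b, rfl⟩ := h.exists_eq m
      obtain ⟨e, he⟩ := hc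
      change (C (c * w) : PS W d) • (C b : PS W d) • t = (C b : PS W d) • t
      rw [sub_eq_iff_eq_add.1 he, map_add, map_one, map_mul, map_natCast, add_smul, one_smul,
        mul_smul, smul_comm, hpt, smul_zero, zero_add]
    rw [this, Ext.mk₀_id_comp]

end Bijectivity

end GrossHopkins
end

noncomputable section

namespace GrossHopkins

/-! ### Dévissage to simple modules -/

section FiniteLength

open Abelian MvPowerSeries IsLocalRing

/-- `ℚ_p/ℤ_p` is divisible and the ideals of `ℤ_p` are principal. -/
lemma baer_zModPInfty (p : ℕ) [Fact p.Prime] : Module.Baer ℤ_[p] (ZModPInfty p) := by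
  intro I g
  obtain ⟨a, rfl⟩ := (IsPrincipalIdealRing.principal I).principal
  have ha : a ∈ Submodule.span ℤ_[p] {a} := Submodule.mem_span_singleton_self a
  obtain ⟨q, hq⟩ : ∃ q : ZModPInfty p, a • q = g ⟨a, ha⟩ := by
    by_cases h0 : a = 0
    · refine ⟨0, ?_⟩
      have : (⟨a, ha⟩ : Submodule.span ℤ_[p] {a}) = 0 := Subtype.ext h0
      rw [this, map_zero, smul_zero]
    · obtain ⟨y, hy⟩ := Submodule.Quotient.mk_surjective _ (g ⟨a, ha⟩)
      refine ⟨Submodule.Quotient.mk ((algebraMap ℤ_[p] ℚ_[p] a)⁻¹ * y), ?_⟩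
      rw [← hy, ← Submodule.Quotient.mk_smul, Algebra.smul_def, mul_inv_cancel_left₀]
      exact fun h => h0 (FaithfulSMul.algebraMap_injective ℤ_[p] ℚ_[p] (by rw [h, map_zero]))
  refine ⟨LinearMap.toSpanSingleton ℤ_[p] _ q, fun x hx => ?_⟩
  obtain ⟨c, rfl⟩ := Submodule.mem_span_singleton.1 hx
  have : (⟨c • a, hx⟩ : Submodule.span ℤ_[p] {a}) = c • ⟨a, ha⟩ := rfl
  rw [this, map_smul g, ← hq, LinearMap.toSpanSingleton_apply, smul_eq_mul, mul_smul]

variable {p : ℕ} {W : Type u} [CommRing W] {d : ℕ}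

/-- `R` is local, and its maximal ideal consists of the series with nonunit constant coefficient.
Hence a simple module is a copy of `W/p` killed by the variables, generated by any nonzero element.
-/
lemma exists_isResidueGenerator [IsLocalRing W] (hm : maximalIdeal W = Ideal.span {(p : W)})
    (T : ModuleCat.{u} (PS W d)) [IsSimpleModule (PS W d) T] :
    ∃ t : T, IsResidueGenerator p t := by
  have := IsSimpleModule.nontrivial (PS W d) T
  obtain ⟨t, ht⟩ := exists_ne (0 : T)
  have hann : Module.annihilator (PS W d) T = maximalIdeal (PS W d) :=
    eq_maximalIdeal (IsSimpleModule.annihilator_isMaximal (R := PS W d) (M := T))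
  have hkill : ∀ (r : PS W d) (m : T), ¬ IsUnit (constantCoeff r) → r • m = 0 := by
    intro r m hr
    refine Module.mem_annihilator.1 ?_ m
    rw [hann, mem_maximalIdeal, mem_nonunits_iff, isUnit_iff_constantCoeff]
    exact hr
  refine ⟨t, fun i m => hkill _ m ?_, fun m => ?_, fun w => ?_⟩
  · rw [constantCoeff_X]
    exact not_isUnit_zero
  · obtain ⟨r, rfl⟩ := IsSimpleModule.toSpanSingleton_surjective (PS W d) ht m
    refine ⟨constantCoeff r, ?_⟩
    rw [LinearMap.toSpanSingleton_apply, ← sub_eq_zero, ← sub_smul]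
    refine hkill _ t ?_
    rw [map_sub, constantCoeff_C, sub_self]
    exact not_isUnit_zero
  · rw [← Ideal.mem_span_singleton, ← hm, mem_maximalIdeal, mem_nonunits_iff]
    constructor
    · intro h hw
      refine ht ?_
      have hw' : IsUnit (C w : PS W d) := hw.map C
      rwa [hw'.smul_eq_zero] at h
    · intro h
      refine hkill _ t ?_
      rwa [constantCoeff_C]

lemma isXTorsion_of_submodule {M : ModuleCat.{u} (PS W d)} (N : Submodule (PS W d) M)
    (hN : IsXTorsion (ModuleCat.of (PS W d) N)) (hQ : IsXTorsion (ModuleCat.of (PS W d) (M ⧸ N))) :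
    IsXTorsion M := by
  obtain ⟨k, hk⟩ := hN
  obtain ⟨l, hl⟩ := hQ
  refine ⟨k + l, fun i m => ?_⟩
  have h1 : (X i ^ l : PS W d) • m ∈ N := by
    rw [← Submodule.Quotient.mk_eq_zero, Submodule.Quotient.mk_smul]
    exact hl i (Submodule.Quotient.mk m)
  rw [pow_add, mul_smul]
  exact congrArg Subtype.val (hk i ⟨_, h1⟩)

lemma submodule_shortExact {R : Type u} [CommRing R] {M : ModuleCat.{u} R} (N : Submodule R M) :
    (ShortComplex.mk (ModuleCat.ofHom N.subtype : ModuleCat.of R N ⟶ M)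
      (ModuleCat.ofHom N.mkQ : M ⟶ ModuleCat.of R (M ⧸ N))
      (ModuleCat.hom_ext (LinearMap.ext fun n => by simp))).ShortExact where
  exact := by
    rw [ShortComplex.ShortExact.moduleCat_exact_iff_function_exact]
    exact LinearMap.exact_subtype_mkQ N
  mono_f := (ModuleCat.mono_iff_injective _).2 N.injective_subtype
  epi_g := (ModuleCat.epi_iff_surjective _).2 N.mkQ_surjective

variable [Fact p.Prime] [Algebra ℤ_[p] W]

/-- The dual of a linear map. -/
def PontryaginDual.comap {M M' : ModuleCat.{u} (PS W d)} (g : M ⟶ M') (f : PontryaginDual p M') :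
    PontryaginDual p M :=
  f.toLin ∘ₗ ((ModuleCat.restrictScalars.{u} (algebraMap ℤ_[p] (PS W d))).map g).hom

lemma PontryaginDual.exists_comap_eq {M : ModuleCat.{u} (PS W d)} (N : Submodule (PS W d) M)
    (f : PontryaginDual p (ModuleCat.of (PS W d) N)) :
    ∃ g : PontryaginDual p M, g.comap (ModuleCat.ofHom N.subtype) = f :=
  (baer_zModPInfty p).extension_property
    ((ModuleCat.restrictScalars.{u} (algebraMap ℤ_[p] (PS W d))).map
      (ModuleCat.ofHom N.subtype)).hom N.injective_subtype f.toLin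

lemma PontryaginDual.exists_eq_comap {M : ModuleCat.{u} (PS W d)} (N : Submodule (PS W d) M)
    (f : PontryaginDual p M)
    (hf : f.comap (ModuleCat.ofHom N.subtype : ModuleCat.of (PS W d) N ⟶ M) = 0) :
    ∃ g : PontryaginDual p (ModuleCat.of (PS W d) (M ⧸ N)), g.comap (ModuleCat.ofHom N.mkQ) = f := by
  have hker : ∀ n : N, f (n : M) = 0 := fun n =>
    congrArg (fun g : PontryaginDual p (ModuleCat.of (PS W d) N) => g n) hf
  let g : (ModuleCat.restrictScalars.{u} (algebraMap ℤ_[p] (PS W d))).obj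
      (ModuleCat.of (PS W d) (M ⧸ N)) →ₗ[ℤ_[p]] ZModPInfty p :=
    { toFun := QuotientAddGroup.lift N.toAddSubgroup f.toLin.toAddMonoidHom
        (fun n hn => hker ⟨n, hn⟩)
      map_add' := map_add (QuotientAddGroup.lift N.toAddSubgroup f.toLin.toAddMonoidHom
        (fun n hn => hker ⟨n, hn⟩))
      map_smul' := fun a x => by
        obtain ⟨m, rfl⟩ := N.mkQ_surjective x
        exact f.toLin.map_smul a m }
  exact ⟨g, rfl⟩

variable [Algebra.FormallyUnramified ℤ_[p] W] [Algebra.EssFiniteType ℤ_[p] W] [IsDomain W]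
variable [Module.Flat ℤ_[p] (PS W d)]

/-- The conclusion of the duality theorem for `M`, together with the vanishing of the lower `Ext`
groups. -/
structure IsDualizable (p : ℕ) [Fact p.Prime] [Algebra ℤ_[p] W]
    [Algebra.FormallyUnramified ℤ_[p] W] [Algebra.EssFiniteType ℤ_[p] W]
    [Module.Flat ℤ_[p] (PS W d)] (M : ModuleCat.{u} (PS W d)) : Prop where
  isXTorsion : IsXTorsion M
  vanish : ∀ (j : ℕ) (_ : j < d + 1) (y : Ext.{u} M (ModuleCat.of (PS W d) (PS W d)) j), y = 0
  bijective : ∀ hM : IsXTorsion M,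
    Function.Bijective fun f : PontryaginDual p M => theta hM f

lemma isDualizable_of_subsingleton (M : ModuleCat.{u} (PS W d)) [Subsingleton M] :
    IsDualizable p M := by
  have hext : ∀ (j : ℕ) (y : Ext.{u} M (ModuleCat.of (PS W d) (PS W d)) j), y = 0 := fun j y => by
    rw [← Ext.mk₀_id_comp y]
    have : 𝟙 M = 0 := ModuleCat.hom_ext (LinearMap.ext fun m => Subsingleton.elim _ _)
    rw [this, Ext.mk₀_zero, Ext.zero_comp]
  refine ⟨⟨0, fun i m => Subsingleton.elim _ _⟩, fun j _ => hext j, fun hM =>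
    ⟨fun f g _ => ?_, fun y => ⟨0, ?_⟩⟩⟩
  · refine LinearMap.ext fun m : M => ?_
    obtain rfl : m = 0 := Subsingleton.elim _ _
    exact (map_zero f.toLin).trans (map_zero g.toLin).symm
  · rw [hext _ y]
    exact hext _ _

lemma theta_zero {M : ModuleCat.{u} (PS W d)} (hM : IsXTorsion M) :
    theta hM (0 : PontryaginDual p M) = 0 := by
  have := theta_add hM (0 : PontryaginDual p M) 0
  rwa [add_zero, eq_comm, add_eq_left] at this

/-- A five lemma chase between the dual sequence and the `Ext` sequence. Injectivity needs `Ext^d(N,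
R) = 0`, which is why vanishing is carried along; surjectivity needs forms on `N` to extend to `M`.
-/
lemma IsDualizable.extension {M : ModuleCat.{u} (PS W d)} (N : Submodule (PS W d) M)
    (hN : IsDualizable p (ModuleCat.of (PS W d) N))
    (hQ : IsDualizable p (ModuleCat.of (PS W d) (M ⧸ N))) : IsDualizable p M := by
  have hS := submodule_shortExact N
  let i : ModuleCat.of (PS W d) N ⟶ M := ModuleCat.ofHom N.subtype
  let π : M ⟶ ModuleCat.of (PS W d) (M ⧸ N) := ModuleCat.ofHom N.mkQ
  have hNM : ∀ (hM : IsXTorsion M) (f : PontryaginDual p M),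
      theta hN.isXTorsion (f.comap i) = (Ext.mk₀ i).comp (theta hM f) (zero_add _) :=
    fun hM f => theta_naturality hN.isXTorsion hM i _ f fun m => rfl
  have hMQ : ∀ (hM : IsXTorsion M) (f : PontryaginDual p (ModuleCat.of (PS W d) (M ⧸ N))),
      theta hM (f.comap π) = (Ext.mk₀ π).comp (theta hQ.isXTorsion f) (zero_add _) :=
    fun hM f => theta_naturality hM hQ.isXTorsion π _ f fun m => rfl
  refine ⟨isXTorsion_of_submodule N hN.isXTorsion hQ.isXTorsion, fun j hj y => ?_, fun hM =>
    ⟨?_, fun y => ?_⟩⟩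
  · obtain ⟨x, rfl⟩ := Ext.contravariant_sequence_exact₂ hS _ y (hN.vanish j hj _)
    rw [hQ.vanish j hj x, Ext.comp_zero]
  · have key : ∀ f : PontryaginDual p M, theta hM f = 0 → f = 0 := by
      intro f hf
      have h1 : f.comap i = 0 := by
        refine (hN.bijective hN.isXTorsion).1 ?_
        dsimp only
        rw [theta_zero, hNM hM, hf, Ext.comp_zero]
      obtain ⟨g, rfl⟩ := PontryaginDual.exists_eq_comap N f h1
      have h2 : (Ext.mk₀ π).comp (theta hQ.isXTorsion g) (zero_add _) = 0 :=
        (hMQ hM g).symm.trans hf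
      obtain ⟨x, hx⟩ := Ext.contravariant_sequence_exact₃ hS _ _ h2 (add_comm 1 d)
      rw [hN.vanish d (by omega) x, Ext.comp_zero] at hx
      have h3 : g = 0 := (hQ.bijective hQ.isXTorsion).1 (hx.symm.trans (theta_zero _).symm)
      rw [h3]
      rfl
    intro f g hfg
    rw [← sub_eq_zero]
    refine key _ ?_
    have h2 := theta_add hM (f - g) g
    rw [sub_add_cancel] at h2
    exact add_eq_right.1 (h2.symm.trans hfg)
  · obtain ⟨fN, hfN⟩ := (hN.bijective hN.isXTorsion).2 ((Ext.mk₀ i).comp y (zero_add _))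
    obtain ⟨f, rfl⟩ := PontryaginDual.exists_comap_eq N fN
    have h1 : (Ext.mk₀ i).comp (y - theta hM f) (zero_add _) = 0 := by
      rw [sub_eq_add_neg, Ext.comp_add, Ext.comp_neg, ← hNM, ← sub_eq_add_neg, sub_eq_zero, ← hfN]
    obtain ⟨x, hx⟩ := Ext.contravariant_sequence_exact₂ hS _ _ h1
    obtain ⟨g, rfl⟩ := (hQ.bijective hQ.isXTorsion).2 x
    refine ⟨g.comap π + f, ?_⟩
    refine (theta_add _ _ _).trans ?_
    rw [hMQ, ← eq_sub_iff_add_eq]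
    exact hx

variable [Module.Free ℤ_[p] W] [Module.Finite ℤ_[p] W] [IsLocalRing W]

lemma isDualizable_of_isSimpleModule (hp : (p : W) ≠ 0)
    (hm : maximalIdeal W = Ideal.span {(p : W)}) (T : ModuleCat.{u} (PS W d))
    [IsSimpleModule (PS W d) T] : IsDualizable p T := by
  obtain ⟨t, ht⟩ := exists_isResidueGenerator hm T
  exact ⟨ht.isXTorsion, (ht.isUniversalFrom_extGen hp ht.X_smul ht.p_smul).vanish, fun _ =>
    ht.theta_bijective hp (hm ▸ maximalIdeal.isMaximal W)⟩

lemma isDualizable_of_isFiniteLength (hp : (p : W) ≠ 0)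
    (hm : maximalIdeal W = Ideal.span {(p : W)}) (M : ModuleCat.{u} (PS W d))
    (hM : IsFiniteLength (PS W d) M) : IsDualizable p M := by
  have key : ∀ (M : Type u) [AddCommGroup M] [Module (PS W d) M], IsFiniteLength (PS W d) M →
      IsDualizable p (ModuleCat.of (PS W d) M) := by
    intro M _ _ hM
    induction hM with
    | @of_subsingleton M _ _ h =>
      have : Subsingleton (ModuleCat.of (PS W d) M) := h
      exact isDualizable_of_subsingleton _
    | @of_simple_quotient M _ _ N hs _ ih =>
      have : IsSimpleModule (PS W d) (ModuleCat.of (PS W d) (M ⧸ N)) := hs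
      exact IsDualizable.extension (M := ModuleCat.of (PS W d) M) N ih
        (isDualizable_of_isSimpleModule hp hm (ModuleCat.of (PS W d) (M ⧸ N)))
  exact key M hM

end FiniteLength

end GrossHopkins
end

noncomputable section

namespace GrossHopkins

/-! ### The coefficient ring: completeness, locality and maximal ideal -/

section CoefficientRing

open IsLocalRing

variable (p : ℕ) [Fact p.Prime] (W : Type u) [CommRing W] [Algebra ℤ_[p] W]

lemma map_maximalIdeal_padicInt :
    (maximalIdeal ℤ_[p]).map (algebraMap ℤ_[p] W) = Ideal.span {(p : W)} := by
  rw [PadicInt.maximalIdeal_eq_span_p, Ideal.map_span, Set.image_singleton, map_natCast]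

lemma dvd_iff_repr {ι : Type*} [Fintype ι] (b : Module.Basis ι ℤ_[p] W) (k : ℕ) (w : W) :
    (p : W) ^ k ∣ w ↔ ∀ j, (p : ℤ_[p]) ^ k ∣ b.repr w j := by
  have hs : ∀ v : W, (p : W) ^ k * v = (p : ℤ_[p]) ^ k • v := fun v => by
    rw [Algebra.smul_def, map_pow, map_natCast]
  constructor
  · rintro ⟨v, rfl⟩ j
    rw [hs, map_smul]
    exact ⟨b.repr v j, rfl⟩
  · intro h
    choose c hc using h
    refine ⟨∑ j, c j • b j, ?_⟩
    rw [hs, Finset.smul_sum]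
    conv_lhs => rw [← b.sum_repr w]
    exact Finset.sum_congr rfl fun j _ => by rw [hc, mul_smul]

variable [Module.Free ℤ_[p] W]

lemma natCast_p_ne_zero [Nontrivial W] : (p : W) ≠ 0 := by
  intro h
  have h1 : (p : ℤ_[p]) • (1 : W) = 0 := by rw [Algebra.smul_def, map_natCast, h, zero_mul]
  have h2 := (smul_eq_zero.1 h1).resolve_right one_ne_zero
  exact PadicInt.prime_p.ne_zero h2

variable [Module.Finite ℤ_[p] W]

/-- A finite free algebra over `ℤ_p` is `p`-adically complete. -/
lemma isAdicComplete_span_p : IsAdicComplete (Ideal.span {(p : W)}) W := by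
  let b := Module.Free.chooseBasis ℤ_[p] W
  have hmem : ∀ (k : ℕ) (x y : W),
      x ≡ y [SMOD (Ideal.span {(p : W)} ^ k • ⊤ : Submodule W W)] ↔
        ∀ j, b.repr x j ≡ b.repr y j [SMOD (maximalIdeal ℤ_[p] ^ k • ⊤ : Submodule ℤ_[p] ℤ_[p])] := by
    intro k x y
    rw [SModEq.sub_mem, smul_eq_mul, Ideal.mul_top, Ideal.span_singleton_pow,
      Ideal.mem_span_singleton, dvd_iff_repr p W b]
    refine forall_congr' fun j => ?_
    rw [SModEq.sub_mem, smul_eq_mul, Ideal.mul_top, PadicInt.maximalIdeal_eq_span_p,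
      Ideal.span_singleton_pow, Ideal.mem_span_singleton, map_sub]
    rfl
  refine { haus' := fun x hx => ?_, prec' := fun f hf => ?_ }
  · apply b.repr.injective
    ext j
    rw [map_zero, Finsupp.zero_apply]
    refine IsHausdorff.haus (I := maximalIdeal ℤ_[p]) inferInstance _ fun k => ?_
    have := (hmem k x 0).1 (hx k) j
    rwa [map_zero, Finsupp.zero_apply] at this
  · have h1 : ∀ j, ∃ L : ℤ_[p], ∀ k, b.repr (f k) j ≡ L
        [SMOD (maximalIdeal ℤ_[p] ^ k • ⊤ : Submodule ℤ_[p] ℤ_[p])] := fun j =>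
      IsPrecomplete.prec (I := maximalIdeal ℤ_[p]) inferInstance
        fun {m n} hmn => (hmem m _ _).1 (hf hmn) j
    choose L hL using h1
    refine ⟨∑ j, L j • b j, fun k => (hmem k _ _).2 fun j => ?_⟩
    rw [b.repr_sum_self]
    exact hL j k

/-- Fitting's lemma in the Artinian ring `W/p` attaches an idempotent to each `a`. By Hensel it
lifts to `W`, where it is `0` or `1` since `W` is a domain. Accordingly `a` is nilpotent modulo `p`,
and `1 - a` is a unit, or `a` is a unit. -/
lemma isLocalRing_of_finite_free (p : ℕ) [Fact p.Prime] (W : Type u) [CommRing W] [IsDomain W]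
    [Algebra ℤ_[p] W] [Module.Free ℤ_[p] W] [Module.Finite ℤ_[p] W] : IsLocalRing W := by
  let J := (maximalIdeal ℤ_[p]).map (algebraMap ℤ_[p] W)
  have hJ : J = Ideal.span {(p : W)} := map_maximalIdeal_padicInt p W
  have hcomp : IsAdicComplete J W := hJ ▸ isAdicComplete_span_p p W
  have hjac : J ≤ Ideal.jacobson ⊥ := IsAdicComplete.le_jacobson_bot J
  have hunit : ∀ w : W, w - 1 ∈ J → IsUnit w := fun w hw => by
    have := (Ideal.mem_jacobson_bot.1 (hjac hw)) 1
    rwa [mul_one, sub_add_cancel] at this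
  have : IsArtinianRing (W ⧸ J) := by
    let : Field (ℤ_[p] ⧸ maximalIdeal ℤ_[p]) := Ideal.Quotient.field _
    have : Module.Finite (ℤ_[p] ⧸ maximalIdeal ℤ_[p]) (W ⧸ J) :=
      Module.Finite.of_restrictScalars_finite ℤ_[p] _ _
    exact isArtinian_of_tower (ℤ_[p] ⧸ maximalIdeal ℤ_[p]) inferInstance
  refine IsLocalRing.of_isUnit_or_isUnit_one_sub_self fun a => ?_
  -- The descending chain of powers of `a` stabilizes: `α ^ (n + 1) * η = α ^ n`, so `α ^ n * η ^ n`
  -- is idempotent.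
  obtain ⟨n, y, hy⟩ := IsArtinian.exists_pow_succ_smul_dvd (R := W ⧸ J) (M := W ⧸ J)
    (Ideal.Quotient.mk J a) 1
  obtain ⟨y, rfl⟩ := Ideal.Quotient.mk_surjective y
  simp only [Nat.succ_eq_add_one, smul_eq_mul, mul_one] at hy
  set α := Ideal.Quotient.mk J a
  set η := Ideal.Quotient.mk J y
  have h1 : ∀ k, α ^ n = α ^ (n + k) * η ^ k := by
    intro k
    induction k with
    | zero => simp
    | succ k ih =>
      calc α ^ n = α ^ (n + k) * η ^ k := ih
        _ = α ^ k * (α ^ (n + 1) * η) * η ^ k := by rw [hy]; ring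
        _ = _ := by ring
  obtain ⟨c, hc, hcJ⟩ := HenselianRing.is_henselian (I := J) (Polynomial.X ^ 2 - Polynomial.X)
    (Polynomial.monic_X_pow_sub (by simp)) (a ^ n * y ^ n) (by
      rw [← Ideal.Quotient.eq_zero_iff_mem]
      simp only [Polynomial.eval_sub, Polynomial.eval_pow, Polynomial.eval_X, map_sub, map_pow,
        map_mul]
      change (α ^ n * η ^ n) ^ 2 - α ^ n * η ^ n = 0
      have := h1 n
      linear_combination -(η ^ n) * this) (by
      simp only [Polynomial.derivative_X_pow, Polynomial.derivative_X,
        Polynomial.eval_sub, Polynomial.eval_mul, Polynomial.eval_pow, Polynomial.eval_X,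
        Polynomial.eval_one, map_sub, map_mul, map_pow, map_one, Polynomial.eval_C]
      -- The derivative at an idempotent `ε` is `2ε - 1`, which is its own inverse.
      refine IsUnit.of_mul_eq_one (2 * (α ^ n * η ^ n) - 1) ?_
      change (Ideal.Quotient.mk J ((2 : ℕ) : W) * (α ^ n * η ^ n) ^ (2 - 1) - 1) * _ = 1
      have := h1 n
      rw [map_natCast, Nat.add_one_sub_one, pow_one, Nat.cast_ofNat]
      linear_combination -4 * (η ^ n) * this)
  have hc2 : c * (c - 1) = 0 := by
    have := hc
    simp only [Polynomial.IsRoot, Polynomial.eval_sub, Polynomial.eval_pow, Polynomial.eval_X] at this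
    linear_combination this
  have hcα : Ideal.Quotient.mk J c = α ^ n * η ^ n := by
    rw [← sub_eq_zero, ← map_pow, ← map_pow, ← map_mul, ← map_sub, Ideal.Quotient.eq_zero_iff_mem]
    exact hcJ
  rcases mul_eq_zero.1 hc2 with h0 | h0
  · right
    rw [h0, map_zero] at hcα
    have h2 : α ^ n = 0 := by
      have := h1 n
      rw [pow_add, mul_assoc, ← hcα, mul_zero] at this
      exact this
    have h3 : IsUnit (1 - a ^ n) := hunit _ (by
      rw [← Ideal.Quotient.eq_zero_iff_mem, sub_sub_cancel_left, map_neg, map_pow, neg_eq_zero]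
      exact h2)
    exact isUnit_of_dvd_unit (one_sub_dvd_one_sub_pow a n) h3
  · left
    rw [sub_eq_zero.1 h0, map_one] at hcα
    -- For `n = 0` the idempotent is trivially `1`; there `hy` itself says that `α * η = 1`.
    rcases Nat.eq_zero_or_pos n with rfl | hn
    · have h3 : IsUnit (a * y) := hunit _ (by
        rw [← Ideal.Quotient.eq_zero_iff_mem, map_sub, map_one, map_mul, sub_eq_zero]
        simpa using hy)
      exact isUnit_of_mul_isUnit_left h3
    · have h3 : IsUnit (a ^ n * y ^ n) := hunit _ (by
        rw [← Ideal.Quotient.eq_zero_iff_mem, map_sub, map_one, map_mul, map_pow, map_pow, sub_eq_zero]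
        exact hcα.symm)
      exact (isUnit_pow_iff hn.ne').1 (isUnit_of_mul_isUnit_left h3)

lemma maximalIdeal_eq_span_p [IsDomain W] [IsLocalRing W] [Algebra.FormallyUnramified ℤ_[p] W] :
    maximalIdeal W = Ideal.span {(p : W)} := by
  have : Algebra.IsIntegral ℤ_[p] W := Algebra.IsIntegral.of_finite ℤ_[p] W
  rw [← map_maximalIdeal_padicInt, Algebra.FormallyUnramified.map_maximalIdeal]

instance flat_mvPowerSeries (d : ℕ) : Module.Flat ℤ_[p] (PS W d) := by
  have : Module.IsTorsionFree ℤ_[p] (PS W d) :=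
    inferInstanceAs (Module.IsTorsionFree ℤ_[p] ((Fin d →₀ ℕ) → W))
  infer_instance

end CoefficientRing

end GrossHopkins
end

noncomputable section

namespace GrossHopkins

/-! ### The filtration by powers of `(p, x)` and uniqueness of ring homomorphisms -/

section Filtration

open MvPowerSeries

variable {W : Type u} [CommRing W] (p : ℕ) {ι ι' : Type*}

variable (W ι) in
/-- The `k`-th power of the ideal generated by `p` and the variables, described by coefficients. -/
def filt (k : ℕ) : Ideal (MvPowerSeries ι W) where
  carrier := {s | ∀ e, (p : W) ^ (k - e.degree) ∣ coeff e s}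
  zero_mem' e := by rw [map_zero]; exact dvd_zero _
  add_mem' ha hb e := by rw [map_add]; exact dvd_add (ha e) (hb e)
  smul_mem' r s hs e := by
    classical
    rw [smul_eq_mul, coeff_mul]
    refine Finset.dvd_sum fun q hq => Dvd.dvd.mul_left ((pow_dvd_pow _ ?_).trans (hs q.2)) _
    have := congrArg Finsupp.degree (Finset.HasAntidiagonal.mem_antidiagonal.1 hq)
    rw [map_add] at this
    omega

lemma mem_filt {k : ℕ} {s : MvPowerSeries ι W} :
    s ∈ filt W p ι k ↔ ∀ e, (p : W) ^ (k - e.degree) ∣ coeff e s := Iff.rfl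

lemma mul_mem_filt {k l : ℕ} {s t : MvPowerSeries ι W} (hs : s ∈ filt W p ι k)
    (ht : t ∈ filt W p ι l) : s * t ∈ filt W p ι (k + l) := by
  classical
  intro e
  rw [coeff_mul]
  refine Finset.dvd_sum fun q hq =>
    (pow_dvd_pow _ ?_).trans ((pow_add (p : W) _ _).dvd.trans (mul_dvd_mul (hs q.1) (ht q.2)))
  have := congrArg Finsupp.degree (Finset.HasAntidiagonal.mem_antidiagonal.1 hq)
  rw [map_add] at this
  omega

lemma mem_filt_zero (s : MvPowerSeries ι W) : s ∈ filt W p ι 0 := fun e => by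
  rw [Nat.zero_sub, pow_zero]
  exact one_dvd _

lemma pow_mem_filt {s : MvPowerSeries ι W} (hs : s ∈ filt W p ι 1) (k : ℕ) :
    s ^ k ∈ filt W p ι k := by
  induction k with
  | zero => exact mem_filt_zero p _
  | succ k ih =>
    rw [pow_succ]
    exact mul_mem_filt p ih hs

lemma ideal_pow_le_filt {I : Ideal (MvPowerSeries ι W)} (hI : I ≤ filt W p ι 1) (k : ℕ) :
    I ^ k ≤ filt W p ι k := by
  induction k with
  | zero => exact fun s _ => mem_filt_zero p s
  | succ k ih =>
    rw [pow_succ, Ideal.mul_le]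
    exact fun a ha b hb => mul_mem_filt p (ih ha) (hI hb)

lemma mem_filt_one_iff {s : MvPowerSeries ι W} :
    s ∈ filt W p ι 1 ↔ (p : W) ∣ constantCoeff s := by
  rw [mem_filt, ← coeff_zero_eq_constantCoeff_apply]
  constructor
  · intro h
    simpa using h 0
  · intro h e
    by_cases he : e = 0
    · subst he
      simpa using h
    · have : 1 - e.degree = 0 := by
        have := mt (Finsupp.degree_eq_zero_iff e).1 he
        omega
      rw [this, pow_zero]
      exact one_dvd _

variable [IsHausdorff (Ideal.span {(p : W)}) W]

lemma eq_zero_of_forall_pow_dvd (w : W) (h : ∀ k, (p : W) ^ k ∣ w) : w = 0 := by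
  refine IsHausdorff.haus (I := Ideal.span {(p : W)}) inferInstance w fun k => ?_
  rw [SModEq.zero, smul_eq_mul, Ideal.mul_top, Ideal.span_singleton_pow, Ideal.mem_span_singleton]
  exact h k

lemma eq_zero_of_forall_mem_filt (s : MvPowerSeries ι W) (h : ∀ k, s ∈ filt W p ι k) : s = 0 := by
  ext e
  refine eq_zero_of_forall_pow_dvd p _ fun k => ?_
  have := h (k + e.degree) e
  rwa [Nat.add_sub_cancel] at this

/-- Ring homomorphisms between power series rings which are determined by the images of the
constants and the variables. -/
lemma mvPowerSeries_ringHom_ext [Finite ι] {f g : MvPowerSeries ι W →+* MvPowerSeries ι' W}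
    (hC : ∀ w, f (C w) = g (C w)) (hX : ∀ i, f (X i) = g (X i))
    (hf : ∀ i, f (X i) ∈ filt W p ι' 1) : f = g := by
  classical
  have := Fintype.ofFinite ι
  ext1 s
  rw [← sub_eq_zero]
  refine eq_zero_of_forall_mem_filt p _ fun k => ?_
  -- The two maps agree on the polynomial `t`, and the remainder lies in the ideal of the `X i ^ k`,
  -- which both send into step `k` of a separated filtration.
  let t := trunc' W (Finsupp.equivFunOnFinite.symm fun _ : ι => k) s
  have h1 : s - (t : MvPowerSeries ι W) ∈ Ideal.span (Set.range fun i : ι =>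
      (X i ^ k : MvPowerSeries ι W)) := by
    refine mem_span_X_pow_of_coeff id k Finset.univ _ fun e he => ?_
    rw [map_sub, MvPolynomial.coeff_coe, coeff_trunc', if_pos, sub_self]
    exact fun i => (he i (Finset.mem_univ i)).le
  have h2 : ∀ h : MvPowerSeries ι W →+* MvPowerSeries ι' W, (∀ i, h (X i) ∈ filt W p ι' 1) →
      h (s - t) ∈ filt W p ι' k := by
    intro h hh
    refine (Ideal.map_le_iff_le_comap.1 ?_ : _ ≤ (filt W p ι' k).comap h) h1
    rw [Ideal.map_span, Ideal.span_le]
    rintro _ ⟨_, ⟨i, rfl⟩, rfl⟩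
    change h (X i ^ k) ∈ _
    rw [map_pow]
    exact pow_mem_filt p (hh i) k
  have h3 : f t = g t := by
    have : (f.comp MvPolynomial.coeToMvPowerSeries.ringHom) =
        g.comp MvPolynomial.coeToMvPowerSeries.ringHom := by
      refine MvPolynomial.ringHom_ext (fun w => ?_) fun i => ?_
      · simpa using hC w
      · simpa using hX i
    exact congrArg (fun h : MvPolynomial ι W →+* MvPowerSeries ι' W => h t) this
  have h4 : f s - g s = f (s - t) - g (s - t) := by
    rw [map_sub, map_sub, h3]
    ring
  rw [h4]
  exact sub_mem (h2 f hf) (h2 g fun i => hX i ▸ hf i)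

variable [Fact p.Prime]

/-- Both maps agree on integers, and every `p`-adic integer is an integer modulo `p ^ k`; the
difference is divisible by all powers of `p`. -/
lemma padicInt_ringHom_ext {f g : ℤ_[p] →+* MvPowerSeries ι W} : f = g := by
  ext1 a
  rw [← sub_eq_zero]
  ext e
  refine eq_zero_of_forall_pow_dvd p _ fun k => ?_
  have h := PadicInt.appr_spec k a
  obtain ⟨b, hb⟩ := Ideal.mem_span_singleton.1 h
  have h1 : f a - g a = ((p ^ k : ℕ) : MvPowerSeries ι W) * (f b - g b) := by
    have h2 : a = (a.appr k : ℤ_[p]) + (p : ℤ_[p]) ^ k * b := by rw [← hb]; ring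
    rw [h2]
    simp only [map_add, map_mul, map_pow, map_natCast]
    push_cast
    ring
  rw [h1, ← nsmul_eq_mul, map_nsmul, nsmul_eq_mul]
  push_cast
  exact dvd_mul_right _ _

end Filtration

/-! ### Evaluation of power series -/

section Evaluation

open MvPowerSeries MvPowerSeries.WithPiTopology

lemma exists_evalHom {W S : Type*} [CommRing W] [CommRing S] [UniformSpace S] [IsUniformAddGroup S]
    [CompleteSpace S] [T2Space S] [IsTopologicalRing S] [IsLinearTopology S S] {ι : Type*} [Finite ι]
    (φ : W →+* S) (a : ι → S) (ha : ∀ i, IsTopologicallyNilpotent (a i)) :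
    ∃ ψ : MvPowerSeries ι W →+* S, (∀ w, ψ (C w) = φ w) ∧ ∀ i, ψ (X i) = a i := by
  -- The coefficients of the source are taken discrete, so that every `φ` is continuous; only the
  -- target needs a genuine topology.
  let : UniformSpace W := ⊥
  have : DiscreteTopology W := ⟨rfl⟩
  have : IsUniformAddGroup W := ⟨by fun_prop⟩
  have hφ : Continuous φ := continuous_of_discreteTopology
  have ha' : HasEval a := ⟨ha, by rw [Filter.cofinite_eq_bot]; exact Filter.tendsto_bot⟩
  refine ⟨eval₂Hom hφ ha', fun w => ?_, fun i => ?_⟩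
  · rw [coe_eval₂Hom, eval₂_C]
  · rw [coe_eval₂Hom, eval₂_X]

/-- Evaluation of power series over a `p`-adically complete ring at power series whose constant
coefficients are divisible by `p`. -/
lemma exists_evalHom_mvPowerSeries {W : Type u} [CommRing W] (p : ℕ)
    [IsAdicComplete (Ideal.span {(p : W)}) W] {ι ι' : Type*} [Finite ι] (φ : W →+* MvPowerSeries ι' W)
    (a : ι → MvPowerSeries ι' W) (ha : ∀ i, a i ∈ filt W p ι' 1) :
    ∃ ψ : MvPowerSeries ι W →+* MvPowerSeries ι' W,
      (∀ w, ψ (C w) = φ w) ∧ ∀ i, ψ (X i) = a i := by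
  let : WithIdeal W := ⟨Ideal.span {(p : W)}⟩
  have hI : IsAdic (Ideal.span {(p : W)}) := rfl
  have ⟨_, _⟩ := hI.isAdicComplete_iff.1 inferInstance
  refine exists_evalHom φ a fun i => ?_
  refine LinearTopology.isTopologicallyNilpotent_of_constantCoeff ?_
  exact WithIdeal.isTopologicallyNilpotent_of_mem
    (Ideal.mem_span_singleton.2 ((mem_filt_one_iff p).1 (ha i)))

end Evaluation

/-! ### The automorphism `σ ⊗ σ` -/

section DiagonalLift

open MvPowerSeries IsLocalRing

variable (p : ℕ) [Fact p.Prime] {W : Type u} [CommRing W] [Algebra ℤ_[p] W] {d : ℕ}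

/-- A ring automorphism is an automorphism of `ℤ_p`-algebras. -/
lemma exists_algEquiv_eq [IsHausdorff (Ideal.span {(p : W)}) W] (σ : PS W d ≃+* PS W d) :
    ∃ σa : PS W d ≃ₐ[ℤ_[p]] PS W d, σa.toRingEquiv = σ := by
  refine ⟨AlgEquiv.ofRingEquiv (f := σ) fun a => ?_, rfl⟩
  exact congrArg (fun f : ℤ_[p] →+* PS W d => f a) (padicInt_ringHom_ext p
    (f := (σ : PS W d →+* PS W d).comp (algebraMap ℤ_[p] (PS W d)))
    (g := algebraMap ℤ_[p] (PS W d)))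

/-- The two sides are `ℤ_p`-algebra maps from `W` to `R` that agree modulo the augmentation ideal,
whose powers intersect in zero. Formal unramifiedness forces them to be equal. -/
lemma map_C_eq [IsHausdorff (Ideal.span {(p : W)}) W] [Algebra.FormallyUnramified ℤ_[p] W]
    (σ : PS W d ≃ₐ[ℤ_[p]] PS W d) (w : W) : σ (C w) = C (constantCoeff (σ (C w))) := by
  let c : W →ₐ[ℤ_[p]] PS W d := IsScalarTower.toAlgHom ℤ_[p] W (PS W d)
  let k : PS W d →ₐ[ℤ_[p]] W :=
    { (constantCoeff : PS W d →+* W) with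
      commutes' := fun a => by
        change constantCoeff (algebraMap ℤ_[p] (PS W d) a) = _
        rw [MvPowerSeries.algebraMap_apply, constantCoeff_C] }
  let I : Ideal (PS W d) := RingHom.ker (constantCoeff : PS W d →+* W)
  have hI : ⨅ i, I ^ i = ⊥ := by
    rw [eq_bot_iff]
    intro s hs
    refine eq_zero_of_forall_mem_filt p s fun i => ideal_pow_le_filt p (fun t ht => ?_) i
      ((Submodule.mem_iInf _).1 hs i)
    rw [mem_filt_one_iff, RingHom.mem_ker.1 ht]
    exact dvd_zero _
  have h := Algebra.FormallyUnramified.ext_of_iInf (R := ℤ_[p]) I hI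
    (g₁ := σ.toAlgHom.comp c) (g₂ := c.comp (k.comp (σ.toAlgHom.comp c))) (fun x => by
      rw [Ideal.Quotient.eq, RingHom.mem_ker, map_sub, sub_eq_zero]
      exact (constantCoeff_C (constantCoeff (σ (C x)))).symm)
  exact congrArg (fun f : W →ₐ[ℤ_[p]] PS W d => f w) h

/-- The automorphism of `W` induced by an automorphism of `W⟦x⟧`. -/
lemma exists_constAut [IsHausdorff (Ideal.span {(p : W)}) W] [Algebra.FormallyUnramified ℤ_[p] W]
    (σ : PS W d ≃ₐ[ℤ_[p]] PS W d) : ∃ σW : W ≃ₐ[ℤ_[p]] W, ∀ w, σ (C w) = C (σW w) := by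
  have key : ∀ (σ : PS W d ≃ₐ[ℤ_[p]] PS W d) (w : W),
      constantCoeff (σ.symm (C (constantCoeff (σ (C w))))) = w := fun σ w => by
    rw [← map_C_eq, σ.symm_apply_apply, constantCoeff_C]
  refine ⟨
    { toFun := fun w => constantCoeff (σ (C w))
      invFun := fun w => constantCoeff (σ.symm (C w))
      left_inv := key σ
      right_inv := key σ.symm
      map_mul' := fun a b => by simp only [map_mul]
      map_add' := fun a b => by simp only [map_add]
      commutes' := fun a => by
        rw [← MvPowerSeries.algebraMap_apply, σ.commutes, MvPowerSeries.algebraMap_apply,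
          constantCoeff_C] }, fun w => map_C_eq p σ w⟩

lemma inclLeft_C (w : W) : inclLeft W d (C w) = C w := rename_C _ _

lemma inclRight_C (w : W) : inclRight W d (C w) = C w := rename_C _ _

lemma diag_C (w : W) : diag W d (C w) = C w := rename_C _ _

lemma inclLeft_X (i : Fin d) : inclLeft W d (X i) = X (Sum.inl i) := rename_X _ _

lemma inclRight_X (i : Fin d) : inclRight W d (X i) = X (Sum.inr i) := rename_X _ _

end DiagonalLift

section DiagonalLift

open MvPowerSeries IsLocalRing

variable (p : ℕ) {W : Type u} [CommRing W] {d : ℕ} [IsLocalRing W]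

lemma mem_filt_one_iff_not_isUnit (hm : maximalIdeal W = Ideal.span {(p : W)}) {ι : Type*}
    (s : MvPowerSeries ι W) : s ∈ filt W p ι 1 ↔ ¬ IsUnit s := by
  rw [mem_filt_one_iff, ← Ideal.mem_span_singleton, ← hm, mem_maximalIdeal, mem_nonunits_iff,
    isUnit_iff_constantCoeff]

/-- An automorphism preserves nonunits but not the ideal of the variables: the constant coefficient
of `σ (X i)` can be a nonzero multiple of `p`. Hence `p` is included in the filtration. -/
lemma map_X_mem_filt_one (hm : maximalIdeal W = Ideal.span {(p : W)}) (σ : PS W d ≃+* PS W d)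
    (i : Fin d) : σ (X i) ∈ filt W p (Fin d) 1 := by
  rw [mem_filt_one_iff_not_isUnit p hm, MulEquiv.isUnit_map, ← mem_filt_one_iff_not_isUnit p hm,
    mem_filt_one_iff, constantCoeff_X]
  exact dvd_zero _

lemma inclLeft_mem_filt_one (hm : maximalIdeal W = Ideal.span {(p : W)}) {r : PS W d}
    (hr : r ∈ filt W p (Fin d) 1) : inclLeft W d r ∈ filt W p (Fin d ⊕ Fin d) 1 := by
  rw [mem_filt_one_iff_not_isUnit p hm] at hr ⊢
  intro h
  rw [← diag_inclLeft W d r] at hr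
  exact hr (h.map (diag W d))

lemma inclRight_mem_filt_one (hm : maximalIdeal W = Ideal.span {(p : W)}) {r : PS W d}
    (hr : r ∈ filt W p (Fin d) 1) : inclRight W d r ∈ filt W p (Fin d ⊕ Fin d) 1 := by
  rw [mem_filt_one_iff_not_isUnit p hm] at hr ⊢
  intro h
  rw [← diag_inclRight W d r] at hr
  exact hr (h.map (diag W d))

variable [IsHausdorff (Ideal.span {(p : W)}) W] in
lemma diagonalHom_ext (hm : maximalIdeal W = Ideal.span {(p : W)}) (σ : PS W d ≃+* PS W d)
    {f g : PS₂ W d →+* PS₂ W d} (hfl : ∀ r, f (inclLeft W d r) = inclLeft W d (σ r))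
    (hfr : ∀ r, f (inclRight W d r) = inclRight W d (σ r))
    (hgl : ∀ r, g (inclLeft W d r) = inclLeft W d (σ r))
    (hgr : ∀ r, g (inclRight W d r) = inclRight W d (σ r)) : f = g := by
  refine mvPowerSeries_ringHom_ext p (fun w => ?_) ?_ ?_
  · rw [← inclLeft_C, hfl, hgl]
  · rintro (i | i)
    · rw [← inclLeft_X, hfl, hgl]
    · rw [← inclRight_X, hfr, hgr]
  · rintro (i | i)
    · rw [← inclLeft_X, hfl]
      exact inclLeft_mem_filt_one p hm (map_X_mem_filt_one p hm σ i)
    · rw [← inclRight_X, hfr]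
      exact inclRight_mem_filt_one p hm (map_X_mem_filt_one p hm σ i)

variable [Fact p.Prime] [Algebra ℤ_[p] W] [Algebra.FormallyUnramified ℤ_[p] W]
variable [IsAdicComplete (Ideal.span {(p : W)}) W]

/-- The ring endomorphism `σ ⊗ σ` of `W⟦x, y⟧`. -/
lemma exists_diagonalHom (hm : maximalIdeal W = Ideal.span {(p : W)}) (σ : PS W d ≃+* PS W d) :
    ∃ ψ : PS₂ W d →+* PS₂ W d, (∀ r, ψ (inclLeft W d r) = inclLeft W d (σ r)) ∧
      (∀ r, ψ (inclRight W d r) = inclRight W d (σ r)) ∧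
      ∀ s, diag W d (ψ s) = σ (diag W d s) := by
  obtain ⟨σ, rfl⟩ := exists_algEquiv_eq p σ
  obtain ⟨σW, hσW⟩ := exists_constAut p σ
  have hX := map_X_mem_filt_one p hm σ.toRingEquiv
  -- Constants are sent by the induced automorphism of `W`, and each copy of the variables to the
  -- corresponding copy of the `σ (X i)`.
  obtain ⟨ψ, hC, hψ⟩ := exists_evalHom_mvPowerSeries p ((C : W →+* PS₂ W d).comp (σW : W →+* W))
    (Sum.elim (fun i => inclLeft W d (σ (X i))) (fun i => inclRight W d (σ (X i)))) (by
      rintro (i | i)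
      · exact inclLeft_mem_filt_one p hm (hX i)
      · exact inclRight_mem_filt_one p hm (hX i))
  have hC' : ∀ w, ψ (C w) = C (σW w) := hC
  have hl : ∀ i, ψ (X (Sum.inl i)) = inclLeft W d (σ (X i)) := fun i => hψ (Sum.inl i)
  have hr : ∀ i, ψ (X (Sum.inr i)) = inclRight W d (σ (X i)) := fun i => hψ (Sum.inr i)
  have h1 : ψ.comp (inclLeft W d) = (inclLeft W d).comp (σ.toRingEquiv : PS W d →+* PS W d) := by
    refine mvPowerSeries_ringHom_ext p (fun w => ?_) (fun i => ?_) fun i => ?_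
    · change ψ (inclLeft W d (C w)) = inclLeft W d (σ (C w))
      rw [inclLeft_C, hC', hσW, inclLeft_C]
    · exact (congrArg ψ (inclLeft_X i)).trans (hl i)
    · refine Set.mem_of_eq_of_mem ((congrArg ψ (inclLeft_X i)).trans (hl i)) ?_
      exact inclLeft_mem_filt_one p hm (hX i)
  have h2 : ψ.comp (inclRight W d) = (inclRight W d).comp (σ.toRingEquiv : PS W d →+* PS W d) := by
    refine mvPowerSeries_ringHom_ext p (fun w => ?_) (fun i => ?_) fun i => ?_
    · change ψ (inclRight W d (C w)) = inclRight W d (σ (C w))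
      rw [inclRight_C, hC', hσW, inclRight_C]
    · exact (congrArg ψ (inclRight_X i)).trans (hr i)
    · refine Set.mem_of_eq_of_mem ((congrArg ψ (inclRight_X i)).trans (hr i)) ?_
      exact inclRight_mem_filt_one p hm (hX i)
  have hd : ∀ j, diag W d (X j) = X (Sum.elim id id j) := fun j => rename_X _ _
  have h3 : ∀ j, diag W d (ψ (X j)) = σ (X (Sum.elim id id j)) := by
    rintro (i | i)
    · rw [hl, diag_inclLeft]
      rfl
    · rw [hr, diag_inclRight]
      rfl
  have h4 : (diag W d).comp ψ = (σ.toRingEquiv : PS W d →+* PS W d).comp (diag W d) := by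
    refine mvPowerSeries_ringHom_ext p (fun w => ?_) (fun j => ?_) fun j => ?_
    · change diag W d (ψ (C w)) = σ (diag W d (C w))
      rw [hC', diag_C, diag_C, hσW]
    · exact (h3 j).trans (congrArg σ (hd j)).symm
    · exact Set.mem_of_eq_of_mem (h3 j) (hX _)
  exact ⟨ψ, fun r => congrArg (fun f : PS W d →+* PS₂ W d => f r) h1,
    fun r => congrArg (fun f : PS W d →+* PS₂ W d => f r) h2,
    fun s => congrArg (fun f : PS₂ W d →+* PS W d => f s) h4⟩

theorem existsUnique_isDiagonalLift (hm : maximalIdeal W = Ideal.span {(p : W)})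
    (σ : PS W d ≃+* PS W d) : ∃! σ₂ : PS₂ W d ≃+* PS₂ W d, IsDiagonalLift σ σ₂ := by
  obtain ⟨ψ, hl, hr, hd⟩ := exists_diagonalHom p hm σ
  obtain ⟨ψ', hl', hr', -⟩ := exists_diagonalHom p hm σ.symm
  have h1 : ψ'.comp ψ = RingHom.id _ :=
    diagonalHom_ext p hm (RingEquiv.refl _) (fun r => by simp [hl, hl']) (fun r => by simp [hr, hr'])
      (fun r => rfl) fun r => rfl
  have h2 : ψ.comp ψ' = RingHom.id _ :=
    diagonalHom_ext p hm (RingEquiv.refl _) (fun r => by simp [hl, hl']) (fun r => by simp [hr, hr'])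
      (fun r => rfl) fun r => rfl
  refine ⟨RingEquiv.ofRingHom ψ ψ' h2 h1, ⟨hl, hr, hd⟩, fun σ₂ h => ?_⟩
  refine RingEquiv.ext fun s => ?_
  exact congrArg (fun f : PS₂ W d →+* PS₂ W d => f s)
    (diagonalHom_ext p hm σ (f := (σ₂ : PS₂ W d →+* PS₂ W d)) (g := ψ) h.left h.right hl hr)

end DiagonalLift

end GrossHopkins
end

noncomputable section

namespace GrossHopkins

/-! ### The duality isomorphism and its naturality -/

section Duality

open Abelian MvPowerSeries IsLocalRing

variable {W : Type u} [CommRing W] {d : ℕ} {p : ℕ} [Fact p.Prime] [Algebra ℤ_[p] W]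

/-- The pullback of a linear form along a skew homomorphism. -/
def PontryaginDual.skewComap (σ : PS W d ≃ₐ[ℤ_[p]] PS W d) {M M' : ModuleCat.{u} (PS W d)}
    (τ : M →ₛₗ[(σ.toRingEquiv : PS W d →+* PS W d)] M') (f : PontryaginDual p M') :
    PontryaginDual p M :=
  f.toLin ∘ₗ
    ({ toFun := fun m => τ m
       map_add' := τ.map_add
       map_smul' := fun a m => by
        refine (τ.map_smulₛₗ (algebraMap ℤ_[p] (PS W d) a) m).trans ?_
        exact congrArg (fun r : PS W d => r • τ m) (σ.commutes a) } :
      (ModuleCat.restrictScalars.{u} (algebraMap ℤ_[p] (PS W d))).obj M →ₗ[ℤ_[p]]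
        (ModuleCat.restrictScalars.{u} (algebraMap ℤ_[p] (PS W d))).obj M')

lemma PontryaginDual.skewComap_apply (σ : PS W d ≃ₐ[ℤ_[p]] PS W d)
    {M M' : ModuleCat.{u} (PS W d)} (τ : M →ₛₗ[(σ.toRingEquiv : PS W d →+* PS W d)] M')
    (f : PontryaginDual p M') (m : M) : f.skewComap σ τ m = f (τ m) := rfl

lemma PontryaginDual.smul_apply {M : ModuleCat.{u} (PS W d)} (r : PS W d)
    (f : PontryaginDual p M) (m : M) : (r • f) m = f (r • m) := rfl

variable [Nontrivial W]

variable (W d) in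
/-- The trivialization of `L` given by the cap product with the fundamental class. -/
def capEquiv : twistModule W d ≃ₗ[PS W d] PS W d :=
  LinearEquiv.ofBijective
    ({ toFun := fun l => (show PS W d from (cap (ringClass W d)).hom l)
       map_add' := fun a b => map_add (cap (ringClass W d)).hom a b
       map_smul' := fun r l => by
        refine (map_smul (cap (ringClass W d)).hom (inclLeft W d r) l).trans ?_
        change diag W d (inclLeft W d r) * _ = r * _
        rw [diag_inclLeft]
        rfl } : twistModule W d →ₗ[PS W d] PS W d)
    ((ConcreteCategory.isIso_iff_bijective (cap (ringClass W d))).1 inferInstance)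

variable [Algebra.FormallyUnramified ℤ_[p] W] [Algebra.EssFiniteType ℤ_[p] W]
variable [Module.Flat ℤ_[p] (PS W d)]

/-- The duality isomorphism `Hom(M, ℤ/p^∞) ≅ Ext^{d+1}(M, R)`. -/
def thetaEquiv {M : ModuleCat.{u} (PS W d)} (hM : IsXTorsion M)
    (hbij : Function.Bijective fun f : PontryaginDual p M => theta hM f) :
    PontryaginDual p M ≃ₗ[PS W d] Ext.{u} M (ModuleCat.of (PS W d) (PS W d)) (d + 1) :=
  LinearEquiv.ofBijective
    { toFun := fun f => theta hM f
      map_add' := theta_add hM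
      map_smul' := theta_smul hM } hbij

/-- The isomorphism `L ⊗ Ext^{d+1}(M, R) ≅ Hom(M, ℤ/p^∞)`. -/
def dualityEquiv {M : ModuleCat.{u} (PS W d)} (hM : IsXTorsion M)
    (hbij : Function.Bijective fun f : PontryaginDual p M => theta hM f) :
    twistModule W d ⊗[PS W d] Ext.{u} M (ModuleCat.of (PS W d) (PS W d)) (d + 1) ≃ₗ[PS W d]
      PontryaginDual p M :=
  (TensorProduct.congr (capEquiv W d) (thetaEquiv hM hbij).symm).trans (TensorProduct.lid _ _)

lemma dualityEquiv_tmul {M : ModuleCat.{u} (PS W d)} (hM : IsXTorsion M)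
    (hbij : Function.Bijective fun f : PontryaginDual p M => theta hM f) (l : twistModule W d)
    (f : PontryaginDual p M) :
    dualityEquiv hM hbij (l ⊗ₜ theta hM f) = capEquiv W d l • f := by
  have h : (thetaEquiv hM hbij).symm (theta hM f) = f := (thetaEquiv hM hbij).symm_apply_apply f
  rw [dualityEquiv, LinearEquiv.trans_apply, TensorProduct.congr_tmul, TensorProduct.lid_tmul, h]

/-- Write `e` as `theta (v • f)`; its pullback is `theta` of the form `f ∘ τ`. Then the left side is
`f(σ(cap l) τ m)`, the right side is `f(v cap(σ_* l) τ m)`, and the two scalars agree. -/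
lemma dualityEquiv_skew [IsHausdorff (Ideal.span {(p : W)}) W] {M M' : ModuleCat.{u} (PS W d)}
    (hM : IsXTorsion M) (hbij : Function.Bijective fun f : PontryaginDual p M => theta hM f)
    (hM' : IsXTorsion M') (hbij' : Function.Bijective fun f : PontryaginDual p M' => theta hM' f)
    {σ : PS W d ≃+* PS W d} {σ₂ : PS₂ W d ≃+* PS₂ W d} (hσ : IsDiagonalLift σ σ₂)
    (τ : M →ₛₗ[(σ : PS W d →+* PS W d)] M') (l : twistModule W d)
    (e : Ext.{u} M' (ModuleCat.of (PS W d) (PS W d)) (d + 1)) (m : M) :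
    dualityEquiv hM hbij (l ⊗ₜ extSkew σ τ (d + 1) e) m =
      dualityEquiv hM' hbij' (twistAction hσ l ⊗ₜ e) (τ m) := by
  obtain ⟨σ, rfl⟩ := exists_algEquiv_eq p σ
  obtain ⟨σW, hσW⟩ := exists_constAut p σ
  obtain ⟨v, hv⟩ := exists_fundClass_comp_skewBaseChange hσ
  have hcap : ∀ l, σ (capEquiv W d l) = v * capEquiv W d (twistAction hσ l) :=
    map_cap_ringClass hσ hv
  obtain ⟨f', rfl⟩ := hbij'.2 e
  -- `v` is a unit: for the `l` with coordinate `1`, the relation `hcap` reads `1 = v * capEquiv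
  -- (σ_* l)`.
  obtain ⟨f, rfl⟩ : ∃ f, f' = v • f := by
    have h1 := hcap ((capEquiv W d).symm 1)
    rw [LinearEquiv.apply_symm_apply, map_one] at h1
    exact ⟨capEquiv W d (twistAction hσ ((capEquiv W d).symm 1)) • f', by
      rw [smul_smul, ← h1, one_smul]⟩
  have h2 := theta_skew σ σW hσW hσ hM hM' τ (hv M M' τ) (f.skewComap σ τ) f fun m => rfl
  dsimp only
  rw [dualityEquiv_tmul, theta_smul, ← h2, dualityEquiv_tmul, PontryaginDual.smul_apply,
    PontryaginDual.skewComap_apply, PontryaginDual.smul_apply, PontryaginDual.smul_apply, smul_smul,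
    ← hcap]
  exact congrArg f (τ.map_smulₛₗ _ _)

end Duality

end GrossHopkins
end

theorem mainTheorem9 (p : ℕ) [Fact p.Prime]
    -- `W` is the ring of integers of a finite unramified extension `K` of `ℚ_p`
    (K : Type u) [Field K] [Algebra ℚ_[p] K] [FiniteDimensional ℚ_[p] K]
    [Algebra ℤ_[p] K] [IsScalarTower ℤ_[p] ℚ_[p] K]
    (W : Type u) [CommRing W] [Algebra ℤ_[p] W] [Algebra W K] [IsScalarTower ℤ_[p] W K]
    [IsIntegralClosure W ℤ_[p] K] [Algebra.Unramified ℤ_[p] W]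
    (n : ℕ) (hn : 1 ≤ n) :
    -- `L` is free of rank one over `R`
    Nonempty (GrossHopkins.twistModule W (n - 1) ≃ₗ[GrossHopkins.PS W (n - 1)]
      GrossHopkins.PS W (n - 1)) ∧
    -- every automorphism `σ` of `R` induces a unique automorphism `σ ⊗ σ` of `S`
    (∀ σ : GrossHopkins.PS W (n - 1) ≃+* GrossHopkins.PS W (n - 1),
      ∃! σ₂ : GrossHopkins.PS₂ W (n - 1) ≃+* GrossHopkins.PS₂ W (n - 1),
        GrossHopkins.IsDiagonalLift σ σ₂) ∧
    -- the isomorphisms `L ⊗_R Ext^n_R(M, R) ≅ Hom_{ℤ_p}(M, ℤ/p^∞)`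
    ∃ Φ : ∀ M : ModuleCat.{u} (GrossHopkins.PS W (n - 1)),
        IsFiniteLength (GrossHopkins.PS W (n - 1)) M →
          (GrossHopkins.twistModule W (n - 1) ⊗[GrossHopkins.PS W (n - 1)]
              Abelian.Ext.{u} M
                (ModuleCat.of (GrossHopkins.PS W (n - 1)) (GrossHopkins.PS W (n - 1))) n
            ≃ₗ[GrossHopkins.PS W (n - 1)] GrossHopkins.PontryaginDual p M),
      -- naturality with respect to skew homomorphisms `(σ, τ) : M → M'`
      ∀ (M M' : ModuleCat.{u} (GrossHopkins.PS W (n - 1)))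
        (hM : IsFiniteLength (GrossHopkins.PS W (n - 1)) M)
        (hM' : IsFiniteLength (GrossHopkins.PS W (n - 1)) M')
        (σ : GrossHopkins.PS W (n - 1) ≃+* GrossHopkins.PS W (n - 1))
        (σ₂ : GrossHopkins.PS₂ W (n - 1) ≃+* GrossHopkins.PS₂ W (n - 1))
        (hσ : GrossHopkins.IsDiagonalLift σ σ₂)
        (τ : M →ₛₗ[(σ : GrossHopkins.PS W (n - 1) →+* GrossHopkins.PS W (n - 1))] M')
        (l : GrossHopkins.twistModule W (n - 1))
        (e : Abelian.Ext.{u} M'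
          (ModuleCat.of (GrossHopkins.PS W (n - 1)) (GrossHopkins.PS W (n - 1))) n)
        (m : M),
        Φ M hM (l ⊗ₜ GrossHopkins.extSkew σ τ n e) m =
          Φ M' hM' (GrossHopkins.twistAction hσ l ⊗ₜ e) (τ m) := by
  have hinj : Function.Injective (algebraMap W K) :=
    IsIntegralClosure.algebraMap_injective W ℤ_[p] K
  have : IsDomain W := hinj.isDomain (algebraMap W K)
  have : Module.Finite ℤ_[p] W := IsIntegralClosure.finite ℤ_[p] ℚ_[p] K W
  have : Module.IsTorsionFree ℤ_[p] K := Module.IsTorsionFree.trans_faithfulSMul ℤ_[p] ℚ_[p] K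
  have : Module.Free ℤ_[p] W := IsIntegralClosure.module_free ℤ_[p] ℚ_[p] K W
  have : IsLocalRing W := GrossHopkins.isLocalRing_of_finite_free p W
  have hm := GrossHopkins.maximalIdeal_eq_span_p p W
  have hp := GrossHopkins.natCast_p_ne_zero p W
  have := GrossHopkins.isAdicComplete_span_p p W
  -- With `1 ≤ n` the truncated subtraction is harmless, and the degree `n` takes the form `d + 1`
  -- in which `theta` is defined.
  generalize hd : n - 1 = d
  obtain rfl : n = d + 1 := by omega
  have hdual := fun (M : ModuleCat.{u} (GrossHopkins.PS W d))
      (hM : IsFiniteLength (GrossHopkins.PS W d) M) =>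
    GrossHopkins.isDualizable_of_isFiniteLength hp hm M hM
  refine ⟨⟨GrossHopkins.capEquiv W d⟩, GrossHopkins.existsUnique_isDiagonalLift p hm,
    fun M hM => GrossHopkins.dualityEquiv (hdual M hM).isXTorsion ((hdual M hM).bijective _), ?_⟩
  intro M M' hM hM' σ σ₂ hσ τ l e m
  exact GrossHopkins.dualityEquiv_skew _ _ _ _ hσ τ l e m
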